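/- Let $m\ge 1$ and $n\ge 0$. The complex reflection group $G(m,1,n+1)$ is generated by $s_1,\dots,s_n,t$ with defining relations $s_i^2=1$; $s_is_{i+1}s_i=s_{i+1}s_is_{i+1}$; $s_is_j=s_js_i$ for $|i-j|>1$; $ts_1ts_1=s_1ts_1t$; $s_it=ts_i$ for $i\ge 2$; $t^m=1$. Let $\{\xi_1,\dots,\xi_m\}$ be the set of all $m$-th roots of unity, ordered arbitrarily. An $m$-partition is an $m$-tuple of Young diagrams; a node in row $x$ and column $y$ of the $k$-th diagram has content $y-x$ and position $\xi_k$. A standard $m$-tableau of shape $\mu$ is a filling of the nodes of $\mu$, an $m$-partition with $n+1$ nodes in total, by $1,\dots,n+1$, each used once, ascending along the rows and columns of each diagram. For a standard $m$-tableau $T$ let $c_i(T)$ and $p_i(T)$ be the content and the position of the node with the number $i$. The irreducible representation $V_\mu$ of $G(m,1,n+1)$ has the semi-normal basis $e_T$, $T$ running over the standard $m$-tableaux of shape $\mu$, with $t\,e_T=p_1(T)e_T$ and $s_i e_T=a\,e_T+(1+a)\,e_{s_iT}$, where $a=\delta_{p_i(T),p_{i+1}(T)}/(c_{i+1}(T)-c_i(T))$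 (read as $0$ if $p_i(T)\ne p_{i+1}(T)$), $s_iT$ is $T$ with $i$ and $i+1$ interchanged, and $e_{s_iT}:=0$ if $s_iT$ is not standard. For a standard $m$-tableau $T$ of shape $\lambda^{(m)}$, $E_T\in\mathbb{C}G(m,1,n+1)$ denotes the corresponding primitive idempotent: the unique element that acts on $V_{\lambda^{(m)}}$ as the projector onto $e_T$ along the other basis vectors, and as $0$ on $V_\mu$ for every $\mu\neq\lambda^{(m)}$. Put $s_i(p,p',a,a'):=s_i+\frac{\delta_{p,p'}}{a-a'}$ (the second term being $0$ if $p\neq p'$), $t(v):=\frac1m\sum_{k=0}^{m-1}v^{m-k}t^k$, $\phi_1(v,u):=t(v)$ and, for $k=1,\dots,n$, $$\phi_{k+1}(v_1,\dots,v_k,v,u_1,\dots,u_k,u):=s_k(v,v_k,u,u_k)\,\phi_k(v_1,\dots,v_{k-1},v,u_1,\dots,u_{k-1},u)\,s_k ,$$ and let $$\Phi(v_1,\dots,v_{n+1},u_1,\dots,u_{n+1}):=\phi_{n+1}(v_1,\dots,v_{n+1},u_1,\dots,u_{n+1})\cdots\phi_2(v_1,v_2,u_1,u_2)\,\phi_1(v_1,u_1).$$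 **Theorem.** Let $\lambda^{(m)}$ be an $m$-partition with $n+1$ nodes, $T$ a standard $m$-tableau of shape $\lambda^{(m)}$, $p_i:=p_i(T)$, $c_i:=c_i(T)$, and let $f_{\lambda^{(m)}}$ be the inverse of the product of the hook lengths of all nodes of $\lambda^{(m)}$ (the hook length of a node being taken in its own diagram). Then $$E_T=f_{\lambda^{(m)}}\,\Phi(v_1,\dots,v_{n+1},u_1,\dots,u_{n+1})\Big|_{v_i=p_i,\ i=1,\dots,n+1}\Big|_{u_1=c_1}\cdots\Big|_{u_n=c_n}\Big|_{u_{n+1}=c_{n+1}} ,$$ where the evaluations in $u_1,\dots,u_{n+1}$ are made one after another in this order, each of them being the evaluation of a rational function with values in $\mathbb{C}G(m,1,n+1)$ that is non-singular at the point of evaluation. -/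

import Mathlib

namespace CyclotomicFusion

/-! ### The complex reflection group `G(m,1,n+1)` -/

/-- Generators `t, s₁, …, sₙ` of `G(m,1,n+1)`; `s i` with `i : Fin n` (counted from `0`) stands for
the generator `s_{i+1}`. -/
inductive Gen (n : ℕ) : Type
  | t : Gen n
  | s (i : Fin n) : Gen n

/-- The generator `t` in the free group. -/
def ft (n : ℕ) : FreeGroup (Gen n) := FreeGroup.of Gen.t

/-- The generator `s_{i+1}` in the free group. -/
def fs {n : ℕ} (i : Fin n) : FreeGroup (Gen n) := FreeGroup.of (Gen.s i)

/-- The defining relators of `G(m,1,n+1)`. -/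
inductive IsRelator (m n : ℕ) : FreeGroup (Gen n) → Prop
  | s_sq (i : Fin n) : IsRelator m n (fs i * fs i)
  | s_braid (i j : Fin n) (h : (j : ℕ) = i + 1) :
      IsRelator m n (fs i * fs j * fs i * (fs j * fs i * fs j)⁻¹)
  | s_comm (i j : Fin n) (h : (i : ℕ) + 1 < j) :
      IsRelator m n (fs i * fs j * (fs j * fs i)⁻¹)
  | t_braid (i : Fin n) (h : (i : ℕ) = 0) :
      IsRelator m n (ft n * fs i * ft n * fs i * (fs i * ft n * fs i * ft n)⁻¹)
  | t_comm (i : Fin n) (h : 0 < (i : ℕ)) :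
      IsRelator m n (fs i * ft n * (ft n * fs i)⁻¹)
  | t_pow : IsRelator m n (ft n ^ m)

/-- The complex reflection group `G(m,1,n+1)`, given by generators and relations. -/
abbrev G (m n : ℕ) : Type := PresentedGroup {r | IsRelator m n r}

/-- The element `t` of `G(m,1,n+1)`. -/
def gt (m n : ℕ) : G m n := PresentedGroup.of Gen.t

/-- The element `s_{i+1}` of `G(m,1,n+1)`. -/
def gs (m : ℕ) {n : ℕ} (i : Fin n) : G m n := PresentedGroup.of (Gen.s i)

/-! ### `m`-partitions, standard `m`-tableaux, contents and hooks

An `m`-partition is a family `μ : Fin m → YoungDiagram`; an `m`-node is a pair `(k, (x, y))` with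
position `k`, row `x` and column `y`. -/

/-- An `m`-node: position, and (row, column) in the diagram at that position. -/
abbrev Node (m : ℕ) : Type := Fin m × (ℕ × ℕ)

/-- The content `column - row` of an `m`-node. -/
def content {m : ℕ} (q : Node m) : ℤ := (q.2.2 : ℤ) - (q.2.1 : ℤ)

/-- `w`, listing the nodes that carry the numbers `1, …, n+1`, is a standard filling of the
`m`-partition `μ`: each node of `μ` carries exactly one number, and the numbers ascend along the
rows and the columns of each diagram. -/
structure IsStandard {m n : ℕ} (μ : Fin m → YoungDiagram) (w : Fin (n + 1) → Node m) : Prop where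
  inj : Function.Injective w
  mem_range : ∀ q : Node m, (∃ a, w a = q) ↔ q.2 ∈ μ q.1
  row : ∀ a b, (w a).1 = (w b).1 → (w a).2.1 = (w b).2.1 → (w a).2.2 < (w b).2.2 → a < b
  col : ∀ a b, (w a).1 = (w b).1 → (w a).2.2 = (w b).2.2 → (w a).2.1 < (w b).2.1 → a < b

/-- A standard `m`-tableau of shape `μ` with entries `1, …, n+1`; `node i` is the node carrying the
number `i + 1`. -/
structure StdTableau {m : ℕ} (n : ℕ) (μ : Fin m → YoungDiagram) where
  node : Fin (n + 1) → Node m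
  std : IsStandard μ node

namespace StdTableau

variable {m n : ℕ} {μ : Fin m → YoungDiagram}

/-- The content `c_{i+1}` of the node carrying `i + 1`. -/
def c (T : StdTableau n μ) (i : Fin (n + 1)) : ℤ := content (T.node i)

/-- The root of unity `p_{i+1}` attached to the position of the node carrying `i + 1`; `ξ` is the
chosen ordering of the `m`-th roots of unity. -/
noncomputable def p (ξ : Fin m ≃ rootsOfUnity m ℂ) (T : StdTableau n μ) (i : Fin (n + 1)) : ℂ :=
  ((ξ (T.node i).1 : ℂˣ) : ℂ)

end StdTableau

/-- Hook length of the node `q` in the Young diagram `ν`. -/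
def hookLength (ν : YoungDiagram) (q : ℕ × ℕ) : ℕ :=
  (ν.cells.filter fun r => (r.1 = q.1 ∧ q.2 ≤ r.2) ∨ (r.2 = q.2 ∧ q.1 ≤ r.1)).card

/-- `f_μ`, the inverse of the product of all hook lengths of the `m`-partition `μ`. -/
noncomputable def fCoeff {m : ℕ} (μ : Fin m → YoungDiagram) : ℂ :=
  (∏ k, ∏ q ∈ (μ k).cells, (hookLength (μ k) q : ℂ))⁻¹

/-! ### The semi-normal representations -/

/-- The space `V_μ` with basis the standard `m`-tableaux of shape `μ`. -/
abbrev V {m : ℕ} (n : ℕ) (μ : Fin m → YoungDiagram) : Type := StdTableau n μ →₀ ℂ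

/-- Interchange of the numbers `i + 1` and `i + 2`. -/
def swapFilling {m n : ℕ} (w : Fin (n + 1) → Node m) (i : Fin n) : Fin (n + 1) → Node m :=
  w ∘ Equiv.swap i.castSucc i.succ

/-- `δ_{p,p'} / (c' - c)` for two nodes `q`, `r` with data `(p, c)`, `(p', c')`. -/
noncomputable def axialCoeff {m : ℕ} (q r : Node m) : ℂ :=
  if q.1 = r.1 then ((content r - content q : ℤ) : ℂ)⁻¹ else 0

/-- `axialCoeff` for the nodes carrying the numbers `i + 1` and `i + 2`. -/
noncomputable def axial {m n : ℕ} (w : Fin (n + 1) → Node m) (i : Fin n) : ℂ :=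
  axialCoeff (w i.castSucc) (w i.succ)

open Classical in
/-- The basis vector of `V_μ` attached to a filling, understood to be zero if the filling is not
standard. -/
noncomputable def vec {m n : ℕ} (μ : Fin m → YoungDiagram) (w : Fin (n + 1) → Node m) : V n μ :=
  if h : IsStandard μ w then Finsupp.single ⟨w, h⟩ 1 else 0

/-- The semi-normal action of `s_{i+1}`:
`s e_T = a e_T + (1 + a) e_{sT}` with `a = δ_{p,p'} / (c' - c)`, where `e_{sT} = 0` if `sT`
is not standard. -/
noncomputable def sOp {m n : ℕ} (μ : Fin m → YoungDiagram) (i : Fin n) : V n μ →ₗ[ℂ] V n μ :=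
  Finsupp.linearCombination ℂ fun T : StdTableau n μ =>
    axial T.node i • vec μ T.node + (1 + axial T.node i) • vec μ (swapFilling T.node i)

/-- The semi-normal action of `t`: `t e_T = p_1 e_T`. -/
noncomputable def tOp {m : ℕ} (n : ℕ) (ξ : Fin m ≃ rootsOfUnity m ℂ) (μ : Fin m → YoungDiagram) :
    V n μ →ₗ[ℂ] V n μ :=
  Finsupp.linearCombination ℂ fun T : StdTableau n μ => T.p ξ 0 • vec μ T.node

section Relations

variable {m n : ℕ} {μ : Fin m → YoungDiagram}

theorem IsStandard.mono {w : Fin (n + 1) → Node m} (h : IsStandard μ w) {a b : Fin (n + 1)}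
    (hk : (w a).1 = (w b).1) (hx : (w a).2.1 ≤ (w b).2.1) (hy : (w a).2.2 ≤ (w b).2.2) : a ≤ b := by
  obtain ⟨d, hd⟩ := (h.mem_range ((w b).1, ((w a).2.1, (w b).2.2))).2
    ((μ (w b).1).isLowerSet (show ((w a).2.1, (w b).2.2) ≤ (w b).2 from ⟨hx, le_rfl⟩)
      ((h.mem_range (w b)).1 ⟨b, rfl⟩))
  have h1 : a ≤ d := by
    rcases hy.lt_or_eq with hy | hy
    · exact (h.row a d (by simp [hd, hk]) (by simp [hd]) (by simpa [hd] using hy)).le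
    · refine (h.inj ?_).le
      rw [hd, ← hy, ← hk]
  have h2 : d ≤ b := by
    rcases hx.lt_or_eq with hx | hx
    · exact (h.col d b (by simp [hd]) (by simp [hd]) (by simpa [hd] using hx)).le
    · refine (h.inj ?_).le
      rw [hd, hx]
  exact h1.trans h2

theorem IsStandard.exists_between {w : Fin (n + 1) → Node m} (h : IsStandard μ w)
    {a b : Fin (n + 1)} (hk : (w a).1 = (w b).1) {x y : ℕ} (hx : (w a).2.1 ≤ x)
    (hx' : x ≤ (w b).2.1) (hy : (w a).2.2 ≤ y) (hy' : y ≤ (w b).2.2) :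
    ∃ d, w d = ((w a).1, (x, y)) ∧ a ≤ d ∧ d ≤ b := by
  obtain ⟨d, hd⟩ := (h.mem_range ((w b).1, (x, y))).2
    ((μ (w b).1).isLowerSet (show (x, y) ≤ (w b).2 from ⟨hx', hy'⟩)
      ((h.mem_range (w b)).1 ⟨b, rfl⟩))
  exact ⟨d, by rw [hd, hk], h.mono (by simp [hd, hk]) (by simpa [hd] using hx)
    (by simpa [hd] using hy), h.mono (by simp [hd]) (by simpa [hd] using hx')
    (by simpa [hd] using hy')⟩

theorem isStandard_comp {w : Fin (n + 1) → Node m} (h : IsStandard μ w)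
    (σ : Equiv.Perm (Fin (n + 1)))
    (H : ∀ a b, a < b → (w a).1 = (w b).1 → (w a).2.1 ≤ (w b).2.1 → (w a).2.2 ≤ (w b).2.2 →
      σ.symm a < σ.symm b) : IsStandard μ (w ∘ σ) where
  inj := h.inj.comp σ.injective
  mem_range q := by
    rw [← h.mem_range q]
    exact ⟨fun ⟨a, ha⟩ => ⟨σ a, ha⟩, fun ⟨a, ha⟩ => ⟨σ.symm a, by simpa using ha⟩⟩
  row a b h1 h2 h3 := by
    have := H (σ a) (σ b) (h.row _ _ h1 h2 h3) h1 h2.le h3.le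
    simpa using this
  col a b h1 h2 h3 := by
    have := H (σ a) (σ b) (h.col _ _ h1 h2 h3) h1 h3.le h2.le
    simpa using this

/-- Two nodes of equal position and content carry numbers that differ by at least `3`. -/
theorem IsStandard.content_ne {w : Fin (n + 1) → Node m} (h : IsStandard μ w)
    {a b : Fin (n + 1)} (hab : a < b) (hab' : (b : ℕ) ≤ a + 2) (hk : (w a).1 = (w b).1) :
    content (w b) - content (w a) ≠ 0 := by
  intro hc
  simp only [content] at hc
  have hlt : (w a).2.1 < (w b).2.1 := by
    by_contra hle
    exact absurd (h.mono hk.symm (by omega) (by omega)) (not_le.2 hab)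
  obtain ⟨d, hd, had, hdb⟩ := h.exists_between hk (x := (w a).2.1 + 1) (y := (w a).2.2)
    (by omega) (by omega) le_rfl (by omega)
  obtain ⟨e, he, hae, heb⟩ := h.exists_between hk (x := (w a).2.1) (y := (w a).2.2 + 1)
    le_rfl (by omega) (by omega) (by omega)
  have h1 : d ≠ a := by rintro rfl; have := congrArg (fun q => q.2.1) hd; simp at this
  have h2 : e ≠ a := by rintro rfl; have := congrArg (fun q => q.2.2) he; simp at this
  have h3 : d ≠ e := by
    rintro rfl; have := congrArg (fun q => q.2.1) (hd.symm.trans he); simp at this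
  have h4 : d ≠ b := by
    rintro rfl; have := congrArg (fun q => q.2.2) hd; simp at this; omega
  have h5 : e ≠ b := by
    rintro rfl; have := congrArg (fun q => q.2.1) he; simp at this; omega
  omega

theorem swapFilling_swapFilling (w : Fin (n + 1) → Node m) (i : Fin n) :
    swapFilling (swapFilling w i) i = w := by
  funext a; simp [swapFilling]

@[simp] theorem swapFilling_castSucc (w : Fin (n + 1) → Node m) (i : Fin n) :
    swapFilling w i i.castSucc = w i.succ := by simp [swapFilling]

@[simp] theorem swapFilling_succ (w : Fin (n + 1) → Node m) (i : Fin n) :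
    swapFilling w i i.succ = w i.castSucc := by simp [swapFilling]

theorem swapFilling_of_ne (w : Fin (n + 1) → Node m) (i : Fin n) {a : Fin (n + 1)}
    (h1 : a ≠ i.castSucc) (h2 : a ≠ i.succ) : swapFilling w i a = w a := by
  simp [swapFilling, Equiv.swap_apply_of_ne_of_ne h1 h2]

theorem axialCoeff_swap (q r : Node m) : axialCoeff r q = - axialCoeff q r := by
  simp only [axialCoeff]
  split_ifs with h1 h2 h2
  · rw [← inv_neg, ← Int.cast_neg, neg_sub]
  · exact absurd h1.symm h2
  · exact absurd h2.symm h1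
  · simp

theorem axial_swap (w : Fin (n + 1) → Node m) (i : Fin n) :
    axial (swapFilling w i) i = - axial w i := by
  simp only [axial, swapFilling_castSucc, swapFilling_succ]
  exact axialCoeff_swap _ _

/-- The order on nodes: same diagram, weakly above and weakly to the left. -/
def NodeLE (q r : Node m) : Prop := q.1 = r.1 ∧ q.2.1 ≤ r.2.1 ∧ q.2.2 ≤ r.2.2

theorem isStandard_swap {w : Fin (n + 1) → Node m} (h : IsStandard μ w) (i : Fin n)
    (hr : ¬ NodeLE (w i.castSucc) (w i.succ)) : IsStandard μ (swapFilling w i) := by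
  refine isStandard_comp h (Equiv.swap i.castSucc i.succ) ?_
  intro a b hab hk hx hy
  rw [Equiv.symm_swap]
  have hne : ¬ (a = i.castSucc ∧ b = i.succ) := by
    rintro ⟨rfl, rfl⟩; exact hr ⟨hk, hx, hy⟩
  simp only [Equiv.swap_apply_def]
  simp only [Fin.lt_def, Fin.ext_iff, Fin.val_castSucc, Fin.val_succ] at *
  split_ifs <;> simp <;> omega

/-- If the interchange of `i + 1` and `i + 2` is not standard, the two nodes are neighbours. -/
theorem axial_sq {w : Fin (n + 1) → Node m} (h : IsStandard μ w) (i : Fin n)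
    (h' : ¬ IsStandard μ (swapFilling w i)) : axial w i ^ 2 = 1 := by
  have hlt : i.castSucc < i.succ := Fin.castSucc_lt_succ
  by_cases hr : NodeLE (w i.castSucc) (w i.succ)
  · obtain ⟨hk, hx, hy⟩ := hr
    have key : ∀ d, i.castSucc ≤ d → d ≤ i.succ → d = i.castSucc ∨ d = i.succ := by
      intro d h1 h2
      simp only [Fin.le_def, Fin.ext_iff, Fin.val_castSucc, Fin.val_succ] at *
      omega
    have hc : content (w i.succ) - content (w i.castSucc) = 1 ∨
        content (w i.succ) - content (w i.castSucc) = -1 := by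
      rcases hx.lt_or_eq with hx1 | hx1
      · obtain ⟨d, hd, h1, h2⟩ := h.exists_between hk (x := (w i.castSucc).2.1 + 1)
          (y := (w i.castSucc).2.2) (by omega) (by omega) le_rfl (by omega)
        rcases key d h1 h2 with rfl | rfl
        · have := congrArg (fun q => q.2.1) hd; simp at this
        · right; simp [content, hd]
      · rcases hy.lt_or_eq with hy1 | hy1
        · obtain ⟨d, hd, h1, h2⟩ := h.exists_between hk (x := (w i.castSucc).2.1)
            (y := (w i.castSucc).2.2 + 1) (by omega) (by omega) (by omega) (by omega)
          rcases key d h1 h2 with rfl | rfl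
          · have := congrArg (fun q => q.2.2) hd; simp at this
          · left; simp [content, hd]
        · exact absurd (h.inj (Prod.ext hk (Prod.ext hx1 hy1))) hlt.ne
    rw [axial, axialCoeff, if_pos hk]
    rcases hc with hc | hc <;> rw [hc] <;> norm_num
  · exact absurd (isStandard_swap h i hr) h'

open Classical in
/-- The off-diagonal coefficient, cut off outside the standard fillings. -/
noncomputable def offDiag (μ : Fin m → YoungDiagram) (w : Fin (n + 1) → Node m) (i : Fin n) : ℂ :=
  if IsStandard μ w ∧ IsStandard μ (swapFilling w i) then 1 + axial w i else 0

theorem vec_of_not {w : Fin (n + 1) → Node m} (h : ¬ IsStandard μ w) : vec μ w = 0 := by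
  simp [vec, h]

theorem vec_coe (T : StdTableau n μ) : vec μ T.node = Finsupp.single T 1 := by
  simp [vec, T.std]

theorem sOp_vec (w : Fin (n + 1) → Node m) (i : Fin n) :
    sOp μ i (vec μ w) = axial w i • vec μ w + offDiag μ w i • vec μ (swapFilling w i) := by
  by_cases h : IsStandard μ w
  · have : vec μ w = Finsupp.single (⟨w, h⟩ : StdTableau n μ) 1 := by simp [vec, h]
    conv_lhs => rw [this]
    rw [sOp, Finsupp.linearCombination_single, one_smul]
    by_cases h' : IsStandard μ (swapFilling w i)
    · simp [offDiag, h, h']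
    · simp [offDiag, h', vec_of_not h']
  · simp [vec_of_not h, offDiag, h]

theorem tOp_vec (ξ : Fin m ≃ rootsOfUnity m ℂ) (w : Fin (n + 1) → Node m) :
    tOp n ξ μ (vec μ w) = ((ξ (w 0).1 : ℂˣ) : ℂ) • vec μ w := by
  by_cases h : IsStandard μ w
  · have : vec μ w = Finsupp.single (⟨w, h⟩ : StdTableau n μ) 1 := by simp [vec, h]
    conv_lhs => rw [this]
    rw [tOp, Finsupp.linearCombination_single, one_smul]
    rfl
  · simp [vec_of_not h]

theorem linearMap_ext {f g : V n μ →ₗ[ℂ] V n μ}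
    (h : ∀ w, IsStandard μ w → f (vec μ w) = g (vec μ w)) : f = g := by
  refine Finsupp.lhom_ext' fun T => LinearMap.ext_ring ?_
  have := h T.node T.std
  rw [vec_coe] at this
  simpa using this

theorem offDiag_mul {w : Fin (n + 1) → Node m} (h : IsStandard μ w) (i : Fin n) :
    offDiag μ w i * offDiag μ (swapFilling w i) i = 1 - axial w i ^ 2 := by
  by_cases h' : IsStandard μ (swapFilling w i)
  · simp only [offDiag, h, h', swapFilling_swapFilling, axial_swap, and_self, if_true]
    ring
  · simp [offDiag, h', axial_sq h i h']

theorem sOp_sq (i : Fin n) : sOp μ i * sOp μ i = 1 := by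
  refine linearMap_ext fun w hw => ?_
  have := offDiag_mul hw i
  simp only [Module.End.mul_apply, Module.End.one_apply, sOp_vec, map_add, map_smul,
    swapFilling_swapFilling, axial_swap]
  match_scalars
  · linear_combination this
  · ring

theorem offDiag_of_le {w : Fin (n + 1) → Node m} {i : Fin n}
    (hr : NodeLE (w i.castSucc) (w i.succ)) : offDiag μ w i = 0 := by
  refine if_neg ?_
  rintro ⟨-, h'⟩
  have := h'.mono (a := i.succ) (b := i.castSucc) (by simpa using hr.1) (by simpa using hr.2.1)
    (by simpa using hr.2.2)
  exact absurd this (not_le.2 Fin.castSucc_lt_succ)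

theorem offDiag_of_not_le {w : Fin (n + 1) → Node m} (h : IsStandard μ w) {i : Fin n}
    (hr : ¬ NodeLE (w i.castSucc) (w i.succ)) : offDiag μ w i = 1 + axial w i :=
  if_pos ⟨h, isStandard_swap h i hr⟩

theorem swapFilling_comm (w : Fin (n + 1) → Node m) {i j : Fin n} (hij : (i : ℕ) + 1 < j) :
    swapFilling (swapFilling w i) j = swapFilling (swapFilling w j) i := by
  have key : Equiv.swap i.castSucc i.succ * Equiv.swap j.castSucc j.succ =
      Equiv.swap j.castSucc j.succ * Equiv.swap i.castSucc i.succ := by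
    rw [Equiv.mul_swap_eq_swap_mul]
    congr 2 <;> apply Equiv.swap_apply_of_ne_of_ne <;>
      simp only [ne_eq, Fin.ext_iff, Fin.val_castSucc, Fin.val_succ] <;> omega
  funext a
  exact congrArg w (DFunLike.congr_fun key a)

theorem far_aux (w : Fin (n + 1) → Node m) {i j : Fin n} (hij : (i : ℕ) + 1 < j ∨ (j : ℕ) + 1 < i) :
    swapFilling w i j.castSucc = w j.castSucc ∧ swapFilling w i j.succ = w j.succ := by
  constructor <;> apply swapFilling_of_ne <;>
    simp only [ne_eq, Fin.ext_iff, Fin.val_castSucc, Fin.val_succ] <;> omega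

theorem axial_far (w : Fin (n + 1) → Node m) {i j : Fin n}
    (hij : (i : ℕ) + 1 < j ∨ (j : ℕ) + 1 < i) : axial (swapFilling w i) j = axial w j := by
  simp [axial, far_aux w hij]

theorem offDiag_far {w : Fin (n + 1) → Node m} (h : IsStandard μ w) {i j : Fin n}
    (hij : (i : ℕ) + 1 < j) :
    offDiag μ w j * offDiag μ (swapFilling w j) i =
      offDiag μ w i * offDiag μ (swapFilling w i) j := by
  have f1 := far_aux w (Or.inl hij)
  have f2 := far_aux w (i := j) (j := i) (Or.inr hij)
  by_cases h1 : NodeLE (w i.castSucc) (w i.succ)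
  · rw [offDiag_of_le h1, offDiag_of_le (w := swapFilling w j) (by rwa [f2.1, f2.2])]; simp
  by_cases h2 : NodeLE (w j.castSucc) (w j.succ)
  · rw [offDiag_of_le h2, offDiag_of_le (w := swapFilling w i) (by rwa [f1.1, f1.2])]; simp
  rw [offDiag_of_not_le h h1, offDiag_of_not_le h h2,
    offDiag_of_not_le (isStandard_swap h j h2) (by rwa [f2.1, f2.2]),
    offDiag_of_not_le (isStandard_swap h i h1) (by rwa [f1.1, f1.2]),
    axial_far w (Or.inl hij), axial_far w (Or.inr hij)]
  ring

theorem sOp_comm (i j : Fin n) (hij : (i : ℕ) + 1 < j) :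
    sOp μ i * sOp μ j = sOp μ j * sOp μ i := by
  refine linearMap_ext fun w hw => ?_
  have := offDiag_far hw hij
  simp only [Module.End.mul_apply, sOp_vec, map_add, map_smul, swapFilling_comm w hij,
    axial_far w (Or.inl hij), axial_far w (i := j) (j := i) (Or.inr hij)]
  match_scalars
  · ring
  · ring
  · ring
  · linear_combination this

/-- The three nodes carrying consecutive numbers. -/
theorem axial_triple {w : Fin (n + 1) → Node m} (h : IsStandard μ w) {a b c : Fin (n + 1)}
    (hb : (b : ℕ) = a + 1) (hc : (c : ℕ) = a + 2) :
    axialCoeff (w a) (w b) * axialCoeff (w b) (w c) =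
      axialCoeff (w a) (w c) * (axialCoeff (w a) (w b) + axialCoeff (w b) (w c)) := by
  have hab : a < b := by rw [Fin.lt_def]; omega
  have hbc : b < c := by rw [Fin.lt_def]; omega
  simp only [axialCoeff]
  by_cases h1 : (w a).1 = (w b).1
  · by_cases h2 : (w b).1 = (w c).1
    · have d1 : ((content (w b) - content (w a) : ℤ) : ℂ) ≠ 0 :=
        Int.cast_ne_zero.2 (h.content_ne hab (by omega) h1)
      have d2 : ((content (w c) - content (w b) : ℤ) : ℂ) ≠ 0 :=
        Int.cast_ne_zero.2 (h.content_ne hbc (by omega) h2)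
      have d3 : ((content (w c) - content (w a) : ℤ) : ℂ) ≠ 0 :=
        Int.cast_ne_zero.2 (h.content_ne (hab.trans hbc) (by omega) (h1.trans h2))
      rw [if_pos h1, if_pos h2, if_pos (h1.trans h2)]
      field_simp
      push_cast
      ring
    · have h3 : ¬ (w a).1 = (w c).1 := fun h3 => h2 (h1.symm.trans h3)
      simp [h2, h3]
  · by_cases h2 : (w b).1 = (w c).1
    · have h3 : ¬ (w a).1 = (w c).1 := fun h3 => h1 (h3.trans h2.symm)
      simp [h1, h3]
    · simp [h1, h2]

theorem swapFilling_braid (w : Fin (n + 1) → Node m) {i j : Fin n} (hij : (j : ℕ) = i + 1) :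
    swapFilling (swapFilling (swapFilling w i) j) i =
      swapFilling (swapFilling (swapFilling w j) i) j := by
  have hj : j.castSucc = i.succ := by ext; simp [hij]
  have h1 : i.succ ≠ i.castSucc := Fin.castSucc_lt_succ.ne'
  have h2 : i.succ ≠ j.succ := by simp only [ne_eq, Fin.ext_iff, Fin.val_succ]; omega
  have h3 : i.castSucc ≠ j.succ := by
    simp only [ne_eq, Fin.ext_iff, Fin.val_castSucc, Fin.val_succ]; omega
  have key : Equiv.swap i.castSucc i.succ * Equiv.swap i.succ j.succ *
      Equiv.swap i.castSucc i.succ =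
      Equiv.swap i.succ j.succ * Equiv.swap i.castSucc i.succ * Equiv.swap i.succ j.succ := by
    rw [Equiv.swap_mul_swap_mul_swap h1.symm h3, Equiv.swap_comm i.castSucc i.succ,
      Equiv.swap_comm i.succ j.succ, Equiv.swap_mul_swap_mul_swap h2.symm h3.symm]
    exact Equiv.swap_comm _ _
  funext a
  have := congrArg w (DFunLike.congr_fun key a)
  simpa [swapFilling, hj] using this

theorem sOp_braid (i j : Fin n) (hij : (j : ℕ) = i + 1) :
    sOp μ i * sOp μ j * sOp μ i = sOp μ j * sOp μ i * sOp μ j := by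
  refine linearMap_ext fun w hw => ?_
  have hj : j.castSucc = i.succ := by ext; simp [hij]
  have e1 : ∀ w : Fin (n + 1) → Node m, swapFilling w i j.succ = w j.succ := fun w =>
    swapFilling_of_ne w i (by simp only [ne_eq, Fin.ext_iff, Fin.val_castSucc, Fin.val_succ]; omega)
      (by simp only [ne_eq, Fin.ext_iff, Fin.val_succ]; omega)
  have e2 : ∀ w : Fin (n + 1) → Node m, swapFilling w j i.castSucc = w i.castSucc := fun w =>
    swapFilling_of_ne w j (by simp only [ne_eq, Fin.ext_iff, Fin.val_castSucc]; omega)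
      (by simp only [ne_eq, Fin.ext_iff, Fin.val_castSucc, Fin.val_succ]; omega)
  have e3 : ∀ w : Fin (n + 1) → Node m, swapFilling w j i.succ = w j.succ := fun w => by
    rw [← hj, swapFilling_castSucc]
  have e4 : ∀ w : Fin (n + 1) → Node m, swapFilling w j j.succ = w i.succ := fun w => by
    rw [← hj, swapFilling_succ]
  have hR := axial_triple hw (a := i.castSucc) (b := i.succ) (c := j.succ) (by simp)
    (by simp [hij])
  have hb1 := offDiag_mul hw i
  have hb2 := offDiag_mul hw j
  have hprod : offDiag μ w i * offDiag μ (swapFilling w i) j *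
        offDiag μ (swapFilling (swapFilling w i) j) i =
      offDiag μ w j * offDiag μ (swapFilling w j) i *
        offDiag μ (swapFilling (swapFilling w j) i) j := by
    by_cases h1 : NodeLE (w i.castSucc) (w i.succ)
    · rw [offDiag_of_le h1,
        offDiag_of_le (w := swapFilling (swapFilling w j) i) (by simpa [hj, e1, e2, e3, e4] using h1)]
      simp
    by_cases h2 : NodeLE (w i.succ) (w j.succ)
    · rw [offDiag_of_le (i := j) (w := w) (by simpa [hj] using h2),
        offDiag_of_le (w := swapFilling (swapFilling w i) j) (by simpa [hj, e1, e2, e3, e4] using h2)]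
      simp
    by_cases h3 : NodeLE (w i.castSucc) (w j.succ)
    · rw [offDiag_of_le (i := j) (w := swapFilling w i) (by simpa [hj, e1, e2, e3, e4] using h3),
        offDiag_of_le (i := i) (w := swapFilling w j) (by simpa [hj, e1, e2, e3, e4] using h3)]
      simp
    have s1 := isStandard_swap hw i h1
    have s2 := isStandard_swap hw j (by rwa [hj])
    have s3 := isStandard_swap s1 j (by simpa [hj, e1, e2, e3, e4] using h3)
    have s4 := isStandard_swap s2 i (by simpa [hj, e1, e2, e3, e4] using h3)
    rw [offDiag_of_not_le hw h1, offDiag_of_not_le hw (i := j) (by rwa [hj]),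
      offDiag_of_not_le s1 (i := j) (by simpa [hj, e1, e2, e3, e4] using h3),
      offDiag_of_not_le s2 (i := i) (by simpa [hj, e1, e2, e3, e4] using h3),
      offDiag_of_not_le s3 (i := i) (by simpa [hj, e1, e2, e3, e4] using h2),
      offDiag_of_not_le s4 (i := j) (by simpa [hj, e1, e2, e3, e4] using h1)]
    simp only [axial, hj, e1, e2, e3, e4, swapFilling_castSucc, swapFilling_succ]
    ring
  simp only [Module.End.mul_apply, sOp_vec, map_add, map_smul, swapFilling_swapFilling]
  rw [swapFilling_braid w hij]
  simp only [axial, hj, e1, e2, e3, e4, swapFilling_castSucc, swapFilling_succ] at *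
  rw [axialCoeff_swap (w i.castSucc) (w i.succ), axialCoeff_swap (w i.succ) (w j.succ)]
  match_scalars
  · linear_combination axialCoeff (w i.castSucc) (w j.succ) * (hb1 - hb2) +
      (axialCoeff (w i.castSucc) (w i.succ) - axialCoeff (w i.succ) (w j.succ)) * hR
  · linear_combination offDiag μ w i * hR
  · linear_combination -offDiag μ w j * hR
  · ring
  · ring
  · linear_combination hprod

theorem tOp_sOp_comm (ξ : Fin m ≃ rootsOfUnity m ℂ) (i : Fin n) (hi : 0 < (i : ℕ)) :
    sOp μ i * tOp n ξ μ = tOp n ξ μ * sOp μ i := by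
  refine linearMap_ext fun w _ => ?_
  have h0 : swapFilling w i 0 = w 0 := by
    apply swapFilling_of_ne <;>
      simp only [ne_eq, Fin.ext_iff, Fin.val_castSucc, Fin.val_succ, Fin.val_zero] <;> omega
  simp only [Module.End.mul_apply, sOp_vec, tOp_vec, map_add, map_smul, h0]
  match_scalars <;> ring

theorem tOp_sOp_braid (ξ : Fin m ≃ rootsOfUnity m ℂ) (i : Fin n) (hi : (i : ℕ) = 0) :
    tOp n ξ μ * sOp μ i * tOp n ξ μ * sOp μ i = sOp μ i * tOp n ξ μ * sOp μ i * tOp n ξ μ := by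
  refine linearMap_ext fun w _ => ?_
  have hi0 : (0 : Fin (n + 1)) = i.castSucc := by ext; simp [hi]
  have key : axial w i * (((ξ (w i.castSucc).1 : ℂˣ) : ℂ) - ((ξ (w i.succ).1 : ℂˣ) : ℂ)) = 0 := by
    by_cases h : (w i.castSucc).1 = (w i.succ).1
    · rw [h]; ring
    · simp [axial, axialCoeff, h]
  simp only [Module.End.mul_apply, sOp_vec, tOp_vec, map_add, map_smul, hi0, swapFilling_castSucc,
    swapFilling_swapFilling, axial_swap]
  match_scalars
  · ring
  · linear_combination (-offDiag μ w i *
      (((ξ (w i.castSucc).1 : ℂˣ) : ℂ) - ((ξ (w i.succ).1 : ℂˣ) : ℂ))) * key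

theorem tOp_pow (ξ : Fin m ≃ rootsOfUnity m ℂ) : tOp n ξ μ ^ m = 1 := by
  refine linearMap_ext fun w _ => ?_
  have h : ∀ k : ℕ, (tOp n ξ μ ^ k) (vec μ w) = ((ξ (w 0).1 : ℂˣ) : ℂ) ^ k • vec μ w := by
    intro k
    induction k with
    | zero => simp
    | succ k ih => rw [pow_succ', Module.End.mul_apply, ih, map_smul, tOp_vec, smul_smul, pow_succ]
  rw [h, (mem_rootsOfUnity' m _).1 (ξ (w 0).1).2]
  simp

end Relations

/-- `t` as an invertible operator on `V_μ` (with inverse `t^(m-1)`). -/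
noncomputable def tUnit {m : ℕ} (n : ℕ) (ξ : Fin m ≃ rootsOfUnity m ℂ) (μ : Fin m → YoungDiagram) :
    (V n μ →ₗ[ℂ] V n μ)ˣ where
  val := tOp n ξ μ
  inv := tOp n ξ μ ^ (m - 1)
  val_inv := by
    obtain _ | m := m
    · refine linearMap_ext fun w _ => (w 0).1.elim0
    · rw [← pow_succ']; exact tOp_pow ξ
  inv_val := by
    obtain _ | m := m
    · refine linearMap_ext fun w _ => (w 0).1.elim0
    · rw [← pow_succ]; exact tOp_pow ξ

/-- The generators of `G(m,1,n+1)` as invertible operators on `V_μ`. -/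
noncomputable def genUnit {m n : ℕ} (ξ : Fin m ≃ rootsOfUnity m ℂ) (μ : Fin m → YoungDiagram) :
    Gen n → (V n μ →ₗ[ℂ] V n μ)ˣ
  | Gen.t => tUnit n ξ μ
  | Gen.s i => ⟨sOp μ i, sOp μ i, sOp_sq i, sOp_sq i⟩

theorem genUnit_relator {m n : ℕ} (ξ : Fin m ≃ rootsOfUnity m ℂ) (μ : Fin m → YoungDiagram) :
    ∀ r ∈ {r | IsRelator m n r}, FreeGroup.lift (genUnit ξ μ) r = 1 := by
  rintro r (⟨i⟩ | ⟨i, j, h⟩ | ⟨i, j, h⟩ | ⟨i, h⟩ | ⟨i, h⟩ | _)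
  · simp only [map_mul, fs, FreeGroup.lift_apply_of]
    exact Units.ext (sOp_sq i)
  · simp only [map_mul, map_inv, fs, FreeGroup.lift_apply_of, mul_inv_eq_one]
    exact Units.ext (sOp_braid i j h)
  · simp only [map_mul, map_inv, fs, FreeGroup.lift_apply_of, mul_inv_eq_one]
    exact Units.ext (sOp_comm i j h)
  · simp only [map_mul, map_inv, fs, ft, FreeGroup.lift_apply_of, mul_inv_eq_one]
    exact Units.ext (tOp_sOp_braid ξ i h)
  · simp only [map_mul, map_inv, fs, ft, FreeGroup.lift_apply_of, mul_inv_eq_one]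
    exact Units.ext (tOp_sOp_comm ξ i h)
  · simp only [map_pow, ft, FreeGroup.lift_apply_of]
    exact Units.ext (by simpa [genUnit, tUnit] using tOp_pow ξ)

/-- The semi-normal representation of `G(m,1,n+1)` on `V_μ`: the irreducible representation attached
to the `m`-partition `μ`, with `s_{i+1}` acting by `sOp μ i` and `t` by `tOp n ξ μ`. (If `μ` does
not have `n+1` boxes, then `V_μ = 0`.) -/
noncomputable def seminormalRep {m : ℕ} (n : ℕ) (ξ : Fin m ≃ rootsOfUnity m ℂ)
    (μ : Fin m → YoungDiagram) : Representation ℂ (G m n) (V n μ) :=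
  (Units.coeHom (V n μ →ₗ[ℂ] V n μ)).comp (PresentedGroup.toGroup (genUnit_relator ξ μ))

theorem seminormalRep_s {m n : ℕ} (ξ : Fin m ≃ rootsOfUnity m ℂ) (μ : Fin m → YoungDiagram)
    (i : Fin n) : seminormalRep n ξ μ (gs m i) = sOp μ i := by
  simp [seminormalRep, gs, genUnit]

theorem seminormalRep_t {m n : ℕ} (ξ : Fin m ≃ rootsOfUnity m ℂ) (μ : Fin m → YoungDiagram) :
    seminormalRep n ξ μ (gt m n) = tOp n ξ μ := by
  simp [seminormalRep, gt, genUnit, tUnit]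

/-! ### The idempotent attached to a standard `m`-tableau -/

/-- Primitive idempotents of a ring. -/
def IsPrimitiveIdempotent {R : Type*} [Ring R] (e : R) : Prop :=
  IsIdempotentElem e ∧ e ≠ 0 ∧
    ∀ a b : R, IsIdempotentElem a → IsIdempotentElem b → a * b = 0 → b * a = 0 → a + b = e →
      a = 0 ∨ b = 0

/-- `E` is the diagonal matrix unit attached to the vector `e_T` of the semi-normal basis: it acts on
`V_lam` as the projector onto `e_T` along the other basis vectors, and as `0` on `V_μ` for every
`μ ≠ lam`. -/
structure IsTableauIdempotent {m n : ℕ} (ξ : Fin m ≃ rootsOfUnity m ℂ) {lam : Fin m → YoungDiagram}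
    (T : StdTableau n lam) (E : MonoidAlgebra ℂ (G m n)) : Prop where
  self : (seminormalRep n ξ lam).asAlgebraHom E (Finsupp.single T 1) = Finsupp.single T 1
  of_ne : ∀ S : StdTableau n lam, S ≠ T →
    (seminormalRep n ξ lam).asAlgebraHom E (Finsupp.single S 1) = 0
  of_shape_ne : ∀ μ : Fin m → YoungDiagram, μ ≠ lam → (seminormalRep n ξ μ).asAlgebraHom E = 0

/-! ### The rational function `Φ`

Let `K` be a field containing `ℂ`. The spectral parameters `u_1, …, u_{n+1}` are elements of `K`
(below they are the variables of a field of rational functions), the parameters `v_1, …, v_{n+1}` are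
complex numbers. -/

section Phi

variable {K : Type*} [Field K] [Algebra ℂ K] (m : ℕ) {n : ℕ}

open Classical in
/-- `s_{i+1}(p, p', a, a') = s_{i+1} + δ_{p,p'} / (a - a')`. -/
noncomputable def bs (i : Fin n) (p p' : ℂ) (a a' : K) : MonoidAlgebra K (G m n) :=
  MonoidAlgebra.single (gs m i) 1 + MonoidAlgebra.single 1 (if p = p' then 1 / (a - a') else 0)

/-- `t(v) = (1/m) ∑_{k=0}^{m-1} v^{m-k} t^k`. -/
noncomputable def bt (K : Type*) [Field K] [Algebra ℂ K] (n : ℕ) (v : ℂ) :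
    MonoidAlgebra K (G m n) :=
  ∑ k ∈ Finset.range m,
    MonoidAlgebra.single (gt m n ^ k) (algebraMap ℂ K ((1 / (m : ℂ)) * v ^ (m - k)))

/-- `φ_{k+1}(v_1, …, v_k, v, u_1, …, u_k, u)`, where `φ_1 = t(v)` and
`φ_{k+1} = s_k(v, v_k, u, u_k) φ_k s_k`. The argument `k` runs from `0` to `n`, and the values
`vs i`, `us i` are `v_{i+1}`, `u_{i+1}`; only those with `i < k` are used. -/
noncomputable def phi (vs : Fin (n + 1) → ℂ) (us : Fin (n + 1) → K) (v : ℂ) (u : K)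
    (k : Fin (n + 1)) : MonoidAlgebra K (G m n) :=
  Fin.induction (motive := fun _ => MonoidAlgebra K (G m n)) (bt m K n v)
    (fun i X => bs m i v (vs i.castSucc) u (us i.castSucc) * X * MonoidAlgebra.single (gs m i) 1) k

/-- `Φ(v_1, …, v_{n+1}, u_1, …, u_{n+1}) = φ_{n+1} φ_n ⋯ φ_1`, where `φ_{k+1}` is taken at
`(v_1, …, v_k, v_{k+1}, u_1, …, u_k, u_{k+1})`. -/
noncomputable def Phi (vs : Fin (n + 1) → ℂ) (us : Fin (n + 1) → K) : MonoidAlgebra K (G m n) :=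
  ((List.finRange (n + 1)).reverse.map fun k => phi m vs us (vs k) (us k) k).prod

end Phi

/-! ### Consecutive evaluations of rational functions -/

/-- The field `ℂ(u_1, …, u_N)` of rational functions. -/
abbrev RatField (N : ℕ) : Type := FractionRing (MvPolynomial (Fin N) ℂ)

/-- The variable `u_{i+1}` as a rational function. -/
noncomputable def uVar {N : ℕ} (i : Fin N) : RatField N :=
  algebraMap (MvPolynomial (Fin N) ℂ) (RatField N) (MvPolynomial.X i)

/-- Substitution of the number `c` for the variable with index `i` in a polynomial, the other
variables being kept. -/
noncomputable def substVar {N : ℕ} (i : Fin N) (c : ℂ) :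
    MvPolynomial (Fin N) ℂ →ₐ[ℂ] MvPolynomial (Fin N) ℂ :=
  MvPolynomial.aeval (Function.update MvPolynomial.X i (MvPolynomial.C c))

/-- The rational function `r` is non-singular along `u_{i+1} = c` and `r'` is its restriction: `r`
can be written as a fraction whose denominator does not vanish identically for `u_{i+1} = c`, and
`r'` is obtained by substituting `c` for `u_{i+1}` in this fraction. -/
def EvaluatesTo {N : ℕ} (i : Fin N) (c : ℂ) (r r' : RatField N) : Prop :=
  ∃ a b : MvPolynomial (Fin N) ℂ, substVar i c b ≠ 0 ∧
    r = algebraMap _ (RatField N) a / algebraMap _ (RatField N) b ∧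
    r' = algebraMap _ (RatField N) (substVar i c a) / algebraMap _ (RatField N) (substVar i c b)

/-- `X` is the value of the consecutive evaluations
`F |_{u_1 = c_1} |_{u_2 = c_2} ⋯ |_{u_N = c_N}` of a rational function `F` with values in the group
algebra `ℂ[Γ]`: each rational function in the chain is non-singular along the hyperplane at which it
is evaluated, and the last one is the constant `X`. -/
def ConsecutiveEvaluation {N : ℕ} {Γ : Type*} [Group Γ] (F : MonoidAlgebra (RatField N) Γ)
    (c : Fin N → ℂ) (X : MonoidAlgebra ℂ Γ) : Prop :=
  ∃ R : Fin (N + 1) → MonoidAlgebra (RatField N) Γ,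
    R 0 = F ∧
    (∀ (i : Fin N) (g : Γ), EvaluatesTo i (c i) ((R i.castSucc).coeff g) ((R i.succ).coeff g)) ∧
    R (Fin.last N) = MonoidAlgebra.mapRingHom Γ (algebraMap ℂ (RatField N)) X

end CyclotomicFusion

/-!
Let `U` be a standard tableau in which `1, …, k` occupy the same nodes as in `T`, and evaluate
`u₁, …, u_k` at the contents of `T`. Then `φ_{k+1}` at `p_{k+1}(T)` and `u` acts on `e_U` by a
scalar: `δ u / (u - c) · ∏ (1 - 1 / (u - c_i)²)`, where `c` is the content of the number `k + 1` in
`U`, `δ` compares its position with `p_{k+1}(T)`, and `i ≤ k` runs over the numbers at this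
position. The product telescopes along the rows of the diagram already filled. At
`u = c_{k+1}(T)` the scalar vanishes unless `U` has `k + 1` in the same node as `T`, and otherwise
it is the factor by which adding this node multiplies the product of the hook lengths.
Consecutively, the evaluations therefore produce the matrix unit of `e_T` times the product of the
hook lengths of the whole shape.

That the evaluations are non-singular, and that an element of `ℂG(m,1,n+1)` is determined by its
actions on the `V_μ`, both follow from the Plancherel identity
`∑_μ f_μ χ_μ(g) = m^{n+1} δ_{g,1}`, since it expresses the coefficients of an element linearly by
its matrix coefficients. The identity is proved by induction along the groups
`G(m,1,n) ⊂ G(m,1,n+1)`: the sums of the weights `f_μ` over the ways to add a node to a diagram are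
sums of residues of rational functions with poles at the contents of the addable nodes.
-/

namespace CyclotomicFusion

open Finset
open scoped Matrix

/-! ### Hook lengths -/

section Hooks

variable {ν : YoungDiagram} {L : ℕ}

/-- The content of the first box to the right of row `i`. As `i` varies, these are the shifted row
lengths of `ν`. -/
def rowContent (ν : YoungDiagram) (i : ℕ) : ℤ := (ν.rowLen i : ℤ) - i

/-- The content of the last box of column `j`. The integers that are not of the form
`rowContent ν i` are those of the form `colContent ν j`. -/
def colContent (ν : YoungDiagram) (j : ℕ) : ℤ := (j : ℤ) + 1 - ν.colLen j

theorem rowContent_strictAnti (ν : YoungDiagram) : StrictAnti (rowContent ν) := by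
  intro i j h
  have := ν.rowLen_anti i j h.le
  simp only [rowContent]
  omega

theorem colContent_strictMono (ν : YoungDiagram) : StrictMono (colContent ν) := by
  intro i j h
  have := ν.colLen_anti i j h.le
  simp only [colContent]
  omega

theorem colContent_lt_rowContent {i j : ℕ} (h : (i, j) ∈ ν) : colContent ν j < rowContent ν i := by
  have := YoungDiagram.mem_iff_lt_rowLen.1 h
  have := YoungDiagram.mem_iff_lt_colLen.1 h
  simp only [colContent, rowContent]
  omega

theorem rowContent_lt_colContent {i j : ℕ} (h : (i, j) ∉ ν) : rowContent ν i < colContent ν j := by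
  have := mt YoungDiagram.mem_iff_lt_rowLen.2 h
  have := mt YoungDiagram.mem_iff_lt_colLen.2 h
  simp only [colContent, rowContent]
  omega

theorem rowContent_ne_colContent (ν : YoungDiagram) (i j : ℕ) :
    rowContent ν i ≠ colContent ν j := by
  by_cases h : (i, j) ∈ ν
  · exact (colContent_lt_rowContent h).ne'
  · exact (rowContent_lt_colContent h).ne

theorem rowLen_eq_zero (hL : ν.colLen 0 ≤ L) : ν.rowLen L = 0 := by
  by_contra h
  have := YoungDiagram.mem_iff_lt_colLen.1
    (YoungDiagram.mem_iff_lt_rowLen.2 (Nat.pos_of_ne_zero h))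
  omega

theorem rowContent_eq_neg (hL : ν.colLen 0 ≤ L) : rowContent ν L = -L := by
  simp [rowContent, rowLen_eq_zero hL]

theorem mem_cells_iff_mem_range (hL : ν.colLen 0 ≤ L) (q : ℕ × ℕ) :
    q ∈ ν.cells ↔ q.1 ∈ range L ∧ q.2 ∈ range (ν.rowLen q.1) := by
  rw [YoungDiagram.mem_cells, YoungDiagram.mem_iff_lt_rowLen, mem_range, mem_range]
  refine ⟨fun h => ⟨?_, h⟩, And.right⟩
  by_contra hq
  rw [rowLen_eq_zero (hL.trans (not_lt.1 hq))] at h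
  exact Nat.not_lt_zero _ h

theorem prod_cells {M : Type*} [CommMonoid M] (hL : ν.colLen 0 ≤ L) (f : ℕ × ℕ → M) :
    ∏ q ∈ ν.cells, f q = ∏ i ∈ range L, ∏ j ∈ range (ν.rowLen i), f (i, j) :=
  prod_finset_product _ _ _ (mem_cells_iff_mem_range hL)

theorem hook_eq_arm_union_leg (ν : YoungDiagram) (i j : ℕ) :
    (ν.cells.filter fun r => (r.1 = i ∧ j ≤ r.2) ∨ (r.2 = j ∧ i ≤ r.1)) =
      ({i} ×ˢ Ico j (ν.rowLen i)) ∪ (Ico (i + 1) (ν.colLen j) ×ˢ {j}) := by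
  ext ⟨a, b⟩
  have hrow := YoungDiagram.mem_iff_lt_rowLen (μ := ν) (i := a) (j := b)
  have hcol := YoungDiagram.mem_iff_lt_colLen (μ := ν) (i := a) (j := b)
  simp only [mem_filter, YoungDiagram.mem_cells, mem_union, mem_product, mem_singleton, mem_Ico]
  grind

theorem hookLength_eq {i j : ℕ} (h : (i, j) ∈ ν) :
    (hookLength ν (i, j) : ℤ) = rowContent ν i - colContent ν j := by
  have hrow := YoungDiagram.mem_iff_lt_rowLen.1 h
  have hcol := YoungDiagram.mem_iff_lt_colLen.1 h
  have hdisj : Disjoint (({i} : Finset ℕ) ×ˢ Ico j (ν.rowLen i))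
      (Ico (i + 1) (ν.colLen j) ×ˢ ({j} : Finset ℕ)) :=
    disjoint_product.2 (Or.inl (by simp))
  rw [hookLength, hook_eq_arm_union_leg, card_union_of_disjoint hdisj]
  simp only [card_product, card_singleton, Nat.card_Ico, rowContent, colContent]
  omega

theorem hookLength_pos {q : ℕ × ℕ} (h : q ∈ ν.cells) : 0 < hookLength ν q :=
  card_pos.2 ⟨q, by simp [h]⟩

theorem disjoint_image_rowContent_image_colContent (ν : YoungDiagram) (s t : Finset ℕ) :
    Disjoint (s.image (rowContent ν)) (t.image (colContent ν)) := by
  simp only [disjoint_left, mem_image]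
  rintro _ ⟨k, -, rfl⟩ ⟨j, -, hj⟩
  exact rowContent_ne_colContent ν k j hj.symm

theorem image_rowContent_union_image_colContent (hL : ν.colLen 0 ≤ L) {i : ℕ} (hi : i < L) :
    (Ioo i L).image (rowContent ν) ∪ (range (ν.rowLen i)).image (colContent ν) =
      Ico (1 - L : ℤ) (rowContent ν i) := by
  refine eq_of_subset_of_card_le (fun x hx => ?_) ?_
  · rw [mem_Ico]
    rcases mem_union.1 hx with hx | hx
    · obtain ⟨k, hk, rfl⟩ := mem_image.1 hx
      rw [mem_Ioo] at hk
      refine ⟨?_, rowContent_strictAnti ν hk.1⟩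
      simp only [rowContent]
      omega
    · obtain ⟨j, hj, rfl⟩ := mem_image.1 hx
      refine ⟨?_, colContent_lt_rowContent (YoungDiagram.mem_iff_lt_rowLen.2 (mem_range.1 hj))⟩
      have := ν.colLen_anti 0 j j.zero_le
      simp only [colContent]
      omega
  · rw [card_union_of_disjoint (disjoint_image_rowContent_image_colContent ν _ _),
      card_image_of_injective _ (rowContent_strictAnti ν).injective,
      card_image_of_injective _ (colContent_strictMono ν).injective]
    simp only [Int.card_Ico, Nat.card_Ioo, card_range, rowContent]
    omega

theorem prod_Ico_sub_eq_factorial (a : ℤ) (N : ℕ) :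
    ∏ x ∈ Ico (a - N) a, (a - x) = (N.factorial : ℤ) := by
  rw [← prod_range_add_one_eq_factorial, Nat.cast_prod]
  refine prod_nbij' (fun x => (a - x - 1).toNat) (fun k => a - (k + 1 : ℕ)) ?_ ?_ ?_ ?_ ?_ <;>
    simp only [mem_Ico, mem_range] <;> omega

/-- By `image_rowContent_union_image_colContent`, the hook lengths of row `i` and the differences of
shifted row lengths together run once through `1, …, rowLen i + (L - 1 - i)`. -/
theorem prod_hookLength_row_mul (hL : ν.colLen 0 ≤ L) {i : ℕ} (hi : i < L) :
    (∏ j ∈ range (ν.rowLen i), (hookLength ν (i, j) : ℤ)) *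
      ∏ k ∈ Ioo i L, (rowContent ν i - rowContent ν k) =
        (ν.rowLen i + (L - 1 - i)).factorial := by
  have hIco : Ico (rowContent ν i - (ν.rowLen i + (L - 1 - i) : ℕ)) (rowContent ν i) =
      Ico (1 - L : ℤ) (rowContent ν i) := by
    congr 1
    simp only [rowContent]
    omega
  rw [← prod_Ico_sub_eq_factorial (rowContent ν i), hIco,
    ← image_rowContent_union_image_colContent hL hi,
    prod_union (disjoint_image_rowContent_image_colContent ν _ _),
    prod_image (rowContent_strictAnti ν).injective.injOn,
    prod_image (colContent_strictMono ν).injective.injOn, mul_comm]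
  congr 1
  exact prod_congr rfl fun j hj =>
    hookLength_eq (YoungDiagram.mem_iff_lt_rowLen.2 (mem_range.1 hj))

/-- The Vandermonde product `∏_{i < k < L} (a i - a k)`. -/
def vandermondeProd {R : Type*} [CommRing R] (a : ℕ → R) (L : ℕ) : R :=
  ∏ k ∈ range L, ∏ i ∈ range k, (a i - a k)

theorem vandermondeProd_eq_prod_Ioo {R : Type*} [CommRing R] (a : ℕ → R) (L : ℕ) :
    vandermondeProd a L = ∏ i ∈ range L, ∏ k ∈ Ioo i L, (a i - a k) :=
  prod_comm' fun k i => by simp only [mem_range, mem_Ioo]; omega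

theorem vandermondeProd_ne_zero {R : Type*} [CommRing R] [IsDomain R] {a : ℕ → R}
    (ha : Function.Injective a) (L : ℕ) : vandermondeProd a L ≠ 0 :=
  prod_ne_zero_iff.2 fun _ _ => prod_ne_zero_iff.2 fun _ hi =>
    sub_ne_zero.2 (ha.ne (mem_range.1 hi).ne)

theorem vandermondeProd_congr {R : Type*} [CommRing R] {a b : ℕ → R} {L : ℕ}
    (h : ∀ i < L, a i = b i) : vandermondeProd a L = vandermondeProd b L :=
  prod_congr rfl fun k hk => prod_congr rfl fun i hi => by
    rw [mem_range] at hk hi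
    rw [h k hk, h i (hi.trans hk)]

theorem vandermondeProd_succ {R : Type*} [CommRing R] (a : ℕ → R) (L : ℕ) :
    vandermondeProd a (L + 1) = vandermondeProd a L * ∏ i ∈ range L, (a i - a L) :=
  prod_range_succ _ _

theorem vandermondeProd_update {R : Type*} [CommRing R] (a : ℕ → R) (b : R) {L x : ℕ} (hx : x < L) :
    vandermondeProd (Function.update a x b) L * ∏ k ∈ (range L).erase x, (a x - a k) =
      vandermondeProd a L * ∏ k ∈ (range L).erase x, (b - a k) := by
  induction L with
  | zero => exact absurd hx (Nat.not_lt_zero _)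
  | succ L ih =>
    rw [vandermondeProd_succ, vandermondeProd_succ, range_add_one]
    rcases (Nat.lt_succ_iff.1 hx).lt_or_eq with hx | rfl
    · have hrest : ∏ i ∈ (range L).erase x, (Function.update a x b i - a L) =
          ∏ i ∈ (range L).erase x, (a i - a L) :=
        prod_congr rfl fun i hi => by rw [Function.update_of_ne (ne_of_mem_erase hi)]
      rw [erase_insert_of_ne hx.ne', prod_insert (by simp), prod_insert (by simp),
        Function.update_of_ne hx.ne', ← mul_prod_erase (range L) _ (mem_range.2 hx),
        ← mul_prod_erase (range L) (fun i => a i - a L) (mem_range.2 hx), hrest,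
        Function.update_self]
      linear_combination (b - a L) * (∏ i ∈ (range L).erase x, (a i - a L)) * (a x - a L) * ih hx
    · have hold : vandermondeProd (Function.update a x b) x = vandermondeProd a x :=
        vandermondeProd_congr fun i hi => Function.update_of_ne hi.ne _ _
      have hnew : ∏ i ∈ range x, (Function.update a x b i - b) = ∏ i ∈ range x, (a i - b) :=
        prod_congr rfl fun i hi => by rw [Function.update_of_ne (mem_range.1 hi).ne]
      rw [erase_insert (by simp), hold, Function.update_self, hnew, mul_assoc, mul_assoc,
        ← prod_mul_distrib, ← prod_mul_distrib]
      congr 1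
      exact prod_congr rfl fun i _ => by ring

/-- The product of the hook lengths of a diagram. -/
def hookProd (ν : YoungDiagram) : ℕ := ∏ q ∈ ν.cells, hookLength ν q

theorem hookProd_pos (ν : YoungDiagram) : 0 < hookProd ν :=
  prod_pos fun _ hq => hookLength_pos hq

theorem hookProd_mul_vandermondeProd (hL : ν.colLen 0 ≤ L) :
    (hookProd ν : ℤ) * vandermondeProd (rowContent ν) L =
      ∏ i ∈ range L, ((ν.rowLen i + (L - 1 - i)).factorial : ℤ) := by
  rw [hookProd, prod_cells hL, vandermondeProd_eq_prod_Ioo, Nat.cast_prod, ← prod_mul_distrib]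
  refine prod_congr rfl fun i hi => ?_
  rw [Nat.cast_prod, prod_hookLength_row_mul hL (mem_range.1 hi)]

end Hooks

/-! ### Adding a box to a diagram -/

section AddCell

variable {ν : YoungDiagram} {L : ℕ}

/-- A box can be added to the row `x`. -/
def IsAddable (ν : YoungDiagram) (x : ℕ) : Prop := ∀ i, i < x → ν.rowLen x < ν.rowLen i

/-- The rows to which a box can be added. -/
abbrev AddRow (ν : YoungDiagram) : Type := {x : ℕ // IsAddable ν x}

theorem IsAddable.le_colLen {x : ℕ} (h : IsAddable ν x) : x ≤ ν.colLen 0 := by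
  by_contra hx
  have := h _ (not_le.1 hx)
  rw [rowLen_eq_zero le_rfl] at this
  omega

theorem IsAddable.rowContent_add_one_ne {x : ℕ} (hx : IsAddable ν x) (i : ℕ) :
    rowContent ν x + 1 ≠ rowContent ν i := by
  simp only [rowContent]
  rcases lt_or_ge i x with h | h
  · have := hx i h
    omega
  · have := ν.rowLen_anti x i h
    omega

theorem rowContent_add_one_eq_of_not_isAddable {x : ℕ} (h : ¬ IsAddable ν x) :
    ∃ i < x, rowContent ν x + 1 = rowContent ν i := by
  simp only [IsAddable, not_forall, not_lt] at h
  obtain ⟨i, hi, hle⟩ := h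
  have := ν.rowLen_anti i (x - 1) (by omega)
  have := ν.rowLen_anti (x - 1) x (by omega)
  exact ⟨x - 1, by omega, by simp only [rowContent]; omega⟩

noncomputable instance (ν : YoungDiagram) : Fintype (AddRow ν) :=
  (Set.Finite.subset (Set.finite_Iic (ν.colLen 0)) fun _ h =>
    IsAddable.le_colLen h : {x | IsAddable ν x}.Finite).fintype

/-- The diagram with one more box in the row `x`. -/
def addCell (ν : YoungDiagram) (x : AddRow ν) : YoungDiagram where
  cells := insert (x.1, ν.rowLen x.1) ν.cells
  isLowerSet := by
    rintro ⟨a, b⟩ ⟨a', b'⟩ ⟨hrow, hcol⟩ hq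
    have hadd := x.2 a'
    simp only [coe_insert, Set.mem_insert_iff, mem_coe, YoungDiagram.mem_cells, Prod.mk.injEq]
      at hq ⊢
    rcases hq with ⟨rfl, rfl⟩ | hq
    · rw [YoungDiagram.mem_iff_lt_rowLen]
      dsimp only at hrow hcol
      rcases hrow.lt_or_eq with hrow | rfl <;> grind
    · exact Or.inr (ν.up_left_mem hrow hcol hq)

theorem mem_addCell {x : AddRow ν} {q : ℕ × ℕ} :
    q ∈ addCell ν x ↔ q = (x.1, ν.rowLen x.1) ∨ q ∈ ν := by
  rw [← YoungDiagram.mem_cells, addCell, mem_insert, YoungDiagram.mem_cells]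

theorem rowLen_addCell (ν : YoungDiagram) (x : AddRow ν) (i : ℕ) :
    (addCell ν x).rowLen i = if i = x.1 then ν.rowLen i + 1 else ν.rowLen i := by
  refine eq_of_forall_lt_iff fun j => ?_
  rw [← YoungDiagram.mem_iff_lt_rowLen, mem_addCell, YoungDiagram.mem_iff_lt_rowLen, Prod.mk.injEq]
  split_ifs with h
  · subst h; omega
  · omega

theorem rowContent_addCell (ν : YoungDiagram) (x : AddRow ν) :
    rowContent (addCell ν x) =
      Function.update (rowContent ν) x.1 (rowContent ν x.1 + 1) := by
  funext i
  rw [Function.update_apply]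
  simp only [rowContent, rowLen_addCell]
  split_ifs with h
  · rw [h]; push_cast; ring
  · rfl

theorem colLen_addCell_le (x : AddRow ν) (hL : ν.colLen 0 < L) : (addCell ν x).colLen 0 ≤ L := by
  by_contra h
  have hlast := YoungDiagram.mem_iff_lt_rowLen.1 (YoungDiagram.mem_iff_lt_colLen.2 (not_le.1 h))
  have hx := x.2.le_colLen
  rw [rowLen_addCell, rowLen_eq_zero hL.le] at hlast
  split_ifs at hlast <;> omega

theorem prod_factorial_addCell (x : AddRow ν) (hL : ν.colLen 0 < L) :
    (∏ i ∈ range L, (((addCell ν x).rowLen i + (L - 1 - i)).factorial : ℤ)) =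
      (rowContent ν x.1 - rowContent ν L) *
        ∏ i ∈ range L, ((ν.rowLen i + (L - 1 - i)).factorial : ℤ) := by
  have hxL : x.1 < L := x.2.le_colLen.trans_lt hL
  have hrest : ∏ i ∈ (range L).erase x.1, (((addCell ν x).rowLen i + (L - 1 - i)).factorial : ℤ) =
      ∏ i ∈ (range L).erase x.1, ((ν.rowLen i + (L - 1 - i)).factorial : ℤ) :=
    prod_congr rfl fun i hi => by rw [rowLen_addCell, if_neg (ne_of_mem_erase hi)]
  have hfactor : rowContent ν x.1 - rowContent ν L = (ν.rowLen x.1 + (L - 1 - x.1) + 1 : ℕ) := by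
    rw [rowContent_eq_neg hL.le, rowContent]
    omega
  rw [← mul_prod_erase _ _ (mem_range.2 hxL), hrest, rowLen_addCell, if_pos rfl, hfactor,
    ← mul_prod_erase _ (fun i => ((ν.rowLen i + (L - 1 - i)).factorial : ℤ)) (mem_range.2 hxL),
    add_right_comm, Nat.factorial_succ, Nat.cast_mul, mul_assoc]

theorem hookProd_addCell_mul (x : AddRow ν) (hL : ν.colLen 0 < L) :
    (hookProd (addCell ν x) : ℤ) * ∏ i ∈ range L, (rowContent ν x.1 + 1 - rowContent ν i) =
      hookProd ν * ∏ i ∈ (range (L + 1)).erase x.1, (rowContent ν x.1 - rowContent ν i) := by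
  have hxL : x.1 < L := x.2.le_colLen.trans_lt hL
  have hν := hookProd_mul_vandermondeProd hL.le
  have hadd := hookProd_mul_vandermondeProd (colLen_addCell_le x hL)
  have hΔ := vandermondeProd_update (rowContent ν) (rowContent ν x.1 + 1) hxL
  rw [prod_factorial_addCell x hL, rowContent_addCell] at hadd
  rw [range_add_one, erase_insert_of_ne hxL.ne', prod_insert (by simp),
    ← mul_prod_erase (range L) _ (mem_range.2 hxL), add_sub_cancel_left, one_mul]
  refine mul_right_cancel₀
    (vandermondeProd_ne_zero (rowContent_strictAnti ν).injective L) ?_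
  rw [mul_assoc, mul_comm (∏ _ ∈ _, _), ← hΔ, ← mul_assoc, hadd, ← hν]
  ring

end AddCell

/-! ### Hook sums -/

section HookSums

variable {ν : YoungDiagram} {L : ℕ} {F : Type*} [Field F]

theorem sum_prod_sub_div_prod_sub_eq_one {ι κ : Type*} [DecidableEq ι] {s : Finset ι}
    {t : Finset κ} {a : ι → F} (ha : Set.InjOn a s) (b : κ → F) (hst : #t + 1 = #s) :
    ∑ r ∈ s, (∏ i ∈ t, (a r - b i)) / ∏ i ∈ s.erase r, (a r - a i) = 1 := by
  have hmonic : (∏ i ∈ t, (Polynomial.X - Polynomial.C (b i))).Monic :=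
    Polynomial.monic_prod_of_monic _ _ fun i _ => Polynomial.monic_X_sub_C _
  have hdeg : (#s : WithBot ℕ) = (∏ i ∈ t, (Polynomial.X - Polynomial.C (b i))).degree + 1 := by
    simp [Polynomial.degree_prod, ← hst]
  have := Lagrange.leadingCoeff_eq_sum ha hdeg
  simpa [hmonic.leadingCoeff, Polynomial.eval_prod] using this.symm

theorem sum_prod_sub_div_prod_sub_eq_zero {ι κ : Type*} [DecidableEq ι] {s : Finset ι}
    {t : Finset κ} {a : ι → F} (ha : Set.InjOn a s) (b : κ → F) (hst : #t + 1 < #s) :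
    ∑ r ∈ s, (∏ i ∈ t, (a r - b i)) / ∏ i ∈ s.erase r, (a r - a i) = 0 := by
  have hdeg : (∏ i ∈ t, (Polynomial.X - Polynomial.C (b i))).degree = (#t : WithBot ℕ) := by
    simp [Polynomial.degree_prod]
  have := Lagrange.coeff_eq_sum ha (P := ∏ i ∈ t, (Polynomial.X - Polynomial.C (b i)))
    (by rw [hdeg]; exact_mod_cast (by omega))
  rw [Polynomial.coeff_eq_zero_of_degree_lt (by rw [hdeg]; exact_mod_cast (by omega))] at this
  simpa [Polynomial.eval_prod] using this.symm

variable (F) in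
/-- The residue at `rowContent ν r` of the rational function
`∏_{i < L} (u + 1 - rowContent ν i) / ∏_{i ≤ L} (u - rowContent ν i)`. -/
def residue (ν : YoungDiagram) (L r : ℕ) : F :=
  (∏ i ∈ range L, ((rowContent ν r : F) + 1 - rowContent ν i)) /
    ∏ i ∈ (range (L + 1)).erase r, ((rowContent ν r : F) - rowContent ν i)

theorem residue_eq_zero {r : ℕ} (hr : r ≤ L) (h : ¬ IsAddable ν r) : residue F ν L r = 0 := by
  obtain ⟨i, hi, heq⟩ := rowContent_add_one_eq_of_not_isAddable h
  rw [residue, prod_eq_zero (mem_range.2 (hi.trans_le hr)), zero_div]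
  rw [← heq]
  push_cast
  ring

variable [CharZero F]

theorem rowContent_cast_injective (ν : YoungDiagram) :
    Function.Injective fun i => (rowContent ν i : F) :=
  Int.cast_injective.comp (rowContent_strictAnti ν).injective

theorem hookProd_eq_mul_residue (x : AddRow ν) (hL : ν.colLen 0 < L) :
    (hookProd ν : F) = hookProd (addCell ν x) * residue F ν L x.1 := by
  have hden : ∏ i ∈ (range (L + 1)).erase x.1, ((rowContent ν x.1 : F) - rowContent ν i) ≠ 0 :=
    prod_ne_zero_iff.2 fun i hi =>
      sub_ne_zero.2 ((rowContent_cast_injective ν).ne (ne_of_mem_erase hi).symm)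
  rw [residue, mul_div_assoc', eq_div_iff hden]
  exact_mod_cast congrArg (Int.cast : ℤ → F) (hookProd_addCell_mul x hL).symm

theorem sum_residue (ν : YoungDiagram) (L : ℕ) : ∑ r ∈ range (L + 1), residue F ν L r = 1 := by
  simpa only [residue, sub_sub_eq_add_sub] using
    sum_prod_sub_div_prod_sub_eq_one (rowContent_cast_injective ν).injOn
      (fun i => (rowContent ν i : F) - 1) (s := range (L + 1)) (t := range L) (by simp)

theorem sum_residue_div {r₀ : ℕ} (hr₀ : r₀ < L) (h : ν.rowLen (r₀ + 1) < ν.rowLen r₀) :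
    ∑ r ∈ range (L + 1), residue F ν L r / ((rowContent ν r : F) - (rowContent ν r₀ - 1)) = 0 := by
  rw [← sum_prod_sub_div_prod_sub_eq_zero (rowContent_cast_injective ν).injOn
    (fun i => (rowContent ν i : F) - 1) (s := range (L + 1)) (t := (range L).erase r₀)
    (by rw [card_erase_of_mem (mem_range.2 hr₀)]; simp; omega)]
  refine sum_congr rfl fun r _ => ?_
  have hne : (rowContent ν r : F) - (rowContent ν r₀ - 1) ≠ 0 := by
    have : rowContent ν r - (rowContent ν r₀ - 1) ≠ 0 := by
      simp only [rowContent]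
      rcases le_or_gt r r₀ with hr | hr
      · have := ν.rowLen_anti r r₀ hr; omega
      · have := ν.rowLen_anti (r₀ + 1) r hr; omega
    exact_mod_cast this
  simp only [residue, ← sub_sub_eq_add_sub]
  rw [← mul_prod_erase (range L) _ (mem_range.2 hr₀), mul_div_assoc, mul_div_cancel_left₀ _ hne]

theorem sum_addRow (hL : ν.colLen 0 < L) (f : ℕ → F) :
    ∑ x : AddRow ν, (hookProd (addCell ν x) : F)⁻¹ * f x.1 =
      (hookProd ν : F)⁻¹ * ∑ r ∈ range (L + 1), residue F ν L r * f r := by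
  classical
  have hterm (x : AddRow ν) : (hookProd (addCell ν x) : F)⁻¹ * f x.1 =
      (hookProd ν : F)⁻¹ * (residue F ν L x.1 * f x.1) := by
    have hν : (hookProd ν : F) ≠ 0 := Nat.cast_ne_zero.2 (hookProd_pos ν).ne'
    have hadd : (hookProd (addCell ν x) : F) ≠ 0 := Nat.cast_ne_zero.2 (hookProd_pos _).ne'
    field_simp
    rw [hookProd_eq_mul_residue x hL]
    ring
  rw [sum_congr rfl fun x _ => hterm x, ← mul_sum, ← sum_filter_of_ne (p := IsAddable ν),
    ← sum_subtype (f := fun r => residue F ν L r * f r)]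
  · intro r
    rw [mem_filter, mem_range]
    exact ⟨And.right, fun h => ⟨by have := h.le_colLen; omega, h⟩⟩
  · intro r hr hne
    by_contra h
    exact hne (by rw [residue_eq_zero (Nat.lt_succ_iff.1 (mem_range.1 hr)) h, zero_mul])

theorem sum_inv_hookProd_addCell (ν : YoungDiagram) :
    ∑ x : AddRow ν, (hookProd (addCell ν x) : F)⁻¹ = (hookProd ν : F)⁻¹ := by
  simpa [sum_residue] using sum_addRow (F := F) (Nat.lt_succ_self (ν.colLen 0)) fun _ => 1

theorem sum_inv_hookProd_addCell_div {r c : ℕ} (h : (r, c) ∈ ν) (hright : (r, c + 1) ∉ ν)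
    (hbelow : (r + 1, c) ∉ ν) :
    ∑ x : AddRow ν, (hookProd (addCell ν x) : F)⁻¹ *
      ((rowContent ν x.1 - ((c : ℤ) - r) : ℤ) : F)⁻¹ = 0 := by
  rw [YoungDiagram.mem_iff_lt_rowLen] at h hright hbelow
  have hr : r < ν.colLen 0 := YoungDiagram.mem_iff_lt_colLen.1
    (YoungDiagram.mem_iff_lt_rowLen.2 ((Nat.zero_le _).trans_lt h))
  have hc : (c : ℤ) - r = rowContent ν r - 1 := by
    simp only [rowContent]
    omega
  have hsum := sum_residue_div (F := F) (Nat.lt_succ_of_lt hr) (by omega : ν.rowLen (r + 1) < _)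
  rw [sum_addRow (Nat.lt_succ_self (ν.colLen 0)) fun x =>
    ((rowContent ν x - ((c : ℤ) - r) : ℤ) : F)⁻¹, hc]
  push_cast
  simp only [← div_eq_mul_inv, hsum, mul_zero]

end HookSums

section Telescope

variable {F : Type*} [Field F]

theorem prod_range_one_sub_inv_sq {w : F} (hw : ∀ z : ℤ, w - z ≠ 0) (l : ℕ) :
    ∏ j ∈ range l, (1 - 1 / (w - j) ^ 2) = (w - l) / (w + 1 - l) * ((w + 1) / w) := by
  have h0 : w ≠ 0 := by simpa using hw 0
  induction l with
  | zero =>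
    have h1 : w + 1 ≠ 0 := by simpa using hw (-1)
    simp [h0, h1]
  | succ l ih =>
    have hl : w - l ≠ 0 := by simpa using hw l
    have hl' : w + 1 - l ≠ 0 := by simpa [← sub_add, sub_add_eq_add_sub] using hw (l - 1)
    have hl'' : w + 1 - (l + 1 : ℕ) ≠ 0 := by simpa using hl
    rw [prod_range_succ, ih]
    push_cast at hl'' ⊢
    field_simp
    ring

theorem prod_range_add_one_div {u : F} (hu : ∀ z : ℤ, u - z ≠ 0) (L : ℕ) :
    ∏ i ∈ range L, (u + i + 1) / (u + i) = (u + L) / u := by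
  induction L with
  | zero =>
    have : u ≠ 0 := by simpa using hu 0
    simp [this]
  | succ L ih =>
    have : u + L ≠ 0 := by simpa using hu (-L)
    rw [prod_range_succ, ih]
    field_simp
    push_cast
    ring

/-- The product telescopes along each row, and then along the rows. -/
theorem mul_prod_cells_one_sub_inv_sq {u : F} (hu : ∀ z : ℤ, u - z ≠ 0) {ν : YoungDiagram} {L : ℕ}
    (hL : ν.colLen 0 ≤ L) :
    u * ∏ q ∈ ν.cells, (1 - 1 / (u - (((q.2 : ℤ) - q.1 : ℤ) : F)) ^ 2) =
      (∏ i ∈ range (L + 1), (u - rowContent ν i)) / ∏ i ∈ range L, (u + 1 - rowContent ν i) := by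
  have hrow (i : ℕ) : ∏ j ∈ range (ν.rowLen i), (1 - 1 / (u - (((j : ℤ) - i : ℤ) : F)) ^ 2) =
      (u - rowContent ν i) / (u + 1 - rowContent ν i) * ((u + i + 1) / (u + i)) := by
    have := prod_range_one_sub_inv_sq (w := u + i) (fun z => by
      have := hu (z - i); push_cast at this; rwa [← sub_add_eq_add_sub, sub_add]) (ν.rowLen i)
    convert this using 3 <;> push_cast [rowContent] <;> ring
  have hu0 : u ≠ 0 := by simpa using hu 0
  rw [prod_cells hL, prod_congr rfl fun i _ => hrow i, prod_mul_distrib,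
    prod_range_add_one_div hu, prod_div_distrib, prod_range_succ, rowContent_eq_neg hL]
  field_simp
  push_cast
  ring

end Telescope

/-! ### The chain of groups `G(m,1,n+1)` -/

section Group

variable {m n : ℕ}

theorem mk_relator_eq_one {r : FreeGroup (Gen n)} (h : IsRelator m n r) :
    PresentedGroup.mk {r | IsRelator m n r} r = 1 :=
  PresentedGroup.mk_eq_one_iff.2 (Subgroup.subset_normalClosure h)

theorem gs_mul_self (i : Fin n) : gs m i * gs m i = 1 :=
  mk_relator_eq_one (IsRelator.s_sq i)

theorem gs_braid (i j : Fin n) (h : (j : ℕ) = i + 1) :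
    gs m i * gs m j * gs m i = gs m j * gs m i * gs m j :=
  mul_inv_eq_one.1 (mk_relator_eq_one (IsRelator.s_braid i j h))

theorem gs_commute_gs (i j : Fin n) (h : (i : ℕ) + 1 < j) : Commute (gs m i) (gs m j) :=
  mul_inv_eq_one.1 (mk_relator_eq_one (IsRelator.s_comm i j h))

theorem gt_gs_braid (i : Fin n) (h : (i : ℕ) = 0) :
    gt m n * gs m i * gt m n * gs m i = gs m i * gt m n * gs m i * gt m n :=
  mul_inv_eq_one.1 (mk_relator_eq_one (IsRelator.t_braid i h))

theorem gs_commute_gt (i : Fin n) (h : 0 < (i : ℕ)) : Commute (gs m i) (gt m n) :=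
  mul_inv_eq_one.1 (mk_relator_eq_one (IsRelator.t_comm i h))

theorem gt_pow_eq_one : gt m n ^ m = 1 :=
  mk_relator_eq_one IsRelator.t_pow

/-- The images of the generators of `G(m,1,n+1)` in `G(m,1,n+2)`. -/
def inclGen (m n : ℕ) : Gen n → G m (n + 1)
  | Gen.t => gt m (n + 1)
  | Gen.s i => gs m i.castSucc

theorem lift_inclGen_eq_one (m n : ℕ) :
    ∀ r ∈ {r | IsRelator m n r}, FreeGroup.lift (inclGen m n) r = 1 := by
  rintro r (⟨i⟩ | ⟨i, j, h⟩ | ⟨i, j, h⟩ | ⟨i, h⟩ | ⟨i, h⟩ | _) <;>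
    simp only [map_mul, map_inv, map_pow, fs, ft, FreeGroup.lift_apply_of, mul_inv_eq_one, inclGen]
  · exact gs_mul_self _
  · exact gs_braid _ _ h
  · exact gs_commute_gs _ _ h
  · exact gt_gs_braid _ h
  · exact gs_commute_gt _ h
  · exact gt_pow_eq_one

/-- The homomorphism `G(m,1,n+1) → G(m,1,n+2)` that preserves the names of the generators. -/
def incl (m n : ℕ) : G m n →* G m (n + 1) := PresentedGroup.toGroup (lift_inclGen_eq_one m n)

@[simp] theorem incl_gt : incl m n (gt m n) = gt m (n + 1) :=
  PresentedGroup.toGroup.of (lift_inclGen_eq_one m n)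

@[simp] theorem incl_gs (i : Fin n) : incl m n (gs m i) = gs m i.castSucc :=
  PresentedGroup.toGroup.of (lift_inclGen_eq_one m n)

theorem mem_of_gt_mem_of_gs_mem {H : Subgroup (G m n)} (ht : gt m n ∈ H) (hs : ∀ i, gs m i ∈ H)
    (g : G m n) : g ∈ H := by
  refine PresentedGroup.generated_by _ H (fun j => ?_) g
  cases j with
  | t => exact ht
  | s i => exact hs i

/-- The last generator `s_{n+1}` of `G(m,1,n+2)`. -/
def lastS (m n : ℕ) : G m (n + 1) := gs m (Fin.last n)

theorem lastS_mul_self : lastS m n * lastS m n = 1 := gs_mul_self _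

theorem lastS_inv : (lastS m n)⁻¹ = lastS m n := inv_eq_of_mul_eq_one_left lastS_mul_self

theorem mem_of_incl_mem_of_lastS_mem {H : Subgroup (G m (n + 1))} (hi : ∀ h, incl m n h ∈ H)
    (hs : lastS m n ∈ H) (g : G m (n + 1)) : g ∈ H := by
  refine mem_of_gt_mem_of_gs_mem (by simpa using hi (gt m n)) (Fin.lastCases hs fun i => ?_) g
  simpa using hi (gs m i)

theorem lastS_commute_incl_incl (h : G m n) :
    Commute (lastS m (n + 1)) (incl m (n + 1) (incl m n h)) := by
  suffices h ∈ (Subgroup.centralizer {lastS m (n + 1)}).comap ((incl m (n + 1)).comp (incl m n)) by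
    exact (Subgroup.mem_centralizer_singleton_iff.1 (Subgroup.mem_comap.1 this)).symm
  refine mem_of_gt_mem_of_gs_mem ?_ (fun i => ?_) h <;>
    rw [Subgroup.mem_comap, Subgroup.mem_centralizer_singleton_iff]
  · simpa [lastS] using (gs_commute_gt (m := m) (Fin.last (n + 1)) (by simp)).eq.symm
  · simpa [lastS] using (gs_commute_gs (m := m) i.castSucc.castSucc (Fin.last _) (by simp)).eq

theorem lastS_incl_lastS_braid :
    lastS m (n + 1) * incl m (n + 1) (lastS m n) * lastS m (n + 1) =
      incl m (n + 1) (lastS m n) * lastS m (n + 1) * incl m (n + 1) (lastS m n) := by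
  simpa [lastS] using (gs_braid (m := m) (Fin.last n).castSucc (Fin.last _) (by simp)).symm

/-- The conjugate `s_n ⋯ s_1 t s_1 ⋯ s_n` of `t` in `G(m,1,n+1)`, which multiplies the last
coordinate of the reflection representation by a root of unity. -/
def lastT (m : ℕ) : (n : ℕ) → G m n
  | 0 => gt m 0
  | n + 1 => lastS m n * incl m n (lastT m n) * lastS m n

theorem lastT_succ_zpow (j : ℤ) :
    lastT m (n + 1) ^ j = lastS m n * incl m n (lastT m n ^ j) * lastS m n := by
  have hconj : lastT m (n + 1) = lastS m n * incl m n (lastT m n) * (lastS m n)⁻¹ := by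
    rw [lastS_inv, lastT]
  rw [hconj, conj_zpow, ← map_zpow, lastS_inv]

theorem lastT_pow_eq_one (m : ℕ) : ∀ n, lastT m n ^ m = 1
  | 0 => gt_pow_eq_one
  | n + 1 => by
    rw [← zpow_natCast, lastT_succ_zpow, zpow_natCast, lastT_pow_eq_one m n, map_one, mul_one,
      lastS_mul_self]

theorem exists_eq_lastT_zero_zpow (g : G m 0) : ∃ j : ℤ, g = lastT m 0 ^ j := by
  have hg : g ∈ Subgroup.zpowers (gt m 0) :=
    mem_of_gt_mem_of_gs_mem (Subgroup.mem_zpowers _) (fun i => i.elim0) g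
  obtain ⟨j, hj⟩ := Subgroup.mem_zpowers_iff.1 hg
  exact ⟨j, hj.symm⟩

theorem lastT_one_commute_gt : Commute (lastT m 1) (gt m 1) := by
  have hbraid := gt_gs_braid (m := m) (Fin.last 0) rfl
  simp only [Commute, SemiconjBy, lastT, incl_gt, lastS, ← hbraid]
  simp only [mul_assoc]

theorem lastT_commute_incl_lastS :
    Commute (lastT m (n + 2)) (incl m (n + 1) (lastS m n)) := by
  set a := lastS m (n + 1) with ha
  set b := incl m (n + 1) (lastS m n) with hb
  set x := incl m (n + 1) (incl m n (lastT m n))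
  have hax : a * x = x * a := lastS_commute_incl_incl _
  have hab : a * b * a = b * a * b := lastS_incl_lastS_braid
  have hT : lastT m (n + 2) = a * (b * x * b) * a := by
    simp only [lastT, map_mul, ha, hb, x]
  rw [hT]
  calc a * (b * x * b) * a * b = a * b * x * (b * a * b) := by simp only [mul_assoc]
    _ = a * b * (x * a) * b * a := by rw [← hab]; simp only [mul_assoc]
    _ = a * b * a * x * b * a := by rw [← hax]; simp only [mul_assoc]
    _ = b * (a * (b * x * b) * a) := by rw [hab]; simp only [mul_assoc]

theorem lastT_commute_incl : ∀ (n : ℕ) (h : G m n), Commute (lastT m (n + 1)) (incl m n h)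
  | 0, h => by
    obtain ⟨j, rfl⟩ := exists_eq_lastT_zero_zpow h
    rw [map_zpow, lastT, incl_gt]
    exact lastT_one_commute_gt.zpow_right j
  | n + 1, h => by
    suffices h ∈ (Subgroup.centralizer {lastT m (n + 2)}).comap (incl m (n + 1)) by
      exact (Subgroup.mem_centralizer_singleton_iff.1 (Subgroup.mem_comap.1 this)).symm
    refine mem_of_incl_mem_of_lastS_mem (fun h => ?_) ?_ h <;>
      rw [Subgroup.mem_comap, Subgroup.mem_centralizer_singleton_iff]
    · have hS := lastS_commute_incl_incl h
      have hT := (lastT_commute_incl n h).map (incl m (n + 1))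
      exact ((hS.mul_left hT).mul_left hS).symm
    · exact lastT_commute_incl_lastS.symm

/-- With `H` the image of `G(m,1,n+1)` in `G(m,1,n+2)`, the element `g` lies in `H ⟨lastT⟩` or in
the double coset `H s_{n+1} H`. This is a normal form for `G(m,1,n+2)` over `H`, see `isSplit`. -/
def IsSplit (g : G m (n + 1)) : Prop :=
  (∃ (h : G m n) (j : ℤ), g = incl m n h * lastT m (n + 1) ^ j) ∨
    ∃ h h' : G m n, g = incl m n h * lastS m n * incl m n h'

theorem IsSplit.mul_incl {g : G m (n + 1)} (hg : IsSplit g) (k : G m n) :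
    IsSplit (g * incl m n k) := by
  rcases hg with ⟨h, j, rfl⟩ | ⟨h, h', rfl⟩
  · refine Or.inl ⟨h * k, j, ?_⟩
    rw [mul_assoc, ((lastT_commute_incl n k).zpow_left j).eq, map_mul, mul_assoc]
  · exact Or.inr ⟨h, h' * k, by rw [map_mul, mul_assoc]⟩

theorem IsSplit.incl_mul {g : G m (n + 1)} (hg : IsSplit g) (k : G m n) :
    IsSplit (incl m n k * g) := by
  rcases hg with ⟨h, j, rfl⟩ | ⟨h, h', rfl⟩
  · exact Or.inl ⟨k * h, j, by rw [map_mul, mul_assoc]⟩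
  · exact Or.inr ⟨k * h, h', by rw [map_mul]; simp only [mul_assoc]⟩

theorem IsSplit.of_lastS_mul_incl_mul_lastS
    (hconj : ∀ h : G m n, IsSplit (lastS m n * incl m n h * lastS m n)) (g : G m (n + 1)) :
    IsSplit g := by
  have hmul : ∀ g : G m (n + 1), IsSplit g → IsSplit (g * lastS m n) := by
    rintro _ (⟨h, j, rfl⟩ | ⟨h, h', rfl⟩)
    · refine Or.inr ⟨h, lastT m n ^ j, ?_⟩
      rw [lastT_succ_zpow]
      simp only [mul_assoc, lastS_mul_self, mul_one]
    · simpa only [mul_assoc] using (hconj h').incl_mul h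
  have hg : g ∈ Subgroup.closure (Set.range (incl m n) ∪ {lastS m n}) :=
    mem_of_incl_mem_of_lastS_mem (fun h => Subgroup.subset_closure (Or.inl ⟨h, rfl⟩))
      (Subgroup.subset_closure (Or.inr rfl)) g
  induction hg using Subgroup.closure_induction_right with
  | one => exact Or.inl ⟨1, 0, by simp⟩
  | mul_right x _ _ hy ih =>
    rcases hy with ⟨k, rfl⟩ | rfl
    · exact ih.mul_incl k
    · exact hmul _ ih
  | mul_inv_cancel x _ _ hy ih =>
    rcases hy with ⟨k, rfl⟩ | rfl
    · rw [← map_inv]; exact ih.mul_incl k⁻¹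
    · rw [lastS_inv]; exact hmul _ ih

theorem isSplit : ∀ (n : ℕ) (g : G m (n + 1)), IsSplit g
  | 0, g => by
    refine IsSplit.of_lastS_mul_incl_mul_lastS (fun h => ?_) g
    obtain ⟨j, rfl⟩ := exists_eq_lastT_zero_zpow h
    exact Or.inl ⟨1, j, by rw [lastT_succ_zpow, map_one, one_mul]⟩
  | n + 1, g => by
    refine IsSplit.of_lastS_mul_incl_mul_lastS (fun h => ?_) g
    rcases isSplit n h with ⟨k, j, rfl⟩ | ⟨k, k', rfl⟩
    · refine Or.inl ⟨incl m n k, j, ?_⟩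
      rw [lastT_succ_zpow (n := n + 1), map_mul, ← mul_assoc, (lastS_commute_incl_incl k).eq]
      simp only [mul_assoc]
    · have hk := (lastS_commute_incl_incl (m := m) k).eq
      have hk' := (lastS_commute_incl_incl (m := m) k').eq
      refine Or.inr ⟨incl m n k * lastS m n, lastS m n * incl m n k', ?_⟩
      simp only [map_mul]
      calc _ = lastS m (n + 1) * incl m (n + 1) (incl m n k) * incl m (n + 1) (lastS m n) *
            (incl m (n + 1) (incl m n k') * lastS m (n + 1)) := by simp only [mul_assoc]
        _ = incl m (n + 1) (incl m n k) * (lastS m (n + 1) * incl m (n + 1) (lastS m n) *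
            lastS m (n + 1)) * incl m (n + 1) (incl m n k') := by
          rw [hk, ← hk']; simp only [mul_assoc]
        _ = _ := by rw [lastS_incl_lastS_braid]; simp only [mul_assoc]

end Group

/-! ### Growth of standard tableaux -/

section Tableaux

variable {m n : ℕ} {μ μ' : Fin m → YoungDiagram} {w : Fin (n + 1) → Node m}

theorem shape_ext (h : ∀ q : Node m, q.2 ∈ μ q.1 ↔ q.2 ∈ μ' q.1) : μ = μ' := by
  funext k
  ext q
  exact h (k, q)

theorem IsStandard.shape_unique (h : IsStandard μ w) (h' : IsStandard μ' w) : μ = μ' :=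
  shape_ext fun q => (h.mem_range q).symm.trans (h'.mem_range q)

theorem StdTableau.node_injective : Function.Injective (StdTableau.node (n := n) (μ := μ)) := by
  rintro ⟨w, h⟩ ⟨_, _⟩ rfl
  rfl

theorem IsStandard.mem (h : IsStandard μ w) (a : Fin (n + 1)) : (w a).2 ∈ μ (w a).1 :=
  (h.mem_range _).1 ⟨a, rfl⟩

theorem IsStandard.card_le (h : IsStandard μ w) {s : Finset (Node m)}
    (hs : ∀ q ∈ s, q.2 ∈ μ q.1) : s.card ≤ n + 1 := by
  have hsub : s ⊆ univ.image w := fun q hq => by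
    simpa using (h.mem_range q).2 (hs q hq)
  simpa using (card_le_card hsub).trans card_image_le

theorem IsStandard.lt_and_lt (h : IsStandard μ w) {q : Node m} (hq : q.2 ∈ μ q.1) :
    q.2.1 < n + 1 ∧ q.2.2 < n + 1 := by
  constructor
  · have hcol := h.card_le (s := (range (q.2.1 + 1)).image fun i => (q.1, (i, q.2.2))) (by
      simp only [mem_image, Finset.mem_range, forall_exists_index, and_imp]
      rintro _ i hi rfl
      exact (μ q.1).up_left_mem (Nat.lt_succ_iff.1 hi) le_rfl hq)
    rwa [card_image_of_injective _ fun i j => by simp, card_range] at hcol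
  · have hrow := h.card_le (s := (range (q.2.2 + 1)).image fun i => (q.1, (q.2.1, i))) (by
      simp only [mem_image, Finset.mem_range, forall_exists_index, and_imp]
      rintro _ i hi rfl
      exact (μ q.1).up_left_mem le_rfl (Nat.lt_succ_iff.1 hi) hq)
    rwa [card_image_of_injective _ fun i j => by simp, card_range] at hrow

theorem IsStandard.of_monotone (hinj : Function.Injective w)
    (hrange : ∀ q : Node m, (∃ a, w a = q) ↔ q.2 ∈ μ q.1)
    (hmono : ∀ a b, NodeLE (w a) (w b) → a ≤ b) : IsStandard μ w where
  inj := hinj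
  mem_range := hrange
  row a b hk hx hy :=
    (hmono a b ⟨hk, hx.le, hy.le⟩).lt_of_ne fun hab => by rw [hab] at hy; exact hy.false
  col a b hk hy hx :=
    (hmono a b ⟨hk, hx.le, hy.le⟩).lt_of_ne fun hab => by rw [hab] at hx; exact hx.false

theorem finite_setOf_isStandard (m n : ℕ) :
    {w : Fin (n + 1) → Node m | ∃ μ, IsStandard μ w}.Finite := by
  have hbox : {w : Fin (n + 1) → Node m |
      ∀ a, w a ∈ (Set.univ ×ˢ (Set.Iio (n + 1) ×ˢ Set.Iio (n + 1)) : Set (Node m))}.Finite :=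
    Set.Finite.pi' fun _ => Set.finite_univ.prod ((Set.finite_Iio _).prod (Set.finite_Iio _))
  refine hbox.subset ?_
  rintro w ⟨μ, h⟩ a
  simpa using h.lt_and_lt (h.mem a)

instance (n : ℕ) (μ : Fin m → YoungDiagram) : Finite (StdTableau n μ) := by
  have := (finite_setOf_isStandard m n).to_subtype
  refine Finite.of_injective
    (fun T : StdTableau n μ => (⟨T.node, μ, T.std⟩ : {w | ∃ μ, IsStandard μ w})) fun S T h => ?_
  exact StdTableau.node_injective (congrArg Subtype.val h)

noncomputable instance (n : ℕ) (μ : Fin m → YoungDiagram) : Fintype (StdTableau n μ) :=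
  Fintype.ofFinite _

noncomputable instance (n : ℕ) (μ : Fin m → YoungDiagram) : DecidableEq (StdTableau n μ) :=
  Classical.decEq _

/-- The `m`-partitions with `n + 1` nodes, encoded as the shapes of standard `m`-tableaux. -/
abbrev Shape (m n : ℕ) : Type := {μ : Fin m → YoungDiagram // Nonempty (StdTableau n μ)}

instance (m n : ℕ) : Finite (Shape m n) := by
  have := (finite_setOf_isStandard m n).to_subtype
  refine Finite.of_surjective
    (fun w : {w : Fin (n + 1) → Node m | ∃ μ, IsStandard μ w} =>
      (⟨w.2.choose, ⟨⟨w.1, w.2.choose_spec⟩⟩⟩ : Shape m n)) ?_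
  rintro ⟨μ, ⟨T⟩⟩
  refine ⟨⟨T.node, μ, T.std⟩, Subtype.ext ?_⟩
  exact IsStandard.shape_unique (Exists.choose_spec (p := fun μ => IsStandard μ T.node) _) T.std

noncomputable instance (m n : ℕ) : Fintype (Shape m n) := Fintype.ofFinite _

/-- The addable nodes of an `m`-partition. -/
abbrev AddNode (μ : Fin m → YoungDiagram) : Type := Σ k : Fin m, AddRow (μ k)

/-- The node added by `a : AddNode μ`, at the end of its row. -/
def AddNode.node (a : AddNode μ) : Node m := (a.1, (a.2.1, (μ a.1).rowLen a.2.1))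

/-- The `m`-partition obtained from `μ` by adding a node. -/
def addNode (μ : Fin m → YoungDiagram) (a : AddNode μ) : Fin m → YoungDiagram :=
  Function.update μ a.1 (addCell (μ a.1) a.2)

theorem mem_addNode {a : AddNode μ} {q : Node m} :
    q.2 ∈ addNode μ a q.1 ↔ q = AddNode.node a ∨ q.2 ∈ μ q.1 := by
  obtain ⟨k, q⟩ := q
  obtain ⟨j, x⟩ := a
  by_cases h : k = j
  · subst h
    simp [addNode, mem_addCell, AddNode.node]
  · simp [addNode, AddNode.node, h]

theorem AddNode.node_notMem (a : AddNode μ) : (AddNode.node a).2 ∉ μ (AddNode.node a).1 := by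
  simp [AddNode.node, YoungDiagram.mem_iff_lt_rowLen]

theorem AddNode.node_injective : Function.Injective (AddNode.node (μ := μ)) := by
  rintro ⟨k, x⟩ ⟨k', x'⟩ h
  simp only [AddNode.node, Prod.mk.injEq] at h
  obtain ⟨rfl, h, _⟩ := h
  rw [Subtype.ext h]

theorem AddNode.content_node (a : AddNode μ) :
    content (AddNode.node a) = rowContent (μ a.1) a.2.1 := rfl

open Classical in
/-- The shape of the part of a standard filling that carries the numbers at most `k`. -/
noncomputable def partialShape (h : IsStandard μ w) (k : ℕ) (j : Fin m) : YoungDiagram where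
  cells := (μ j).cells.filter fun q => ∃ i : Fin (n + 1), i.1 < k ∧ w i = (j, q)
  isLowerSet := by
    rintro ⟨x, y⟩ ⟨x', y'⟩ ⟨hx, hy⟩ hq
    simp only [mem_coe, mem_filter, YoungDiagram.mem_cells] at hq ⊢
    simp only at hx hy
    obtain ⟨hq, i, hi, hwi⟩ := hq
    have hq' := (μ j).up_left_mem hx hy hq
    obtain ⟨d, hd⟩ := (h.mem_range (j, (x', y'))).2 hq'
    have hdi : d ≤ i := h.mono (by simp [hd, hwi]) (by simpa [hd, hwi]) (by simpa [hd, hwi])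
    exact ⟨hq', d, lt_of_le_of_lt (Fin.le_def.1 hdi) hi, hd⟩

theorem mem_partialShape {h : IsStandard μ w} {k : ℕ} {q : Node m} :
    q.2 ∈ partialShape h k q.1 ↔ ∃ i : Fin (n + 1), i.1 < k ∧ w i = q := by
  rw [← YoungDiagram.mem_cells, partialShape, mem_filter, YoungDiagram.mem_cells]
  refine ⟨fun hq => hq.2, fun hq => ⟨?_, hq⟩⟩
  obtain ⟨i, _, rfl⟩ := hq
  exact h.mem i

theorem partialShape_add_one_eq (h : IsStandard μ w) : partialShape h (n + 1) = μ :=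
  shape_ext fun q => by
    rw [mem_partialShape, ← h.mem_range]
    exact ⟨fun ⟨i, _, hi⟩ => ⟨i, hi⟩, fun ⟨i, hi⟩ => ⟨i, i.2, hi⟩⟩

theorem partialShape_zero (h : IsStandard μ w) : partialShape h 0 = fun _ => ⊥ :=
  shape_ext fun q => by
    rw [mem_partialShape]
    simp

theorem mem_partialShape_of_nodeLE (h : IsStandard μ w) {k : Fin (n + 1)} {q : Node m}
    (hle : NodeLE q (w k)) (hne : q ≠ w k) : q.2 ∈ partialShape h k q.1 := by
  obtain ⟨hpos, hx, hy⟩ := hle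
  have hq : q.2 ∈ μ q.1 := hpos ▸ (μ (w k).1).up_left_mem hx hy (h.mem k)
  obtain ⟨d, rfl⟩ := (h.mem_range q).2 hq
  exact mem_partialShape.2 ⟨d, (h.mono hpos hx hy).lt_of_ne fun hd => hne (by rw [hd]), rfl⟩

theorem rowLen_partialShape (h : IsStandard μ w) (k : Fin (n + 1)) :
    (partialShape h k (w k).1).rowLen (w k).2.1 = (w k).2.2 := by
  refine eq_of_forall_lt_iff fun y => ?_
  rw [← YoungDiagram.mem_iff_lt_rowLen]
  refine ⟨fun hq => ?_, fun hy => ?_⟩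
  · obtain ⟨i, hi, hwi⟩ := mem_partialShape (q := ((w k).1, ((w k).2.1, y))).1 hq
    by_contra! hy
    have hki : k ≤ i := h.mono (by simp [hwi]) (by simp [hwi]) (by simpa [hwi] using hy)
    exact absurd hi (not_lt.2 (Fin.le_def.1 hki))
  · exact mem_partialShape_of_nodeLE (q := ((w k).1, ((w k).2.1, y))) h ⟨rfl, le_rfl, hy.le⟩
      fun hq => hy.ne (congrArg (fun q : Node m => q.2.2) hq)

theorem isAddable_partialShape (h : IsStandard μ w) (k : Fin (n + 1)) :
    IsAddable (partialShape h k (w k).1) (w k).2.1 := by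
  intro i hi
  rw [rowLen_partialShape, ← YoungDiagram.mem_iff_lt_rowLen]
  exact mem_partialShape_of_nodeLE (q := ((w k).1, (i, (w k).2.2))) h ⟨rfl, hi.le, le_rfl⟩
    fun hq => hi.ne (congrArg (fun q : Node m => q.2.1) hq)

theorem exists_addNode (h : IsStandard μ w) (k : Fin (n + 1)) :
    ∃ a : AddNode (partialShape h k), AddNode.node a = w k ∧
      addNode (partialShape h k) a = partialShape h (k + 1) := by
  let a : AddNode (partialShape h k) := ⟨(w k).1, (w k).2.1, isAddable_partialShape h k⟩
  have hnode : AddNode.node a = w k := by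
    simp [AddNode.node, a, rowLen_partialShape h k]
  refine ⟨a, hnode, shape_ext fun q => ?_⟩
  rw [mem_addNode, hnode, mem_partialShape, mem_partialShape]
  constructor
  · rintro (rfl | ⟨i, hi, hwi⟩)
    · exact ⟨k, Nat.lt_succ_self _, rfl⟩
    · exact ⟨i, hi.trans (Nat.lt_succ_self _), hwi⟩
  · rintro ⟨i, hi, hwi⟩
    rcases (Nat.lt_succ_iff.1 hi).lt_or_eq with hi | hi
    · exact Or.inr ⟨i, hi, hwi⟩
    · exact Or.inl (by rw [← hwi, Fin.ext hi])

/-- The filling `w` with the next number put into the node `q`. -/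
def extend (w : Fin (n + 1) → Node m) (q : Node m) : Fin (n + 2) → Node m :=
  Fin.snoc (α := fun _ => Node m) w q

@[simp] theorem extend_castSucc (w : Fin (n + 1) → Node m) (q : Node m) (i : Fin (n + 1)) :
    extend w q i.castSucc = w i := Fin.snoc_castSucc (α := fun _ => Node m) _ _ _

@[simp] theorem extend_last (w : Fin (n + 1) → Node m) (q : Node m) :
    extend w q (Fin.last (n + 1)) = q := Fin.snoc_last (α := fun _ => Node m) _ _

theorem extend_castSucc_last (w : Fin (n + 2) → Node m) :
    extend (fun i : Fin (n + 1) => w i.castSucc) (w (Fin.last (n + 1))) = w := by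
  funext i
  refine Fin.lastCases ?_ (fun i => ?_) i <;> simp

theorem IsStandard.comp_castSucc {w : Fin (n + 2) → Node m} (h : IsStandard μ w) :
    IsStandard (partialShape h (n + 1)) fun i : Fin (n + 1) => w i.castSucc where
  inj := h.inj.comp (Fin.castSucc_injective _)
  mem_range q := by
    rw [mem_partialShape]
    exact ⟨fun ⟨i, hi⟩ => ⟨i.castSucc, i.2, hi⟩, fun ⟨i, hi, hwi⟩ => ⟨⟨i, hi⟩, hwi⟩⟩
  row a b hk hx hy := h.row _ _ hk hx hy
  col a b hk hy hx := h.col _ _ hk hy hx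

theorem IsStandard.of_extend {a : AddNode μ}
    (h : IsStandard (addNode μ a) (CyclotomicFusion.extend w (AddNode.node a))) :
    IsStandard μ w := by
  have hinit := h.comp_castSucc
  simp only [extend_castSucc] at hinit
  convert hinit using 1
  refine shape_ext fun q => ?_
  have hrange := h.mem_range q
  rw [mem_addNode] at hrange
  rw [mem_partialShape]
  constructor
  · intro hq
    obtain ⟨i, hi⟩ := hrange.2 (Or.inr hq)
    refine ⟨i, lt_of_le_of_ne (Nat.lt_succ_iff.1 i.2) fun hlast => a.node_notMem ?_, hi⟩
    rw [show i = Fin.last (n + 1) from Fin.ext hlast, extend_last] at hi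
    rwa [← hi] at hq
  · rintro ⟨i, hi, hwi⟩
    refine (hrange.1 ⟨i, hwi⟩).resolve_left ?_
    rintro rfl
    have hlast : i = Fin.last (n + 1) := h.inj (hwi.trans (extend_last w (AddNode.node a)).symm)
    simp [hlast] at hi

theorem IsStandard.extend (h : IsStandard μ w) (a : AddNode μ) :
    IsStandard (addNode μ a) (CyclotomicFusion.extend w (AddNode.node a)) := by
  have hne : ∀ i, w i ≠ AddNode.node a := fun i hi => a.node_notMem (hi ▸ h.mem i)
  refine .of_monotone ?_ (fun q => ?_) ?_
  · rw [CyclotomicFusion.extend, Fin.snoc_injective_iff]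
    exact ⟨h.inj, fun ⟨i, hi⟩ => hne i hi⟩
  · rw [mem_addNode, ← h.mem_range, Fin.exists_fin_succ']
    simp only [extend_castSucc, extend_last, or_comm, eq_comm]
  · intro i j
    refine Fin.lastCases ?_ (fun j => ?_) j
    · exact fun _ => Fin.le_last i
    · refine Fin.lastCases (fun hle => ?_) (fun i hle => ?_) i
      · rw [extend_last, extend_castSucc] at hle
        exact absurd (hle.1 ▸ (μ (w j).1).isLowerSet hle.2 (h.mem j)) a.node_notMem
      rw [extend_castSucc, extend_castSucc] at hle
      exact Fin.castSucc_le_castSucc_iff.2 (h.mono hle.1 hle.2.1 hle.2.2)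

theorem isStandard_extend_iff (a : AddNode μ) :
    IsStandard (addNode μ a) (extend w (AddNode.node a)) ↔ IsStandard μ w :=
  ⟨.of_extend, fun h => h.extend a⟩

/-- The standard tableau `T` with the next number put into an addable node of its shape. -/
def StdTableau.extend (T : StdTableau n μ) (a : AddNode μ) : StdTableau (n + 1) (addNode μ a) :=
  ⟨CyclotomicFusion.extend T.node (AddNode.node a), T.std.extend a⟩

theorem IsStandard.exists_eq_extend {w : Fin (n + 2) → Node m} (h : IsStandard μ w) :
    ∃ (ν : Fin m → YoungDiagram) (a : AddNode ν) (U : StdTableau n ν), addNode ν a = μ ∧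
      CyclotomicFusion.extend U.node (AddNode.node a) = w := by
  obtain ⟨a, ha, hν⟩ := exists_addNode h (Fin.last (n + 1))
  refine ⟨_, a, ⟨_, h.comp_castSucc⟩, hν.trans (partialShape_add_one_eq h), ?_⟩
  rw [ha]
  exact extend_castSucc_last w

/-- The map `(U, a) ↦ U.extend a` on all standard tableaux of a given size; by
`extendSigma_bijective`, each standard tableau with at least two nodes arises exactly once. -/
def extendSigma (x : Σ μ : Shape m n, StdTableau n μ.1 × AddNode μ.1) :
    Σ μ : Shape m (n + 1), StdTableau (n + 1) μ.1 :=
  ⟨⟨addNode x.1.1 x.2.2, ⟨x.2.1.extend x.2.2⟩⟩, x.2.1.extend x.2.2⟩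

theorem extendSigma_bijective : Function.Bijective (extendSigma (m := m) (n := n)) := by
  constructor
  · rintro ⟨⟨μ, hμ⟩, U, a⟩ ⟨⟨μ', hμ'⟩, U', a'⟩ h
    have hext : extend U.node (AddNode.node a) = extend U'.node (AddNode.node a') :=
      congrArg (fun y : Σ μ : Shape m (n + 1), StdTableau (n + 1) μ.1 => y.2.node) h
    obtain ⟨hU, ha⟩ := Fin.snoc_injective2 hext
    obtain rfl := U.std.shape_unique (hU ▸ U'.std)
    rw [StdTableau.node_injective hU, AddNode.node_injective ha]
  · rintro ⟨⟨μ, hμ⟩, T⟩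
    obtain ⟨ν, a, U, rfl, hw⟩ := T.std.exists_eq_extend
    obtain rfl : U.extend a = T := StdTableau.node_injective hw
    exact ⟨⟨⟨ν, ⟨U⟩⟩, U, a⟩, rfl⟩

theorem sum_stdTableau_succ {M : Type*} [AddCommMonoid M]
    (F : ∀ μ : Fin m → YoungDiagram, StdTableau (n + 1) μ → M) :
    ∑ μ : Shape m (n + 1), ∑ T : StdTableau (n + 1) μ.1, F μ.1 T =
      ∑ μ : Shape m n, ∑ U : StdTableau n μ.1, ∑ a : AddNode μ.1, F _ (U.extend a) := by
  simp only [← Fintype.sum_prod_type', ← Fintype.sum_sigma']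
  exact (Fintype.sum_bijective extendSigma extendSigma_bijective _ _ fun _ => rfl).symm

end Tableaux

/-! ### The Plancherel weights -/

section Weights

variable {m n : ℕ} {μ : Fin m → YoungDiagram}

theorem fCoeff_eq_prod_inv_hookProd (μ : Fin m → YoungDiagram) :
    fCoeff μ = ∏ k, (hookProd (μ k) : ℂ)⁻¹ := by
  simp only [fCoeff, hookProd, Nat.cast_prod, prod_inv_distrib]

theorem cast_hookProd_ne_zero (ν : YoungDiagram) : (hookProd ν : ℂ) ≠ 0 :=
  Nat.cast_ne_zero.2 (hookProd_pos ν).ne'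

theorem fCoeff_ne_zero (μ : Fin m → YoungDiagram) : fCoeff μ ≠ 0 := by
  rw [fCoeff_eq_prod_inv_hookProd]
  exact prod_ne_zero_iff.2 fun k _ => inv_ne_zero (cast_hookProd_ne_zero _)

theorem fCoeff_addNode (a : AddNode μ) :
    fCoeff (addNode μ a) =
      fCoeff μ * hookProd (μ a.1) * (hookProd (addCell (μ a.1) a.2) : ℂ)⁻¹ := by
  have hne : (hookProd (μ a.1) : ℂ) ≠ 0 := cast_hookProd_ne_zero _
  have herase : ∏ k ∈ univ.erase a.1, (hookProd (addNode μ a k) : ℂ)⁻¹ =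
      ∏ k ∈ univ.erase a.1, (hookProd (μ k) : ℂ)⁻¹ :=
    prod_congr rfl fun k hk => by rw [addNode, Function.update_of_ne (ne_of_mem_erase hk)]
  rw [fCoeff_eq_prod_inv_hookProd, fCoeff_eq_prod_inv_hookProd,
    ← mul_prod_erase univ _ (mem_univ a.1),
    ← mul_prod_erase univ (fun k => (hookProd (μ k) : ℂ)⁻¹) (mem_univ a.1), herase, addNode,
    Function.update_self]
  field_simp

theorem sum_fCoeff_addNode (μ : Fin m → YoungDiagram) (c : Fin m → ℂ) :
    ∑ a : AddNode μ, fCoeff (addNode μ a) * c a.1 = fCoeff μ * ∑ k, c k := by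
  rw [Fintype.sum_sigma, mul_sum]
  refine sum_congr rfl fun k _ => ?_
  simp only [fCoeff_addNode]
  rw [← sum_mul, ← mul_sum, sum_inv_hookProd_addCell, mul_assoc (fCoeff μ),
    mul_inv_cancel₀ (cast_hookProd_ne_zero _), mul_one]

theorem StdTableau.notMem_of_last_nodeLE (U : StdTableau n μ) {q : Node m}
    (hq : NodeLE (U.node (Fin.last n)) q) (hne : q ≠ U.node (Fin.last n)) : q.2 ∉ μ q.1 := by
  intro hmem
  obtain ⟨i, rfl⟩ := (U.std.mem_range q).2 hmem
  exact hne (congrArg U.node (Fin.last_le_iff.1 (U.std.mono hq.1 hq.2.1 hq.2.2)))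

theorem sum_fCoeff_addNode_mul_axialCoeff (U : StdTableau n μ) :
    ∑ a : AddNode μ, fCoeff (addNode μ a) * axialCoeff (U.node (Fin.last n)) a.node = 0 := by
  rw [Fintype.sum_sigma]
  refine sum_eq_zero fun k _ => ?_
  by_cases hk : (U.node (Fin.last n)).1 = k
  swap
  · refine sum_eq_zero fun x _ => ?_
    rw [axialCoeff, if_neg (by exact hk), mul_zero]
  subst hk
  set q := U.node (Fin.last n)
  have hright : (q.2.1, q.2.2 + 1) ∉ μ q.1 :=
    U.notMem_of_last_nodeLE (q := (q.1, (q.2.1, q.2.2 + 1))) ⟨rfl, le_rfl, Nat.le_succ _⟩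
      fun h => Nat.succ_ne_self _ (congrArg (fun q : Node m => q.2.2) h)
  have hbelow : (q.2.1 + 1, q.2.2) ∉ μ q.1 :=
    U.notMem_of_last_nodeLE (q := (q.1, (q.2.1 + 1, q.2.2))) ⟨rfl, Nat.le_succ _, le_rfl⟩
      fun h => Nat.succ_ne_self _ (congrArg (fun q : Node m => q.2.1) h)
  calc _ = ∑ x : AddRow (μ q.1), fCoeff μ * hookProd (μ q.1) *
        ((hookProd (addCell (μ q.1) x) : ℂ)⁻¹ *
          ((rowContent (μ q.1) x.1 - ((q.2.2 : ℤ) - q.2.1) : ℤ) : ℂ)⁻¹) := by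
        refine sum_congr rfl fun x _ => ?_
        rw [fCoeff_addNode, axialCoeff, if_pos (by rfl), AddNode.content_node]
        simp only [content, mul_assoc]
    _ = 0 := by
        rw [← mul_sum, sum_inv_hookProd_addCell_div (U.std.mem _) hright hbelow, mul_zero]

end Weights

section Roots

variable {m : ℕ} (ξ : Fin m ≃ rootsOfUnity m ℂ)

/-- The `k`-th root of unity as a complex number. -/
noncomputable abbrev rootVal (k : Fin m) : ℂ := ((ξ k : ℂˣ) : ℂ)

theorem rootVal_pow (k : Fin m) : rootVal ξ k ^ m = 1 := (mem_rootsOfUnity' m _).1 (ξ k).2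

theorem rootVal_ne_zero (k : Fin m) : rootVal ξ k ≠ 0 := Units.ne_zero _

theorem rootVal_injective : Function.Injective (rootVal ξ) := fun _ _ h =>
  ξ.injective (Subtype.ext (Units.ext h))

include ξ in
theorem order_pos : 0 < m := Fin.pos (ξ.symm 1)

theorem sum_rootVal_zpow (j : ℤ) :
    ∑ k, rootVal ξ k ^ j = if (m : ℤ) ∣ j then (m : ℂ) else 0 := by
  have : NeZero m := ⟨(order_pos ξ).ne'⟩
  let pow : rootsOfUnity m ℂ →* ℂ :=
    { toFun z := ((z : ℂˣ) : ℂ) ^ j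
      map_one' := by simp
      map_mul' x y := by simp [mul_zpow] }
  have hζ := Complex.isPrimitiveRoot_exp m (order_pos ξ).ne'
  have hpow : pow = 1 ↔ (m : ℤ) ∣ j := by
    rw [← hζ.zpow_eq_one_iff_dvd]
    refine ⟨fun h => by simpa [pow] using DFunLike.congr_fun h hζ.toRootsOfUnity, fun h => ?_⟩
    obtain ⟨l, rfl⟩ := (hζ.zpow_eq_one_iff_dvd j).1 h
    ext z
    simp [pow, zpow_mul, (mem_rootsOfUnity' m _).1 z.2]
  have : Fintype (rootsOfUnity m ℂ) := Fintype.ofEquiv _ ξ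
  classical
  calc ∑ k, rootVal ξ k ^ j = ∑ z, pow z := Equiv.sum_comp ξ pow
    _ = _ := by simp [sum_hom_units, hpow, ← Fintype.card_congr ξ]

end Roots

section Eigenvectors

variable {k H V W : Type*} [Field k] [Group H] [AddCommGroup V] [Module k V] [AddCommGroup W]
  [Module k W]

theorem apply_zpow_of_apply_eq_smul (ρ : Representation k H V) {g : H} {c : k} (hc : c ≠ 0) {x : V}
    (h : ρ g x = c • x) (j : ℤ) : ρ (g ^ j) x = c ^ j • x := by
  have hinv : ρ g⁻¹ x = c⁻¹ • x := by
    rw [eq_inv_smul_iff₀ hc, ← map_smul, ← h, ρ.inv_self_apply]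
  induction j with
  | zero => simp
  | succ j ih => rw [zpow_add_one, map_mul, Module.End.mul_apply, h, map_smul, ih, smul_smul,
      zpow_add_one₀ hc, mul_comm]
  | pred j ih => rw [zpow_sub_one, map_mul, Module.End.mul_apply, hinv, map_smul, ih, smul_smul,
      zpow_sub_one₀ hc, mul_comm]

/-- The subgroup of the elements of a group whose actions are intertwined by a linear map. -/
def intertwinedSubgroup (ρ : Representation k H V) (σ : Representation k H W) (L : V →ₗ[k] W) :
    Subgroup H where
  carrier := {g | ∀ x, σ g (L x) = L (ρ g x)}
  one_mem' x := by simp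
  mul_mem' {g h} hg hh x := by simp only [map_mul, Module.End.mul_apply, hg _, hh _]
  inv_mem' {g} hg x := by
    have hx := hg (ρ g⁻¹ x)
    rw [ρ.self_inv_apply] at hx
    rw [← hx, σ.inv_self_apply]

end Eigenvectors

section Extension

variable {m n : ℕ} {μ : Fin m → YoungDiagram} (ξ : Fin m ≃ rootsOfUnity m ℂ)

theorem StdTableau.extend_injective (a : AddNode μ) :
    Function.Injective fun U : StdTableau n μ => U.extend a := by
  intro U U' h
  have hnode : CyclotomicFusion.extend U.node a.node =
      CyclotomicFusion.extend U'.node a.node := congrArg StdTableau.node h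
  exact StdTableau.node_injective (Fin.snoc_injective2 hnode).1

/-- The embedding `V_μ → V_λ` for an `m`-partition `λ` with one more node, by which `V_λ` restricts
to the subgroup `G(m,1,n+1)`. -/
noncomputable def extMap (a : AddNode μ) : V n μ →ₗ[ℂ] V (n + 1) (addNode μ a) :=
  Finsupp.lmapDomain ℂ ℂ fun U => U.extend a

theorem extMap_single (a : AddNode μ) (U : StdTableau n μ) (c : ℂ) :
    extMap a (Finsupp.single U c) = Finsupp.single (U.extend a) c :=
  Finsupp.mapDomain_single

theorem extMap_vec (a : AddNode μ) (w : Fin (n + 1) → Node m) :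
    extMap a (vec μ w) = vec (addNode μ a) (extend w a.node) := by
  by_cases h : IsStandard μ w
  · let U : StdTableau n μ := ⟨w, h⟩
    exact (congrArg (extMap a) (vec_coe U)).trans
      ((extMap_single a U 1).trans (vec_coe (U.extend a)).symm)
  · rw [vec_of_not h, vec_of_not (mt (isStandard_extend_iff a).1 h), map_zero]

theorem extMap_apply_extend (a : AddNode μ) (x : V n μ) (U : StdTableau n μ) :
    extMap a x (U.extend a) = x U :=
  Finsupp.mapDomain_apply (StdTableau.extend_injective a) x U

theorem extMap_apply_of_node_last_ne (a : AddNode μ) (x : V n μ)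
    (S : StdTableau (n + 1) (addNode μ a)) (h : S.node (Fin.last (n + 1)) ≠ a.node) :
    extMap a x S = 0 := by
  refine Finsupp.mapDomain_of_notMem_range x S ?_
  rintro ⟨U, rfl⟩
  exact h (extend_last _ _)

theorem swapFilling_extend (w : Fin (n + 1) → Node m) (q : Node m) (i : Fin n) :
    swapFilling (extend w q) i.castSucc = extend (swapFilling w i) q := by
  funext j
  refine Fin.lastCases ?_ (fun j => ?_) j
  · have hne : Fin.last (n + 1) ≠ i.castSucc.castSucc ∧ Fin.last (n + 1) ≠ i.castSucc.succ := by
      simp only [ne_eq, Fin.ext_iff, Fin.val_last, Fin.val_castSucc, Fin.val_succ]; omega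
    rw [swapFilling_of_ne _ _ hne.1 hne.2, extend_last, extend_last]
  · rw [extend_castSucc]
    rw [swapFilling, Function.comp_apply, Fin.succ_castSucc,
      (Fin.castSucc_injective _).swap_apply, extend_castSucc]
    rfl

theorem sOp_extMap_vec (a : AddNode μ) (i : Fin n) (w : Fin (n + 1) → Node m) :
    sOp (addNode μ a) i.castSucc (extMap a (vec μ w)) = extMap a (sOp μ i (vec μ w)) := by
  have haxial : axial (extend w a.node) i.castSucc = axial w i := by
    simp only [axial, Fin.succ_castSucc, extend_castSucc]
  have hoffDiag : offDiag (addNode μ a) (extend w a.node) i.castSucc = offDiag μ w i := by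
    classical
    refine if_congr ?_ (by rw [haxial]) rfl
    rw [swapFilling_extend, isStandard_extend_iff, isStandard_extend_iff]
  simp only [extMap_vec, sOp_vec, map_add, map_smul, haxial, hoffDiag, swapFilling_extend]

theorem tOp_extMap_vec (a : AddNode μ) (w : Fin (n + 1) → Node m) :
    tOp (n + 1) ξ (addNode μ a) (extMap a (vec μ w)) = extMap a (tOp n ξ μ (vec μ w)) := by
  rw [extMap_vec, tOp_vec, tOp_vec, map_smul, extMap_vec, ← Fin.castSucc_zero, extend_castSucc]

theorem seminormalRep_incl_extMap (a : AddNode μ) (h : G m n) (x : V n μ) :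
    seminormalRep (n + 1) ξ (addNode μ a) (incl m n h) (extMap a x) =
      extMap a (seminormalRep n ξ μ h x) := by
  have hvec : ∀ {f : V (n + 1) (addNode μ a) →ₗ[ℂ] V (n + 1) (addNode μ a)}
      {g : V n μ →ₗ[ℂ] V n μ}, (∀ w, f (extMap a (vec μ w)) = extMap a (g (vec μ w))) →
      ∀ x, f (extMap a x) = extMap a (g x) := fun {f g} h => by
    refine LinearMap.congr_fun (f := f ∘ₗ extMap a) (g := extMap a ∘ₗ g) ?_
    refine Finsupp.lhom_ext' fun T => LinearMap.ext_ring ?_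
    simpa [vec_coe] using h T.node
  revert x
  refine mem_of_gt_mem_of_gs_mem (H := intertwinedSubgroup _
    ((seminormalRep (n + 1) ξ (addNode μ a)).comp (incl m n)) (extMap a)) ?_ (fun i => ?_) h
  · change ∀ x, seminormalRep _ ξ _ (incl m n (gt m n)) _ = _
    rw [incl_gt, seminormalRep_t, seminormalRep_t]
    exact hvec (tOp_extMap_vec ξ a)
  · change ∀ x, seminormalRep _ ξ _ (incl m n (gs m i)) _ = _
    rw [incl_gs, seminormalRep_s, seminormalRep_s]
    exact hvec (sOp_extMap_vec a i)

theorem seminormalRep_incl_vec_of_forall {h : G m n} {f : (Fin (n + 1) → Node m) → ℂ}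
    (hf : ∀ μ w, seminormalRep n ξ μ h (vec μ w) = f w • vec μ w) (μ : Fin m → YoungDiagram)
    (w : Fin (n + 2) → Node m) :
    seminormalRep (n + 1) ξ μ (incl m n h) (vec μ w) = f (fun i => w i.castSucc) • vec μ w := by
  by_cases hw : IsStandard μ w
  · obtain ⟨ν, a, U, rfl, rfl⟩ := hw.exists_eq_extend
    rw [← extMap_vec, seminormalRep_incl_extMap, hf, map_smul]
    simp only [extend_castSucc]
  · rw [vec_of_not hw, map_zero, smul_zero]

theorem seminormalRep_incl_vec_apply_eq_zero (h : G m n) {μ : Fin m → YoungDiagram}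
    {w : Fin (n + 2) → Node m} {S : StdTableau (n + 1) μ}
    (hne : S.node (Fin.last (n + 1)) ≠ w (Fin.last (n + 1))) :
    seminormalRep (n + 1) ξ μ (incl m n h) (vec μ w) S = 0 := by
  by_cases hw : IsStandard μ w
  · obtain ⟨ν, a, U, rfl, rfl⟩ := hw.exists_eq_extend
    rw [extend_last] at hne
    rw [← extMap_vec, seminormalRep_incl_extMap, extMap_apply_of_node_last_ne a _ S hne]
  · rw [vec_of_not hw, map_zero, Finsupp.zero_apply]

theorem seminormalRep_lastT_vec : ∀ (n : ℕ) (μ : Fin m → YoungDiagram) (w : Fin (n + 1) → Node m),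
    seminormalRep n ξ μ (lastT m n) (vec μ w) = rootVal ξ (w (Fin.last n)).1 • vec μ w
  | 0, μ, w => by rw [lastT, seminormalRep_t, tOp_vec]; rfl
  | n + 1, μ, w => by
    by_cases hw : IsStandard μ w
    swap
    · rw [vec_of_not hw, map_zero, smul_zero]
    have hprev := seminormalRep_incl_vec_of_forall ξ (h := lastT m n)
      (f := fun w => rootVal ξ (w (Fin.last n)).1) (seminormalRep_lastT_vec n) μ
    have haxial : axial w (Fin.last n) * (rootVal ξ (w (Fin.last n).castSucc).1 -
        rootVal ξ (w (Fin.last n).succ).1) = 0 := by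
      by_cases h : (w (Fin.last n).castSucc).1 = (w (Fin.last n).succ).1
      · rw [h, sub_self, mul_zero]
      · rw [axial, axialCoeff, if_neg h, zero_mul]
    have hoffDiag := offDiag_mul hw (Fin.last n)
    rw [lastT, map_mul, map_mul, lastS, seminormalRep_s]
    simp only [Module.End.mul_apply, sOp_vec, hprev, map_add, map_smul, swapFilling_castSucc,
      swapFilling_swapFilling, axial_swap, ← Fin.succ_last]
    match_scalars
    · linear_combination rootVal ξ (w (Fin.last n).succ).1 * hoffDiag +
        axial w (Fin.last n) * haxial
    · linear_combination offDiag μ w (Fin.last n) * haxial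

theorem seminormalRep_incl_mul_lastT_zpow_apply_extend (U : StdTableau n μ) (a : AddNode μ)
    (h : G m n) (j : ℤ) :
    seminormalRep (n + 1) ξ (addNode μ a) (incl m n h * lastT m (n + 1) ^ j)
        (Finsupp.single (U.extend a) 1) (U.extend a) =
      rootVal ξ a.1 ^ j * seminormalRep n ξ μ h (Finsupp.single U 1) U := by
  have hT : seminormalRep (n + 1) ξ (addNode μ a) (lastT m (n + 1))
      (Finsupp.single (U.extend a) 1) = rootVal ξ a.1 • Finsupp.single (U.extend a) 1 := by
    rw [← vec_coe, seminormalRep_lastT_vec]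
    simp [StdTableau.extend, AddNode.node]
  rw [map_mul, Module.End.mul_apply, apply_zpow_of_apply_eq_smul _ (rootVal_ne_zero ξ _) hT,
    map_smul, ← extMap_single, seminormalRep_incl_extMap, Finsupp.smul_apply, extMap_apply_extend,
    smul_eq_mul]

theorem seminormalRep_incl_mul_lastS_apply_extend (U : StdTableau n μ) (a : AddNode μ)
    (h : G m n) :
    seminormalRep (n + 1) ξ (addNode μ a) (incl m n h * lastS m n)
        (Finsupp.single (U.extend a) 1) (U.extend a) =
      axialCoeff (U.node (Fin.last n)) a.node *
        seminormalRep n ξ μ h (Finsupp.single U 1) U := by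
  have hswap : (U.extend a).node (Fin.last (n + 1)) ≠
      swapFilling (U.extend a).node (Fin.last n) (Fin.last (n + 1)) := by
    rw [← Fin.succ_last, swapFilling_succ]
    exact (U.extend a).std.inj.ne (Fin.castSucc_lt_succ).ne'
  have haxial : axial (U.extend a).node (Fin.last n) =
      axialCoeff (U.node (Fin.last n)) a.node := by
    simp [axial, StdTableau.extend]
  rw [map_mul, Module.End.mul_apply, lastS, seminormalRep_s, ← vec_coe, sOp_vec, map_add,
    Finsupp.add_apply, map_smul, map_smul, Finsupp.smul_apply, Finsupp.smul_apply,
    seminormalRep_incl_vec_apply_eq_zero ξ h hswap, smul_zero, add_zero, haxial, vec_coe,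
    ← extMap_single, seminormalRep_incl_extMap, extMap_apply_extend, smul_eq_mul]

end Extension

section Plancherel

variable {m n : ℕ} (ξ : Fin m ≃ rootsOfUnity m ℂ)

/-- The sum of the characters of the semi-normal representations `V_μ`, each with the weight
`fCoeff μ`. By `plancherel_one` and `plancherel_of_ne_one` it is supported at `1`. -/
noncomputable def plancherel (n : ℕ) (g : G m n) : ℂ :=
  ∑ μ : Shape m n, fCoeff μ.1 * (seminormalRep n ξ μ.1).character g

theorem trace_eq_sum_apply {μ : Fin m → YoungDiagram} (f : V n μ →ₗ[ℂ] V n μ) :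
    LinearMap.trace ℂ (V n μ) f = ∑ T : StdTableau n μ, f (Finsupp.single T 1) T := by
  rw [LinearMap.trace_eq_matrix_trace ℂ Finsupp.basisSingleOne, Matrix.trace]
  refine sum_congr rfl fun T _ => ?_
  simp [LinearMap.toMatrix_apply]

theorem plancherel_eq_sum (g : G m n) :
    plancherel ξ n g = ∑ μ : Shape m n, ∑ T : StdTableau n μ.1,
      fCoeff μ.1 * seminormalRep n ξ μ.1 g (Finsupp.single T 1) T := by
  simp only [plancherel, Representation.character, trace_eq_sum_apply, mul_sum]

theorem plancherel_mul_comm (g h : G m n) : plancherel ξ n (g * h) = plancherel ξ n (h * g) := by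
  simp only [plancherel, Representation.char_mul_comm _ h g]

theorem plancherel_incl_mul_lastT_zpow (h : G m n) (j : ℤ) :
    plancherel ξ (n + 1) (incl m n h * lastT m (n + 1) ^ j) =
      (∑ k, rootVal ξ k ^ j) * plancherel ξ n h := by
  rw [plancherel_eq_sum, plancherel_eq_sum, sum_stdTableau_succ fun μ T => fCoeff μ *
    seminormalRep (n + 1) ξ μ (incl m n h * lastT m (n + 1) ^ j) (Finsupp.single T 1) T]
  simp only [mul_sum, seminormalRep_incl_mul_lastT_zpow_apply_extend, ← mul_assoc]
  refine sum_congr rfl fun μ _ => sum_congr rfl fun U _ => ?_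
  rw [← sum_mul, sum_fCoeff_addNode μ.1 fun k => rootVal ξ k ^ j, mul_comm (fCoeff μ.1)]

theorem plancherel_incl_mul_lastS (h : G m n) :
    plancherel ξ (n + 1) (incl m n h * lastS m n) = 0 := by
  rw [plancherel_eq_sum, sum_stdTableau_succ fun μ T => fCoeff μ *
    seminormalRep (n + 1) ξ μ (incl m n h * lastS m n) (Finsupp.single T 1) T]
  simp only [seminormalRep_incl_mul_lastS_apply_extend, ← mul_assoc]
  refine sum_eq_zero fun μ _ => sum_eq_zero fun U _ => ?_
  rw [← sum_mul, sum_fCoeff_addNode_mul_axialCoeff, zero_mul]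

theorem isStandard_addNode_bot (a : AddNode fun _ : Fin m => (⊥ : YoungDiagram)) :
    IsStandard (addNode _ a) fun _ : Fin (0 + 1) => a.node where
  inj := fun i j _ => Fin.ext (by lia)
  mem_range q := by
    rw [mem_addNode]
    simp [eq_comm]
  row _ _ _ _ h := absurd h (lt_irrefl _)
  col _ _ _ _ h := absurd h (lt_irrefl _)

/-- The standard tableau with a single node. -/
def StdTableau.single (a : AddNode fun _ : Fin m => (⊥ : YoungDiagram)) :
    StdTableau 0 (addNode _ a) :=
  ⟨_, isStandard_addNode_bot a⟩

theorem IsStandard.exists_eq_node {μ : Fin m → YoungDiagram} {w : Fin (0 + 1) → Node m}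
    (h : IsStandard μ w) :
    ∃ a : AddNode fun _ : Fin m => (⊥ : YoungDiagram), addNode _ a = μ ∧ w = fun _ => a.node := by
  obtain ⟨a, ha, hμ⟩ := exists_addNode h 0
  replace hμ := hμ.trans (partialShape_add_one_eq h)
  have hbot : partialShape h ((0 : Fin (0 + 1)) : ℕ) = fun _ => ⊥ := partialShape_zero h
  generalize partialShape h ((0 : Fin (0 + 1)) : ℕ) = ν at a ha hμ hbot
  subst hbot
  exact ⟨a, hμ, funext fun i => by rw [Fin.fin_one_eq_zero i, ha]⟩

theorem sum_stdTableau_zero {M : Type*} [AddCommMonoid M]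
    (F : ∀ μ : Fin m → YoungDiagram, StdTableau 0 μ → M) :
    ∑ μ : Shape m 0, ∑ T : StdTableau 0 μ.1, F μ.1 T = ∑ a, F _ (StdTableau.single a) := by
  rw [← Fintype.sum_sigma']
  let single (a : AddNode fun _ : Fin m => (⊥ : YoungDiagram)) :
      Σ μ : Shape m 0, StdTableau 0 μ.1 := ⟨⟨_, ⟨StdTableau.single a⟩⟩, StdTableau.single a⟩
  refine (Fintype.sum_bijective single ⟨fun a a' h => ?_, ?_⟩ _ _ fun _ => rfl).symm
  · exact AddNode.node_injective
      (congrArg (fun y : Σ μ : Shape m 0, StdTableau 0 μ.1 => y.2.node 0) h)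
  · rintro ⟨⟨μ, hμ⟩, T⟩
    obtain ⟨a, rfl, hT⟩ := T.std.exists_eq_node
    obtain rfl : StdTableau.single a = T := StdTableau.node_injective hT.symm
    exact ⟨a, rfl⟩

theorem plancherel_lastT_zero_zpow (j : ℤ) :
    plancherel ξ 0 (lastT m 0 ^ j) = ∑ k, rootVal ξ k ^ j := by
  have hsum := sum_fCoeff_addNode (fun _ : Fin m => (⊥ : YoungDiagram)) fun k => rootVal ξ k ^ j
  rw [show fCoeff (fun _ : Fin m => (⊥ : YoungDiagram)) = 1 by simp [fCoeff], one_mul] at hsum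
  rw [plancherel_eq_sum, sum_stdTableau_zero fun μ T => fCoeff μ *
    seminormalRep 0 ξ μ (lastT m 0 ^ j) (Finsupp.single T 1) T, ← hsum]
  refine sum_congr rfl fun a _ => ?_
  have hT : seminormalRep 0 ξ _ (lastT m 0) (Finsupp.single (StdTableau.single a) 1) =
      rootVal ξ a.1 • Finsupp.single (StdTableau.single a) 1 := by
    rw [← vec_coe, seminormalRep_lastT_vec]
    rfl
  rw [apply_zpow_of_apply_eq_smul _ (rootVal_ne_zero ξ _) hT, Finsupp.smul_apply,
    Finsupp.single_eq_same, smul_eq_mul, mul_one]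

theorem lastT_zpow_eq_one_of_dvd (n : ℕ) {j : ℤ} (h : (m : ℤ) ∣ j) : lastT m n ^ j = 1 := by
  obtain ⟨l, rfl⟩ := h
  rw [zpow_mul, zpow_natCast, lastT_pow_eq_one, one_zpow]

theorem plancherel_one : ∀ n : ℕ, plancherel ξ n (1 : G m n) = (m : ℂ) ^ (n + 1)
  | 0 => by simpa using plancherel_lastT_zero_zpow ξ 0
  | n + 1 => by
    have hstep := plancherel_incl_mul_lastT_zpow ξ (1 : G m n) 0
    rw [plancherel_one n, map_one, zpow_zero, one_mul] at hstep
    simpa [pow_succ'] using hstep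

theorem plancherel_of_ne_one : ∀ (n : ℕ) {g : G m n}, g ≠ 1 → plancherel ξ n g = 0
  | 0, g, hg => by
    obtain ⟨j, rfl⟩ := exists_eq_lastT_zero_zpow g
    rw [plancherel_lastT_zero_zpow, sum_rootVal_zpow, if_neg (mt (lastT_zpow_eq_one_of_dvd 0) hg)]
  | n + 1, g, hg => by
    rcases isSplit n g with ⟨h, j, rfl⟩ | ⟨h, h', rfl⟩
    · rw [plancherel_incl_mul_lastT_zpow, sum_rootVal_zpow]
      by_cases hj : (m : ℤ) ∣ j
      · rw [lastT_zpow_eq_one_of_dvd _ hj, mul_one] at hg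
        rw [plancherel_of_ne_one n fun h1 => hg (by rw [h1, map_one]), mul_zero]
      · rw [if_neg hj, zero_mul]
    · rw [plancherel_mul_comm, ← mul_assoc, ← map_mul, plancherel_incl_mul_lastS]

end Plancherel

/-! ### The group algebra in matrix form -/

section MatrixRep

variable {m n : ℕ} (ξ : Fin m ≃ rootsOfUnity m ℂ) (μ : Fin m → YoungDiagram)

/-- The semi-normal representation in matrix form. -/
noncomputable def matRep : G m n →* Matrix (StdTableau n μ) (StdTableau n μ) ℂ :=
  (LinearMap.toMatrixAlgEquiv (Finsupp.basisSingleOne (R := ℂ) (ι := StdTableau n μ)) :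
    (V n μ →ₗ[ℂ] V n μ) →* _).comp (seminormalRep n ξ μ)

theorem matRep_apply (g : G m n) (S T : StdTableau n μ) :
    matRep ξ μ g S T = seminormalRep n ξ μ g (Finsupp.single T 1) S := by
  simp [matRep, LinearMap.toMatrixAlgEquiv_apply]

variable (K : Type*) [Field K] [Algebra ℂ K]

/-- The action of the group algebra over a field extension of `ℂ` in matrix form. -/
noncomputable def matAlg :
    MonoidAlgebra K (G m n) →ₐ[K] Matrix (StdTableau n μ) (StdTableau n μ) K :=
  MonoidAlgebra.lift K _ (G m n)
    ((RingHom.mapMatrix (m := StdTableau n μ) (algebraMap ℂ K)).toMonoidHom.comp (matRep ξ μ))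

theorem matAlg_single (g : G m n) (c : K) :
    matAlg ξ μ K (MonoidAlgebra.single g c) = c • (matRep ξ μ g).map (algebraMap ℂ K) := by
  rw [matAlg, MonoidAlgebra.lift_single]
  rfl

variable {K} in
theorem matAlg_apply (a : MonoidAlgebra K (G m n)) (S T : StdTableau n μ) :
    matAlg ξ μ K a S T = a.coeff.sum fun g c => c * algebraMap ℂ K (matRep ξ μ g S T) := by
  rw [matAlg, MonoidAlgebra.lift_apply, Finsupp.sum, Matrix.sum_apply]
  rfl

theorem matAlg_mapRingHom (a : MonoidAlgebra ℂ (G m n)) :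
    matAlg ξ μ K (MonoidAlgebra.mapRingHom (G m n) (algebraMap ℂ K) a) =
      (matAlg ξ μ ℂ a).map (algebraMap ℂ K) := by
  induction a using MonoidAlgebra.induction_linear with
  | zero => simp
  | add x y hx hy => rw [map_add, map_add, hx, hy, map_add, Matrix.map_add _ (map_add _)]
  | single g c =>
    rw [MonoidAlgebra.mapRingHom_single, matAlg_single, matAlg_single]
    ext S T
    simp

theorem matAlg_apply_eq_asAlgebraHom (a : MonoidAlgebra ℂ (G m n)) (S T : StdTableau n μ) :
    matAlg ξ μ ℂ a S T = (seminormalRep n ξ μ).asAlgebraHom a (Finsupp.single T 1) S := by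
  induction a using MonoidAlgebra.induction_linear with
  | zero => simp
  | add x y hx hy => rw [map_add, map_add, Matrix.add_apply, hx, hy]; rfl
  | single g c =>
    rw [matAlg_single, Representation.asAlgebraHom_single]
    simp [matRep_apply]

theorem trace_matAlg_single (g : G m n) (c : K) :
    (matAlg ξ μ K (MonoidAlgebra.single g c)).trace =
      c * algebraMap ℂ K ((seminormalRep n ξ μ).character g) := by
  rw [matAlg_single, Matrix.trace_smul, smul_eq_mul, Representation.character, trace_eq_sum_apply,
    map_sum, Matrix.trace]
  simp only [Matrix.diag_apply, Matrix.map_apply, matRep_apply]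

-- Linearity in `a` reduces this to a group element, where the sum is the Plancherel trace.
theorem sum_fCoeff_mul_trace (a : MonoidAlgebra K (G m n)) (g : G m n) :
    ∑ μ : Shape m n, algebraMap ℂ K (fCoeff μ.1) *
      (matAlg ξ μ.1 K (MonoidAlgebra.single g⁻¹ 1 * a)).trace = (m : K) ^ (n + 1) * a.coeff g := by
  classical
  induction a using MonoidAlgebra.induction_linear with
  | zero => simp
  | add x y hx hy =>
    simp only [map_add, mul_add, Matrix.trace_add, sum_add_distrib, hx, hy,
      MonoidAlgebra.coeff_add, Finsupp.add_apply]
  | single h c =>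
    have hsum : ∑ μ : Shape m n, algebraMap ℂ K (fCoeff μ.1) *
        (matAlg ξ μ.1 K (MonoidAlgebra.single g⁻¹ 1 * MonoidAlgebra.single h c)).trace =
        c * algebraMap ℂ K (plancherel ξ n (g⁻¹ * h)) := by
      simp only [MonoidAlgebra.single_mul_single, one_mul, trace_matAlg_single, plancherel,
        map_sum, map_mul, mul_sum, mul_left_comm]
    rw [hsum, MonoidAlgebra.coeff_single, Finsupp.single_apply]
    by_cases hgh : h = g
    · rw [if_pos hgh, hgh, inv_mul_cancel, plancherel_one, map_pow, map_natCast, mul_comm]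
    · rw [if_neg hgh, plancherel_of_ne_one ξ n (mt (inv_mul_eq_one.1 ·|>.symm) hgh), map_zero,
        mul_zero, mul_zero]

variable {K}

theorem coeff_eq_sum_of_diagonal (a : MonoidAlgebra K (G m n))
    (z : ∀ μ : Fin m → YoungDiagram, StdTableau n μ → K)
    (ha : ∀ μ, matAlg ξ μ K a = Matrix.diagonal (z μ)) (g : G m n) :
    a.coeff g = ∑ μ : Shape m n, ∑ T : StdTableau n μ.1,
      algebraMap ℂ K (((m : ℂ) ^ (n + 1))⁻¹ * fCoeff μ.1 * matRep ξ μ.1 g⁻¹ T T) * z μ.1 T := by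
  have hm : (m : K) ^ (n + 1) ≠ 0 := by
    have := pow_ne_zero (n + 1) (Nat.cast_ne_zero (R := ℂ).2 (order_pos ξ).ne')
    simpa using (map_ne_zero (algebraMap ℂ K)).2 this
  rw [← mul_right_inj' hm, ← sum_fCoeff_mul_trace ξ K a g, mul_sum]
  refine sum_congr rfl fun μ _ => ?_
  rw [map_mul, ha, mul_sum, Matrix.trace, mul_sum]
  refine sum_congr rfl fun T _ => ?_
  rw [Matrix.diag_apply, Matrix.mul_diagonal, matAlg_single, one_smul, Matrix.map_apply]
  simp only [map_mul, map_inv₀, map_pow, map_natCast]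
  field_simp

theorem eq_of_forall_matAlg_eq {a b : MonoidAlgebra K (G m n)}
    (h : ∀ μ, matAlg ξ μ K a = matAlg ξ μ K b) : a = b := by
  rw [← sub_eq_zero]
  ext g
  rw [coeff_eq_sum_of_diagonal ξ (a - b) (fun _ _ => 0) fun μ => by rw [map_sub, h]; simp]
  simp

variable (K) {μ}

/-- The coordinate vector of an element of `V_μ`, over a field extension of `ℂ`. -/
noncomputable def castVec : V n μ →ₗ[ℂ] (StdTableau n μ → K) :=
  (Algebra.linearMap ℂ K).compLeft _ ∘ₗ Finsupp.lcoeFun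

theorem castVec_single (T : StdTableau n μ) :
    castVec K (Finsupp.single T 1 : V n μ) = Pi.single T 1 := by
  funext S
  by_cases h : S = T
  · subst h; simp [castVec]
  · simp [castVec, h]

theorem matAlg_single_mulVec (g : G m n) (x : V n μ) :
    matAlg ξ μ K (MonoidAlgebra.single g 1) *ᵥ castVec K x =
      castVec K (seminormalRep n ξ μ g x) := by
  have hlin : (matAlg ξ μ K (MonoidAlgebra.single g 1)).mulVecLin.restrictScalars ℂ ∘ₗ castVec K =
      castVec K ∘ₗ seminormalRep n ξ μ g := by
    refine Finsupp.lhom_ext' fun T => LinearMap.ext_ring (funext fun S => ?_)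
    rw [LinearMap.comp_apply, LinearMap.comp_apply, LinearMap.comp_apply, LinearMap.comp_apply,
      Finsupp.lsingle_apply, castVec_single, LinearMap.restrictScalars_apply,
      Matrix.mulVecLin_apply, Matrix.mulVec_single_one, matAlg_single, one_smul]
    simp [castVec, matRep_apply]
  exact LinearMap.congr_fun hlin x

end MatrixRep

/-! ### The action of `φ_{k+1}` -/

section PhiAction

variable {m n : ℕ} (ξ : Fin m ≃ rootsOfUnity m ℂ) {μ : Fin m → YoungDiagram}
  {K : Type*} [Field K]

theorem IsStandard.content_zero {w : Fin (n + 1) → Node m} (h : IsStandard μ w) :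
    content (w 0) = 0 := by
  obtain ⟨i, hi⟩ := (h.mem_range ((w 0).1, (0, 0))).2
    ((μ (w 0).1).up_left_mem (Nat.zero_le _) (Nat.zero_le _) (h.mem 0))
  have hle : i ≤ 0 := h.mono (by simp [hi]) (by simp [hi]) (by simp [hi])
  rw [Fin.le_zero_iff.1 hle] at hi
  rw [hi, content]
  simp

theorem sum_rootVal_pow_mul_pow (k l : Fin m) :
    ∑ j ∈ range m, (1 / (m : ℂ)) * rootVal ξ k ^ (m - j) * rootVal ξ l ^ j =
      if l = k then 1 else 0 := by
  have hm : (m : ℂ) ≠ 0 := Nat.cast_ne_zero.2 (order_pos ξ).ne'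
  have hterm : ∀ j ∈ range m, (1 / (m : ℂ)) * rootVal ξ k ^ (m - j) * rootVal ξ l ^ j =
      1 / m * (rootVal ξ l / rootVal ξ k) ^ j := by
    intro j hj
    rw [pow_sub₀ _ (rootVal_ne_zero ξ k) (mem_range.1 hj).le, rootVal_pow, div_pow]
    ring
  rw [sum_congr rfl hterm, ← mul_sum]
  split_ifs with h
  · simp [h, hm]
  · have hne : rootVal ξ l / rootVal ξ k ≠ 1 := fun e =>
      h (rootVal_injective ξ (eq_of_div_eq_one e))
    rw [geom_sum_eq hne, div_pow, rootVal_pow, rootVal_pow]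
    simp

/-- The Kronecker symbol `δ_{κ, p}` divided by `u - c`, where `p` and `c` are the position and the
content of the node `q`: the scalar term of `s_k(v, v_k, u, u_k)` when `v`, `v_k`, `u_k` are
specialised to the root with the index `κ` and to the position and the content of `q`. -/
noncomputable def poleFactor (u : K) (κ : Fin m) (q : Node m) : K :=
  if q.1 = κ then (u - content q)⁻¹ else 0

/-- The eigenvalue of `φ_{k+1}`, taken at the root with the index `κ` and at `u`, on the vector of
the semi-normal basis attached to `w`. -/
noncomputable def phiScalar (u : K) (κ : Fin m) (w : Fin (n + 1) → Node m) (k : Fin (n + 1)) : K :=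
  u * poleFactor u κ (w k) * ∏ i ∈ Iio k, (1 - poleFactor u κ (w i) ^ 2)

theorem phiScalar_zero {u : K} (hu : u ≠ 0) (κ : Fin m) {w : Fin (n + 1) → Node m}
    (hw : IsStandard μ w) : phiScalar u κ w 0 = if (w 0).1 = κ then 1 else 0 := by
  rw [phiScalar, poleFactor, hw.content_zero, ← bot_eq_zero, Iio_bot]
  simp [hu]

theorem phiScalar_succ (u : K) (κ : Fin m) (w : Fin (n + 1) → Node m) (i : Fin n) :
    phiScalar u κ w i.succ = u * poleFactor u κ (w i.succ) *
      ((1 - poleFactor u κ (w i.castSucc) ^ 2) *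
        ∏ j ∈ Iio i.castSucc, (1 - poleFactor u κ (w j) ^ 2)) := by
  have hIio : Iio i.succ = insert i.castSucc (Iio i.castSucc) := by
    ext j
    simp only [mem_Iio, mem_insert, Fin.lt_def, Fin.ext_iff, Fin.val_succ, Fin.val_castSucc]
    omega
  rw [phiScalar, hIio, prod_insert (by simp)]

theorem phiScalar_swapFilling (u : K) (κ : Fin m) (w : Fin (n + 1) → Node m) (i : Fin n) :
    phiScalar u κ (swapFilling w i) i.castSucc = u * poleFactor u κ (w i.succ) *
      ∏ j ∈ Iio i.castSucc, (1 - poleFactor u κ (w j) ^ 2) := by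
  rw [phiScalar, swapFilling_castSucc]
  congr 1
  refine prod_congr rfl fun j hj => ?_
  have hj : j < i.castSucc := mem_Iio.1 hj
  rw [swapFilling_of_ne w i hj.ne (hj.trans Fin.castSucc_lt_succ).ne]

variable [Algebra ℂ K]

-- Both matrix coefficients in the induction step of `matAlg_phi_mulVec` reduce to this identity.
theorem axialCoeff_mul_poleFactor {u : K} (hu : ∀ z : ℤ, u - z ≠ 0) (κ : Fin m) {q r : Node m}
    (hqr : q.1 = r.1 → content r - content q ≠ 0) :
    algebraMap ℂ K (axialCoeff q r) * (poleFactor u κ q - poleFactor u κ r) +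
      poleFactor u κ q * poleFactor u κ r = 0 := by
  by_cases hpos : q.1 = r.1
  · have hcast : (content r : K) - content q ≠ 0 := by
      have : ((content r - content q : ℤ) : ℂ) ≠ 0 := Int.cast_ne_zero.2 (hqr hpos)
      simpa using (map_ne_zero (algebraMap ℂ K)).2 this
    have hq := hu (content q)
    have hr := hu (content r)
    simp only [axialCoeff, poleFactor, hpos, if_true]
    split_ifs
    · push_cast [map_inv₀, map_sub, map_intCast]
      field_simp
      ring
    · ring
  · have hprod : poleFactor u κ q * poleFactor u κ r = 0 := by
      by_cases hq : q.1 = κ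
      · simp [poleFactor, show r.1 ≠ κ from fun h => hpos (hq.trans h.symm)]
      · simp [poleFactor, hq]
    simp [axialCoeff, hpos, hprod]

theorem matAlg_gs_mulVec (w : Fin (n + 1) → Node m) (i : Fin n) :
    matAlg ξ μ K (MonoidAlgebra.single (gs m i) 1) *ᵥ castVec K (vec μ w) =
      algebraMap ℂ K (axial w i) • castVec K (vec μ w) +
        algebraMap ℂ K (offDiag μ w i) • castVec K (vec μ (swapFilling w i)) := by
  rw [matAlg_single_mulVec, seminormalRep_s, sOp_vec, map_add, map_smul, map_smul,
    algebraMap_smul, algebraMap_smul]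

theorem matAlg_bs_mulVec (u : K) (κ : Fin m) (q : Node m) (i : Fin n) (x : StdTableau n μ → K) :
    matAlg ξ μ K (bs m i (rootVal ξ κ) (rootVal ξ q.1) u (content q)) *ᵥ x =
      matAlg ξ μ K (MonoidAlgebra.single (gs m i) 1) *ᵥ x + poleFactor u κ q • x := by
  have hscalar (c : K) : matAlg ξ μ K (MonoidAlgebra.single 1 c) *ᵥ x = c • x := by
    rw [show MonoidAlgebra.single (1 : G m n) c = algebraMap K _ c from rfl, AlgHom.commutes,
      Algebra.algebraMap_eq_smul_one, Matrix.smul_mulVec, Matrix.one_mulVec]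
  rw [bs, map_add, Matrix.add_mulVec, hscalar, poleFactor, one_div]
  simp only [(rootVal_injective ξ).eq_iff, eq_comm]

theorem matAlg_bt_mulVec (w : Fin (n + 1) → Node m) (κ : Fin m) :
    matAlg ξ μ K (bt m K n (rootVal ξ κ)) *ᵥ castVec K (vec μ w) =
      (if (w 0).1 = κ then (1 : K) else 0) • castVec K (vec μ w) := by
  have ht : seminormalRep n ξ μ (gt m n) (vec μ w) = rootVal ξ (w 0).1 • vec μ w := by
    rw [seminormalRep_t, tOp_vec]
  have hterm (j : ℕ) (c : ℂ) :
      matAlg ξ μ K (MonoidAlgebra.single (gt m n ^ j) (algebraMap ℂ K c)) *ᵥ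
        castVec K (vec μ w) =
      (c * rootVal ξ (w 0).1 ^ j) • castVec K (vec μ w) := by
    have hpow := apply_zpow_of_apply_eq_smul _ (rootVal_ne_zero ξ _) ht j
    rw [zpow_natCast, zpow_natCast] at hpow
    rw [show MonoidAlgebra.single (gt m n ^ j) (algebraMap ℂ K c) =
        algebraMap ℂ K c • MonoidAlgebra.single (gt m n ^ j) (1 : K) by
        rw [MonoidAlgebra.smul_single', mul_one],
      map_smul, Matrix.smul_mulVec, matAlg_single_mulVec, hpow, map_smul, algebraMap_smul,
      smul_smul]
  rw [bt, map_sum, Matrix.sum_mulVec, sum_congr rfl fun j _ => hterm j _, ← sum_smul,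
    sum_rootVal_pow_mul_pow]
  split_ifs <;> simp

theorem phi_succ (vs : Fin (n + 1) → ℂ) (us : Fin (n + 1) → K) (v : ℂ) (u : K) (i : Fin n) :
    phi m vs us v u i.succ = bs m i v (vs i.castSucc) u (us i.castSucc) *
      phi m vs us v u i.castSucc * MonoidAlgebra.single (gs m i) 1 := by
  rw [phi, Fin.induction_succ]
  rfl

theorem matAlg_phi_mulVec {vs : Fin (n + 1) → ℂ} {us : Fin (n + 1) → K} {u : K}
    (hu : ∀ z : ℤ, u - z ≠ 0) (κ : Fin m) (k : Fin (n + 1)) :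
    ∀ w : Fin (n + 1) → Node m,
      (∀ i, i < k → vs i = rootVal ξ (w i).1 ∧ us i = content (w i)) →
      matAlg ξ μ K (phi m vs us (rootVal ξ κ) u k) *ᵥ castVec K (vec μ w) =
        phiScalar u κ w k • castVec K (vec μ w) := by
  induction k using Fin.induction with
  | zero =>
    intro w _
    by_cases hw : IsStandard μ w
    · rw [phiScalar_zero (by simpa using hu 0) κ hw]
      exact matAlg_bt_mulVec ξ w κ
    · simp [vec_of_not hw]
  | succ i ih =>
    intro w hparams
    by_cases hw : IsStandard μ w
    swap
    · simp [vec_of_not hw]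
    have hlt : i.castSucc < i.succ := Fin.castSucc_lt_succ
    have hphi := ih w fun j hj => hparams j (hj.trans hlt)
    have hphi_swap := ih (swapFilling w i) fun j hj => by
      rw [swapFilling_of_ne w i hj.ne (hj.trans hlt).ne]
      exact hparams j (hj.trans hlt)
    obtain ⟨hv, hc⟩ := hparams i.castSucc hlt
    have hoff : algebraMap ℂ K (offDiag μ w i) * algebraMap ℂ K (offDiag μ (swapFilling w i) i) =
        1 - algebraMap ℂ K (axial w i) ^ 2 := by
      rw [← map_mul, offDiag_mul hw, map_sub, map_one, map_pow]
    have hpole : algebraMap ℂ K (axial w i) * (_ - _) + _ = 0 :=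
      axialCoeff_mul_poleFactor hu κ (hw.content_ne hlt (by simp))
    rw [phi_succ, hv, hc, map_mul, map_mul, ← Matrix.mulVec_mulVec, ← Matrix.mulVec_mulVec]
    simp only [matAlg_gs_mulVec, matAlg_bs_mulVec, Matrix.mulVec_add, Matrix.mulVec_smul, hphi,
      hphi_swap, swapFilling_swapFilling, axial_swap, map_neg, phiScalar_succ,
      phiScalar_swapFilling]
    rw [phiScalar]
    generalize ∏ j ∈ Iio i.castSucc, (1 - poleFactor u κ (w j) ^ 2) = P
    match_scalars
    · linear_combination u * poleFactor u κ (w i.succ) * P * hoff +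
        u * P * (algebraMap ℂ K (axial w i) + poleFactor u κ (w i.castSucc)) * hpole
    · linear_combination u * P * algebraMap ℂ K (offDiag μ w i) * hpole

end PhiAction

/-! ### Evaluation of rational functions -/

section Evaluation

variable {N : ℕ} {i : Fin N} {c : ℂ} {r r' s s' : RatField N}

theorem algebraMap_ratField_injective (N : ℕ) :
    Function.Injective (algebraMap (MvPolynomial (Fin N) ℂ) (RatField N)) :=
  IsFractionRing.injective _ _

theorem algebraMap_ne_zero_of_substVar_ne_zero {b : MvPolynomial (Fin N) ℂ}
    (hb : substVar i c b ≠ 0) : algebraMap _ (RatField N) b ≠ 0 ∧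
      algebraMap _ (RatField N) (substVar i c b) ≠ 0 := by
  simp only [ne_eq, map_eq_zero_iff _ (algebraMap_ratField_injective N)]
  exact ⟨fun h => hb (by rw [h, map_zero]), hb⟩

theorem EvaluatesTo.add (h : EvaluatesTo i c r r') (h' : EvaluatesTo i c s s') :
    EvaluatesTo i c (r + s) (r' + s') := by
  obtain ⟨a, b, hb, rfl, rfl⟩ := h
  obtain ⟨a', b', hb', rfl, rfl⟩ := h'
  obtain ⟨hb₁, hb₂⟩ := algebraMap_ne_zero_of_substVar_ne_zero hb
  obtain ⟨hb₁', hb₂'⟩ := algebraMap_ne_zero_of_substVar_ne_zero hb'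
  refine ⟨a * b' + b * a', b * b', by rw [map_mul]; exact mul_ne_zero hb hb', ?_, ?_⟩
  · rw [div_add_div _ _ hb₁ hb₁', map_add, map_mul, map_mul, map_mul]
  · simp only [div_add_div _ _ hb₂ hb₂', map_add, map_mul]

theorem EvaluatesTo.mul (h : EvaluatesTo i c r r') (h' : EvaluatesTo i c s s') :
    EvaluatesTo i c (r * s) (r' * s') := by
  obtain ⟨a, b, hb, rfl, rfl⟩ := h
  obtain ⟨a', b', hb', rfl, rfl⟩ := h'
  refine ⟨a * a', b * b', by rw [map_mul]; exact mul_ne_zero hb hb', ?_, ?_⟩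
  · rw [map_mul, map_mul, div_mul_div_comm]
  · simp only [map_mul, div_mul_div_comm]

theorem EvaluatesTo.inv (h : EvaluatesTo i c r r') (hr : r' ≠ 0) : EvaluatesTo i c r⁻¹ r'⁻¹ := by
  obtain ⟨a, b, _, rfl, rfl⟩ := h
  refine ⟨b, a, fun ha => hr ?_, inv_div _ _, inv_div _ _⟩
  rw [ha, map_zero, zero_div]

theorem EvaluatesTo.unique (h : EvaluatesTo i c r r') (h' : EvaluatesTo i c r s') : r' = s' := by
  obtain ⟨a, b, hb, rfl, rfl⟩ := h
  obtain ⟨a', b', hb', heq, rfl⟩ := h'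
  obtain ⟨hb₁, hb₂⟩ := algebraMap_ne_zero_of_substVar_ne_zero hb
  obtain ⟨hb₁', hb₂'⟩ := algebraMap_ne_zero_of_substVar_ne_zero hb'
  rw [div_eq_div_iff hb₁ hb₁', ← map_mul, ← map_mul] at heq
  rw [div_eq_div_iff hb₂ hb₂', ← map_mul, ← map_mul, ← map_mul, ← map_mul,
    algebraMap_ratField_injective N heq]

theorem EvaluatesTo.polynomial (p : MvPolynomial (Fin N) ℂ) :
    EvaluatesTo i c (algebraMap _ (RatField N) p) (algebraMap _ (RatField N) (substVar i c p)) :=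
  ⟨p, 1, by simp, by simp, by simp⟩

theorem EvaluatesTo.const (i : Fin N) (c z : ℂ) :
    EvaluatesTo i c (algebraMap ℂ (RatField N) z) (algebraMap ℂ (RatField N) z) := by
  have h := EvaluatesTo.polynomial (i := i) (c := c) (algebraMap ℂ _ z)
  rwa [AlgHom.commutes, ← IsScalarTower.algebraMap_apply] at h

theorem EvaluatesTo.uVar_self (i : Fin N) (c : ℂ) :
    EvaluatesTo i c (uVar i) (algebraMap ℂ (RatField N) c) := by
  have h := EvaluatesTo.polynomial (i := i) (c := c) (MvPolynomial.X i)
  rwa [substVar, MvPolynomial.aeval_X, Function.update_self, ← MvPolynomial.algebraMap_eq,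
    ← IsScalarTower.algebraMap_apply] at h

theorem EvaluatesTo.uVar_of_ne {i j : Fin N} (h : j ≠ i) (c : ℂ) :
    EvaluatesTo i c (uVar j) (uVar j) := by
  simpa [substVar, uVar, h] using EvaluatesTo.polynomial (i := i) (c := c) (MvPolynomial.X j)

/-- The pairs of a rational function and its evaluation, as a subalgebra: this gives the
compatibility of evaluations with differences, finite sums and finite products. -/
def evaluationSubalgebra (i : Fin N) (c : ℂ) : Subalgebra ℂ (RatField N × RatField N) where
  carrier := {p | EvaluatesTo i c p.1 p.2}
  add_mem' := EvaluatesTo.add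
  mul_mem' := EvaluatesTo.mul
  algebraMap_mem' := EvaluatesTo.const i c

theorem EvaluatesTo.zero (i : Fin N) (c : ℂ) : EvaluatesTo i c 0 0 :=
  (evaluationSubalgebra i c).zero_mem

theorem EvaluatesTo.one (i : Fin N) (c : ℂ) : EvaluatesTo i c 1 1 :=
  (evaluationSubalgebra i c).one_mem

theorem EvaluatesTo.sub (h : EvaluatesTo i c r r') (h' : EvaluatesTo i c s s') :
    EvaluatesTo i c (r - s) (r' - s') :=
  (evaluationSubalgebra i c).sub_mem (x := (r, r')) (y := (s, s')) h h'

theorem EvaluatesTo.div (h : EvaluatesTo i c r r') (h' : EvaluatesTo i c s s') (hs : s' ≠ 0) :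
    EvaluatesTo i c (r / s) (r' / s') := by
  rw [div_eq_mul_inv, div_eq_mul_inv]
  exact h.mul (h'.inv hs)

theorem EvaluatesTo.sum {ι : Type*} (t : Finset ι) {f f' : ι → RatField N}
    (h : ∀ j ∈ t, EvaluatesTo i c (f j) (f' j)) :
    EvaluatesTo i c (∑ j ∈ t, f j) (∑ j ∈ t, f' j) := by
  have hmem := (evaluationSubalgebra i c).sum_mem (f := fun j => (f j, f' j)) h
  rwa [← prod_mk_sum] at hmem

theorem EvaluatesTo.prod {ι : Type*} (t : Finset ι) {f f' : ι → RatField N}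
    (h : ∀ j ∈ t, EvaluatesTo i c (f j) (f' j)) :
    EvaluatesTo i c (∏ j ∈ t, f j) (∏ j ∈ t, f' j) := by
  have hmem := (evaluationSubalgebra i c).prod_mem (f := fun j => (f j, f' j)) h
  rwa [← prod_mk_prod] at hmem

theorem uVar_sub_algebraMap_ne_zero (j : Fin N) (z : ℂ) :
    uVar j - algebraMap ℂ (RatField N) z ≠ 0 := by
  intro h
  have heq : (MvPolynomial.X j : MvPolynomial (Fin N) ℂ) = MvPolynomial.C z :=
    algebraMap_ratField_injective N (sub_eq_zero.1 h)
  simpa using congrArg (MvPolynomial.eval fun _ => z + 1) heq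

theorem uVar_sub_intCast_ne_zero (j : Fin N) (z : ℤ) : (uVar j : RatField N) - z ≠ 0 := by
  simpa using uVar_sub_algebraMap_ne_zero j z

theorem uVar_injective : Function.Injective (uVar (N := N)) :=
  (algebraMap_ratField_injective N).comp (MvPolynomial.X_injective)

/-- Evaluation of all coefficients of an element of a group algebra. -/
def AlgEvaluatesTo {Γ : Type*} (i : Fin N) (c : ℂ) (A A' : MonoidAlgebra (RatField N) Γ) : Prop :=
  ∀ g, EvaluatesTo i c (A.coeff g) (A'.coeff g)

variable {Γ : Type*} {A A' B B' : MonoidAlgebra (RatField N) Γ}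

theorem AlgEvaluatesTo.add (h : AlgEvaluatesTo i c A A') (h' : AlgEvaluatesTo i c B B') :
    AlgEvaluatesTo i c (A + B) (A' + B') := fun g => (h g).add (h' g)

theorem AlgEvaluatesTo.sum_coeff (h : AlgEvaluatesTo i c A A')
    {f f' : Γ → RatField N → RatField N} (hf : ∀ g, f g 0 = 0) (hf' : ∀ g, f' g 0 = 0)
    (hff' : ∀ g r r', EvaluatesTo i c r r' → EvaluatesTo i c (f g r) (f' g r')) :
    EvaluatesTo i c (A.coeff.sum f) (A'.coeff.sum f') := by
  classical
  rw [Finsupp.sum_of_support_subset _ subset_union_left _ fun g _ => hf g,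
    Finsupp.sum_of_support_subset _ subset_union_right _ fun g _ => hf' g]
  exact EvaluatesTo.sum _ fun g _ => hff' g _ _ (h g)

theorem AlgEvaluatesTo.mul [Mul Γ] (h : AlgEvaluatesTo i c A A') (h' : AlgEvaluatesTo i c B B') :
    AlgEvaluatesTo i c (A * B) (A' * B') := by
  classical
  intro g
  rw [MonoidAlgebra.coeff_mul, MonoidAlgebra.coeff_mul]
  refine h.sum_coeff (by simp) (by simp) fun g₁ r r' hr => ?_
  refine h'.sum_coeff (by simp) (by simp) fun g₂ s s' hs => ?_
  split_ifs
  · exact hr.mul hs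
  · exact EvaluatesTo.zero i c

theorem AlgEvaluatesTo.single (g : Γ) (h : EvaluatesTo i c r r') :
    AlgEvaluatesTo i c (MonoidAlgebra.single g r) (MonoidAlgebra.single g r') := by
  classical
  intro k
  rw [MonoidAlgebra.coeff_single, MonoidAlgebra.coeff_single, Finsupp.single_apply,
    Finsupp.single_apply]
  split_ifs
  · exact h
  · exact EvaluatesTo.zero i c

theorem AlgEvaluatesTo.sum {ι : Type*} (t : Finset ι)
    {f f' : ι → MonoidAlgebra (RatField N) Γ} (h : ∀ j ∈ t, AlgEvaluatesTo i c (f j) (f' j)) :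
    AlgEvaluatesTo i c (∑ j ∈ t, f j) (∑ j ∈ t, f' j) := by
  intro g
  simp only [MonoidAlgebra.coeff_sum, Finsupp.finsetSum_apply]
  exact EvaluatesTo.sum t fun j hj => h j hj g

theorem AlgEvaluatesTo.list_prod [Monoid Γ] {ι : Type*} (l : List ι)
    {f f' : ι → MonoidAlgebra (RatField N) Γ} (h : ∀ j ∈ l, AlgEvaluatesTo i c (f j) (f' j)) :
    AlgEvaluatesTo i c (l.map f).prod (l.map f').prod := by
  induction l with
  | nil => exact AlgEvaluatesTo.single 1 (EvaluatesTo.one i c)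
  | cons a l ih =>
    rw [List.map_cons, List.map_cons, List.prod_cons, List.prod_cons]
    exact (h a List.mem_cons_self).mul (ih fun j hj => h j (List.mem_cons_of_mem _ hj))

end Evaluation

section GroupAlgebraEvaluation

variable {m n N : ℕ} {i : Fin N} {c : ℂ}

theorem AlgEvaluatesTo.phi {vs : Fin (n + 1) → ℂ} {us us' : Fin (n + 1) → RatField N}
    {u u' : RatField N} (v : ℂ) (k : Fin (n + 1)) (hu : EvaluatesTo i c u u')
    (hus : ∀ j, EvaluatesTo i c (us j) (us' j)) (hne : ∀ j, j < k → u' - us' j ≠ 0) :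
    AlgEvaluatesTo i c (phi m vs us v u k) (phi m vs us' v u' k) := by
  have hone (g : G m n) :
      AlgEvaluatesTo i c (MonoidAlgebra.single g 1) (MonoidAlgebra.single g 1) :=
    .single g (.one i c)
  induction k using Fin.induction with
  | zero =>
    exact AlgEvaluatesTo.sum (range m) fun j _ =>
      .single (gt m n ^ j) (.const i c ((1 / (m : ℂ)) * v ^ (m - j)))
  | succ l ih =>
    have hlt : l.castSucc < l.succ := Fin.castSucc_lt_succ
    rw [phi_succ, phi_succ]
    refine ((((hone _).add (.single _ ?_)).mul (ih fun j hj => hne j (hj.trans hlt)))).mul (hone _)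
    split_ifs
    · exact (EvaluatesTo.one i c).div (hu.sub (hus _)) (hne _ hlt)
    · exact .zero i c

variable (ξ : Fin m ≃ rootsOfUnity m ℂ)

theorem AlgEvaluatesTo.matAlg_apply {a a' : MonoidAlgebra (RatField N) (G m n)}
    (h : AlgEvaluatesTo i c a a') (μ : Fin m → YoungDiagram) (S T : StdTableau n μ) :
    EvaluatesTo i c (matAlg ξ μ _ a S T) (matAlg ξ μ _ a' S T) := by
  rw [CyclotomicFusion.matAlg_apply, CyclotomicFusion.matAlg_apply]
  exact h.sum_coeff (by simp) (by simp) fun g r r' hr => hr.mul (.const i c _)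

-- The coefficients are `ℂ`-linear in the eigenvalues, so they evaluate when the eigenvalues do.
theorem exists_evaluatesTo_of_diagonal {a : MonoidAlgebra (RatField N) (G m n)}
    {z : ∀ μ : Fin m → YoungDiagram, StdTableau n μ → RatField N}
    {z' : ∀ μ : Fin m → YoungDiagram, StdTableau n μ → ℂ}
    (ha : ∀ μ, matAlg ξ μ _ a = Matrix.diagonal (z μ))
    (hz : ∀ μ T, EvaluatesTo i c (z μ T) (algebraMap ℂ _ (z' μ T))) :
    ∃ y : MonoidAlgebra ℂ (G m n), (∀ μ, matAlg ξ μ ℂ y = Matrix.diagonal (z' μ)) ∧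
      AlgEvaluatesTo i c a (MonoidAlgebra.mapRingHom _ (algebraMap ℂ (RatField N)) y) := by
  let coeff (g : G m n) : ℂ := ∑ μ : Shape m n, ∑ T : StdTableau n μ.1,
    ((m : ℂ) ^ (n + 1))⁻¹ * fCoeff μ.1 * matRep ξ μ.1 g⁻¹ T T * z' μ.1 T
  have hcoeff (g : G m n) : EvaluatesTo i c (a.coeff g) (algebraMap ℂ _ (coeff g)) := by
    rw [coeff_eq_sum_of_diagonal ξ a z ha g]
    simp only [coeff, map_sum]
    refine EvaluatesTo.sum _ fun μ _ => EvaluatesTo.sum _ fun T _ => ?_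
    rw [map_mul _ _ (z' μ.1 T)]
    exact (EvaluatesTo.const i c _).mul (hz μ.1 T)
  have hsupport (g : G m n) (hg : coeff g ≠ 0) : g ∈ a.coeff.support := by
    refine Finsupp.mem_support_iff.2 fun h => hg ((algebraMap ℂ (RatField N)).injective ?_)
    rw [map_zero]
    exact (h ▸ hcoeff g).unique (EvaluatesTo.zero i c)
  let y : MonoidAlgebra ℂ (G m n) := .ofCoeff (Finsupp.onFinset _ coeff hsupport)
  have hy : AlgEvaluatesTo i c a (MonoidAlgebra.mapRingHom _ (algebraMap ℂ (RatField N)) y) :=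
    fun g => by rw [MonoidAlgebra.coeff_mapRingHom]; exact hcoeff g
  refine ⟨y, fun μ => Matrix.ext fun S T => (algebraMap ℂ (RatField N)).injective ?_, hy⟩
  have hentry := hy.matAlg_apply ξ μ S T
  rw [matAlg_mapRingHom, Matrix.map_apply, ha] at hentry
  refine hentry.unique ?_
  by_cases hST : S = T
  · subst hST
    rw [Matrix.diagonal_apply_eq, Matrix.diagonal_apply_eq]
    exact hz μ S
  · rw [Matrix.diagonal_apply_ne _ hST, Matrix.diagonal_apply_ne _ hST, map_zero]
    exact EvaluatesTo.zero i c

end GroupAlgebraEvaluation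

/-! ### The eigenvalues of `φ_{k+1}` at the contents -/

section AddRatio

variable {K : Type*} [Field K] {m : ℕ}

/-- The ratio through which the eigenvalues of the elements `φ_{k+1}` depend on the spectral
parameter `u`: `ν` is the part of the diagram filled before, and the next node is added in row `x`.
At the content of that node the ratio is the inverse of `residue`. -/
def addRatio (ν : YoungDiagram) (x : ℕ) (u : K) : K :=
  (∏ i ∈ (range (ν.colLen 0 + 1 + 1)).erase x, (u - rowContent ν i)) /
    ∏ i ∈ range (ν.colLen 0 + 1), (u + 1 - rowContent ν i)

theorem addRatio_rowContent_self [CharZero K] {ν : YoungDiagram} (x : AddRow ν) :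
    addRatio ν x.1 (rowContent ν x.1 : K) = hookProd (addCell ν x) / hookProd ν := by
  have hratio := hookProd_eq_mul_residue (F := K) x (Nat.lt_succ_self (ν.colLen 0))
  have hinv : addRatio ν x.1 (rowContent ν x.1 : K) = (residue K ν (ν.colLen 0 + 1) x.1)⁻¹ :=
    (inv_div _ _).symm
  have hν : (hookProd ν : K) ≠ 0 := Nat.cast_ne_zero.2 (hookProd_pos ν).ne'
  have hres := right_ne_zero_of_mul (hratio ▸ hν)
  rw [hinv, eq_div_iff hν, hratio]
  field_simp

theorem addRatio_rowContent_of_ne {ν : YoungDiagram} (x : AddRow ν) {x' : ℕ} (h : x.1 ≠ x') :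
    addRatio ν x' (rowContent ν x.1 : K) = 0 := by
  have hx : x.1 ∈ (range (ν.colLen 0 + 1 + 1)).erase x' :=
    mem_erase.2 ⟨h, mem_range.2 (by have := x.2.le_colLen; omega)⟩
  rw [addRatio, prod_eq_zero hx (sub_self _), zero_div]

theorem addRatio_addNode {ν : Fin m → YoungDiagram} (a a' : AddNode ν) (h : a'.1 = a.1) :
    addRatio (ν a'.1) a'.2.1 (rowContent (ν a.1) a.2.1 : ℂ) =
      if a' = a then fCoeff ν / fCoeff (addNode ν a) else 0 := by
  obtain ⟨κ, x⟩ := a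
  obtain ⟨κ', x'⟩ := a'
  obtain rfl : κ' = κ := h
  by_cases hx : x' = x
  · have := fCoeff_ne_zero ν
    have := cast_hookProd_ne_zero (ν κ')
    have := cast_hookProd_ne_zero (addCell (ν κ') x)
    rw [if_pos (by rw [hx]), hx, addRatio_rowContent_self, fCoeff_addNode]
    field_simp
  · rw [if_neg (by simpa using hx), addRatio_rowContent_of_ne]
    exact fun hxx => hx (Subtype.ext hxx.symm)

theorem addRatio_evaluatesTo {N : ℕ} (k : Fin N) {ν : YoungDiagram} (x : AddRow ν) (x' : ℕ) :
    EvaluatesTo k (rowContent ν x.1) (addRatio ν x' (uVar k))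
      (algebraMap ℂ _ (addRatio ν x' (rowContent ν x.1 : ℂ))) := by
  have hu := EvaluatesTo.uVar_self k (rowContent ν x.1 : ℂ)
  have hcontent (i : ℕ) :
      EvaluatesTo k (rowContent ν x.1) (rowContent ν i : RatField N) (rowContent ν i) := by
    simpa using EvaluatesTo.const k _ (rowContent ν i : ℂ)
  have hden (i : ℕ) : (rowContent ν x.1 : ℂ) + 1 - rowContent ν i ≠ 0 := by
    exact_mod_cast sub_ne_zero.2 (x.2.rowContent_add_one_ne i)
  simp only [addRatio, map_div₀, map_prod, map_sub, map_add, map_one, map_intCast] at hu ⊢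
  refine .div (.prod _ fun i _ => hu.sub (hcontent i))
    (.prod _ fun i _ => (hu.add (.one k _)).sub (hcontent i)) ?_
  simpa using (map_ne_zero (algebraMap ℂ (RatField N))).2 (prod_ne_zero_iff.2 fun i _ => hden i)

theorem addRatio_addNode_evaluatesTo {N : ℕ} (k : Fin N) {ν : Fin m → YoungDiagram}
    {a a' : AddNode ν} (h : a'.1 = a.1) :
    EvaluatesTo k (content (AddNode.node a)) (addRatio (ν a'.1) a'.2.1 (uVar k))
      (algebraMap ℂ _ (if a' = a then fCoeff ν / fCoeff (addNode ν a) else 0)) := by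
  rw [← addRatio_addNode a a' h]
  obtain ⟨κ, x⟩ := a
  obtain ⟨κ', x'⟩ := a'
  obtain rfl : κ' = κ := h
  exact addRatio_evaluatesTo k x x'.1

end AddRatio

section PhiScalarEvaluation

variable {m n : ℕ} {μ μ' : Fin m → YoungDiagram} {w w' : Fin (n + 1) → Node m}

theorem prod_partialShape {M : Type*} [CommMonoid M] (h : IsStandard μ w) (k : Fin (n + 1))
    (κ : Fin m) (f : ℕ × ℕ → M) :
    ∏ q ∈ (partialShape h k κ).cells, f q =
      ∏ i ∈ Iio k, if (w i).1 = κ then f (w i).2 else 1 := by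
  rw [← prod_filter]
  symm
  refine prod_bij (fun i _ => (w i).2) (fun i hi => ?_) (fun i hi j hj hij => ?_)
    (fun q hq => ?_) fun _ _ => rfl
  · rw [mem_filter, mem_Iio] at hi
    rw [YoungDiagram.mem_cells, ← hi.2, mem_partialShape]
    exact ⟨i, hi.1, rfl⟩
  · rw [mem_filter] at hi hj
    exact h.inj (Prod.ext (hi.2.trans hj.2.symm) hij)
  · rw [YoungDiagram.mem_cells, mem_partialShape (q := (κ, q))] at hq
    obtain ⟨i, hi, hw⟩ := hq
    exact ⟨i, mem_filter.2 ⟨mem_Iio.2 hi, by rw [hw]⟩, by rw [hw]⟩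

theorem partialShape_congr (h : IsStandard μ w) (h' : IsStandard μ' w') {k : ℕ}
    (hww' : ∀ i : Fin (n + 1), i.1 < k → w i = w' i) : partialShape h k = partialShape h' k :=
  shape_ext fun q => by
    rw [mem_partialShape, mem_partialShape]
    exact exists_congr fun i => and_congr_right fun hi => by rw [hww' i hi]

theorem phiScalar_eq_addRatio {K : Type*} [Field K] {u : K} (hu : ∀ z : ℤ, u - z ≠ 0)
    (h : IsStandard μ w) (k : Fin (n + 1)) {ν : Fin m → YoungDiagram} (hν : partialShape h k = ν)
    (a : AddNode ν) (ha : AddNode.node a = w k) :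
    phiScalar u a.1 w k = addRatio (ν a.1) a.2.1 u := by
  subst hν
  have hprod : ∏ i ∈ Iio k, (1 - poleFactor u a.1 (w i) ^ 2) =
      ∏ q ∈ (partialShape h k a.1).cells, (1 - 1 / (u - (((q.2 : ℤ) - q.1 : ℤ) : K)) ^ 2) := by
    rw [prod_partialShape]
    refine prod_congr rfl fun i _ => ?_
    unfold poleFactor
    split_ifs <;> simp [content]
  have hpole : poleFactor u a.1 (w k) = (u - rowContent (partialShape h k a.1) a.2.1)⁻¹ := by
    rw [← ha]
    exact if_pos rfl
  have hx : a.2.1 ∈ range ((partialShape h k a.1).colLen 0 + 1 + 1) :=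
    mem_range.2 (by have := a.2.2.le_colLen; omega)
  have hne := hu (rowContent (partialShape h k a.1) a.2.1)
  rw [phiScalar, hpole, hprod, mul_right_comm, mul_prod_cells_one_sub_inv_sq hu (Nat.le_succ _),
    ← mul_prod_erase _ _ hx, addRatio]
  simp only [Nat.succ_eq_add_one]
  field_simp

theorem phiScalar_evaluatesTo (h : IsStandard μ w) (h' : IsStandard μ' w') (k : Fin (n + 1))
    (hww' : ∀ i, i < k → w' i = w i) :
    EvaluatesTo k (content (w k)) (phiScalar (uVar k) (w k).1 w' k)
      (algebraMap ℂ (RatField (n + 1)) (if w' k = w k then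
        fCoeff (partialShape h k) / fCoeff (partialShape h (k + 1)) else 0)) := by
  have hshape : partialShape h' k = partialShape h k := partialShape_congr h' h hww'
  obtain ⟨a, ha, hadd⟩ := exists_addNode h k
  obtain ⟨a', ha'⟩ : ∃ a' : AddNode (partialShape h k), AddNode.node a' = w' k := by
    rw [← hshape]
    exact (exists_addNode h' k).imp fun _ => And.left
  have hwa : w' k = w k ↔ a' = a := by rw [← ha, ← ha', AddNode.node_injective.eq_iff]
  by_cases hκ : a'.1 = a.1
  · have hpos : (w k).1 = a'.1 := by rw [hκ, ← ha]; rfl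
    rw [hpos, phiScalar_eq_addRatio (uVar_sub_intCast_ne_zero k) h' k hshape a' ha', ← hadd,
      if_congr hwa rfl rfl, ← ha]
    exact addRatio_addNode_evaluatesTo k hκ
  · have hne : w' k ≠ w k := fun hw => hκ (by rw [hwa.1 hw])
    have hpos : (w' k).1 ≠ (w k).1 := by rwa [← ha, ← ha']
    rw [phiScalar, poleFactor, if_neg hpos, if_neg hne, mul_zero, zero_mul, map_zero]
    exact .zero _ _

end PhiScalarEvaluation

/-! ### The consecutive evaluations -/

section ConsecutiveEvaluation

variable {m n : ℕ} {lam μ : Fin m → YoungDiagram} (ξ : Fin m ≃ rootsOfUnity m ℂ)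
  (T : StdTableau n lam)

/-- The spectral parameters after the evaluation of the first `k` variables at the contents. -/
noncomputable def params (k : ℕ) (i : Fin (n + 1)) : RatField (n + 1) :=
  if i.1 < k then algebraMap ℂ _ (content (T.node i) : ℂ) else uVar i

theorem params_of_lt {k : ℕ} {i : Fin (n + 1)} (h : i.1 < k) :
    params T k i = algebraMap ℂ _ (content (T.node i) : ℂ) := if_pos h

theorem params_of_le {k : ℕ} {i : Fin (n + 1)} (h : k ≤ i.1) : params T k i = uVar i :=
  if_neg h.not_gt

theorem params_evaluatesTo (k i : Fin (n + 1)) :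
    EvaluatesTo k (T.c k) (params T k i) (params T (k + 1) i) := by
  rcases lt_trichotomy i k with h | rfl | h
  · rw [params_of_lt T h, params_of_lt T (Nat.lt_succ_of_lt h)]
    exact .const _ _ _
  · rw [params_of_le T le_rfl, params_of_lt T (Nat.lt_succ_self _)]
    exact .uVar_self _ _
  · rw [params_of_le T (Fin.lt_def.1 h).le, params_of_le T (Nat.succ_le_of_lt h)]
    exact .uVar_of_ne h.ne' _

/-- The product `φ_{n+1} ⋯ φ_{l+1}` of the leading factors of `Φ`, for the positions of `T`. -/
noncomputable def phiLeading (us : Fin (n + 1) → RatField (n + 1)) (l : ℕ) :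
    MonoidAlgebra (RatField (n + 1)) (G m n) :=
  (((List.finRange (n + 1)).drop l).reverse.map fun j =>
    phi m (T.p ξ) us (T.p ξ j) (us j) j).prod

theorem phiLeading_zero (us : Fin (n + 1) → RatField (n + 1)) :
    phiLeading ξ T us 0 = Phi m (T.p ξ) us := rfl

theorem phiLeading_last (us : Fin (n + 1) → RatField (n + 1)) : phiLeading ξ T us (n + 1) = 1 := by
  rw [phiLeading, List.drop_eq_nil_of_le (by simp), List.reverse_nil, List.map_nil, List.prod_nil]

theorem phiLeading_eq_mul (us : Fin (n + 1) → RatField (n + 1)) (k : Fin (n + 1)) :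
    phiLeading ξ T us k = phiLeading ξ T us (k + 1) * phi m (T.p ξ) us (T.p ξ k) (us k) k := by
  rw [phiLeading, phiLeading, List.drop_eq_getElem_cons (by rw [List.length_finRange]; exact k.2),
    List.reverse_cons, List.map_append, List.prod_append]
  simp

theorem phiLeading_evaluatesTo (k : Fin (n + 1)) :
    AlgEvaluatesTo k (T.c k) (phiLeading ξ T (params T k) (k + 1))
      (phiLeading ξ T (params T (k + 1)) (k + 1)) := by
  refine AlgEvaluatesTo.list_prod _ fun j hj => ?_
  have hkj : k.1 + 1 ≤ j.1 := by
    rw [List.mem_reverse] at hj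
    obtain ⟨i, hi, rfl⟩ := List.mem_iff_getElem.1 hj
    simp
  refine AlgEvaluatesTo.phi _ _ (params_evaluatesTo T k j) (params_evaluatesTo T k) fun i hi => ?_
  rw [params_of_le T hkj]
  rcases lt_or_ge i.1 (k.1 + 1) with hik | hik
  · rw [params_of_lt T hik]
    exact uVar_sub_algebraMap_ne_zero _ _
  · rw [params_of_le T hik]
    exact sub_ne_zero.2 (uVar_injective.ne hi.ne')

/-- The tableau `S` has the numbers `1, …, k` in the same nodes as `T`. -/
def AgreesUpTo (k : ℕ) (S : StdTableau n μ) : Prop :=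
  ∀ i : Fin (n + 1), i.1 < k → S.node i = T.node i

open Classical in
/-- The eigenvalue on `e_S` of the product `φ_k ⋯ φ_1` evaluated at the contents of `T`. -/
noncomputable def stageScalar (k : ℕ) (S : StdTableau n μ) : ℂ :=
  if AgreesUpTo T k S then (fCoeff (partialShape T.std k))⁻¹ else 0

/-- `Y` acts on the semi-normal bases like `φ_k ⋯ φ_1` after the evaluation of its variables. -/
def IsStage (k : ℕ) (Y : MonoidAlgebra ℂ (G m n)) : Prop :=
  ∀ μ : Fin m → YoungDiagram, matAlg ξ μ ℂ Y = Matrix.diagonal (stageScalar T k)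

variable {ξ T}

theorem agreesUpTo_add_one {k : Fin (n + 1)} {S : StdTableau n μ} :
    AgreesUpTo T (k + 1) S ↔ AgreesUpTo T k S ∧ S.node k = T.node k := by
  refine ⟨fun h => ⟨fun i hi => h i (Nat.lt_succ_of_lt hi), h k (Nat.lt_succ_self _)⟩, ?_⟩
  rintro ⟨h, hk⟩ i hi
  rcases (Nat.lt_succ_iff.1 hi).lt_or_eq with hi | hi
  · exact h i hi
  · rwa [Fin.ext hi]

theorem IsStage.eq {k : ℕ} {Y Y' : MonoidAlgebra ℂ (G m n)} (hY : IsStage ξ T k Y)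
    (hY' : IsStage ξ T k Y') : Y = Y' :=
  eq_of_forall_matAlg_eq ξ fun μ => (hY μ).trans (hY' μ).symm

theorem isStage_zero : IsStage ξ T 0 1 := by
  intro μ
  have hone : stageScalar T 0 = fun _ : StdTableau n μ => 1 := by
    funext S
    have hagree : AgreesUpTo T 0 S := fun i hi => absurd hi (Nat.not_lt_zero _)
    rw [stageScalar, if_pos hagree, partialShape_zero]
    simp [fCoeff]
  rw [hone, map_one, Matrix.diagonal_one]

theorem matAlg_phi_mul_of_isStage {k : Fin (n + 1)} {Y : MonoidAlgebra ℂ (G m n)}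
    (hY : IsStage ξ T k Y) (μ : Fin m → YoungDiagram) :
    matAlg ξ μ (RatField (n + 1))
      (phi m (T.p ξ) (params T k) (T.p ξ k) (params T k k) k *
        MonoidAlgebra.mapRingHom (G m n) (algebraMap ℂ (RatField (n + 1))) Y) =
      Matrix.diagonal fun S => phiScalar (uVar k) (T.node k).1 S.node k *
        algebraMap ℂ _ (stageScalar T k S) := by
  rw [map_mul, matAlg_mapRingHom, hY μ, params_of_le T le_rfl, Matrix.diagonal_map (map_zero _)]
  ext S' S
  rw [Matrix.mul_diagonal]
  by_cases hS : AgreesUpTo T k S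
  · have hphi := congrFun (matAlg_phi_mulVec ξ (μ := μ) (vs := T.p ξ) (us := params T k)
      (uVar_sub_intCast_ne_zero k) (T.node k).1 k S.node fun i hi => by
        rw [hS i hi, params_of_lt T hi, map_intCast]
        exact ⟨rfl, rfl⟩) S'
    rw [vec_coe, castVec_single, Matrix.mulVec_single_one, Matrix.col_apply] at hphi
    rw [StdTableau.p, hphi]
    by_cases h : S' = S
    · subst h; simp
    · simp [h]
  · have hzero : stageScalar T k S = 0 := if_neg hS
    rw [hzero, map_zero, mul_zero, Matrix.diagonal_apply]
    split_ifs with h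
    · rw [h, hzero, map_zero, mul_zero]
    · rfl

theorem stageScalar_evaluatesTo (k : Fin (n + 1)) (S : StdTableau n μ) :
    EvaluatesTo k (T.c k) (phiScalar (uVar k) (T.node k).1 S.node k *
      algebraMap ℂ _ (stageScalar T k S)) (algebraMap ℂ _ (stageScalar T (k + 1) S)) := by
  classical
  by_cases hS : AgreesUpTo T k S
  · have hnext : stageScalar T (k + 1) S = (if S.node k = T.node k then
        fCoeff (partialShape T.std k) / fCoeff (partialShape T.std (k + 1)) else 0) *
          stageScalar T k S := by
      have := fCoeff_ne_zero (partialShape T.std k)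
      rw [stageScalar, stageScalar, if_pos hS,
        if_congr (agreesUpTo_add_one.trans (and_iff_right hS)) rfl rfl]
      split_ifs
      · field_simp
      · rw [zero_mul]
    rw [hnext, map_mul]
    exact (phiScalar_evaluatesTo T.std S.std k hS).mul (.const k _ _)
  · rw [stageScalar, stageScalar, if_neg hS, if_neg fun h => hS (agreesUpTo_add_one.1 h).1,
      map_zero, mul_zero]
    exact .zero _ _

theorem IsStage.exists_add_one {k : Fin (n + 1)} {Y : MonoidAlgebra ℂ (G m n)}
    (hY : IsStage ξ T k Y) :
    ∃ Y', IsStage ξ T (k + 1) Y' ∧ AlgEvaluatesTo k (T.c k)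
      (phi m (T.p ξ) (params T k) (T.p ξ k) (params T k k) k *
        MonoidAlgebra.mapRingHom (G m n) (algebraMap ℂ (RatField (n + 1))) Y)
      (MonoidAlgebra.mapRingHom (G m n) (algebraMap ℂ (RatField (n + 1))) Y') :=
  exists_evaluatesTo_of_diagonal ξ (matAlg_phi_mul_of_isStage hY) fun _ S =>
    stageScalar_evaluatesTo k S

variable (ξ T)

theorem exists_isStage {k : ℕ} (hk : k ≤ n + 1) : ∃ Y, IsStage ξ T k Y := by
  induction k with
  | zero => exact ⟨1, isStage_zero⟩
  | succ k ih =>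
    obtain ⟨Y, hY⟩ := ih (by omega)
    obtain ⟨Y', hY', -⟩ := hY.exists_add_one (k := ⟨k, hk⟩)
    exact ⟨Y', hY'⟩

theorem exists_consecutiveEvaluation :
    ∃ X, IsStage ξ T (n + 1) X ∧
      ConsecutiveEvaluation (Phi m (T.p ξ) uVar) (fun i => ((T.c i : ℤ) : ℂ)) X := by
  choose Y hY using fun k : Fin (n + 2) => exists_isStage ξ T (Nat.lt_succ_iff.1 k.2)
  refine ⟨Y (Fin.last _), hY _, fun k => phiLeading ξ T (params T k) k *
    MonoidAlgebra.mapRingHom (G m n) (algebraMap ℂ (RatField (n + 1))) (Y k), ?_, fun k => ?_, ?_⟩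
  · have hparams : params T 0 = uVar := funext fun i => params_of_le T (Nat.zero_le _)
    beta_reduce
    rw [(hY 0).eq isStage_zero, map_one, mul_one, Fin.val_zero, hparams, phiLeading_zero]
  · obtain ⟨Y', hY', hev⟩ := IsStage.exists_add_one (k := k) (hY k.castSucc)
    beta_reduce
    rw [(hY k.succ).eq hY', Fin.val_castSucc, Fin.val_succ, phiLeading_eq_mul, mul_assoc]
    exact (phiLeading_evaluatesTo ξ T k).mul hev
  · beta_reduce
    rw [Fin.val_last, phiLeading_last, one_mul]

end ConsecutiveEvaluation

/-! ### The idempotent of a standard tableau -/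

section TableauIdempotent

variable {m n : ℕ} {lam : Fin m → YoungDiagram} {ξ : Fin m ≃ rootsOfUnity m ℂ}
  {T : StdTableau n lam} {E E' a : MonoidAlgebra ℂ (G m n)}

theorem matAlg_eq_diagonal_iff {μ : Fin m → YoungDiagram} {z : StdTableau n μ → ℂ} :
    matAlg ξ μ ℂ a = Matrix.diagonal z ↔ ∀ S,
      (seminormalRep n ξ μ).asAlgebraHom a (Finsupp.single S 1) = z S • Finsupp.single S 1 := by
  rw [← Matrix.ext_iff, forall_comm]
  refine forall_congr' fun S => Iff.trans (forall_congr' fun S' => ?_) Finsupp.ext_iff.symm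
  rw [matAlg_apply_eq_asAlgebraHom]
  by_cases h : S' = S
  · subst h; simp
  · simp [h]

open Classical in
theorem isTableauIdempotent_iff : IsTableauIdempotent ξ T E ↔ ∀ μ,
    matAlg ξ μ ℂ E = Matrix.diagonal fun S => if S.node = T.node then 1 else 0 := by
  simp only [matAlg_eq_diagonal_iff, ite_smul, one_smul, zero_smul]
  constructor
  · intro h μ S
    split_ifs with hS
    · obtain rfl : μ = lam := S.std.shape_unique (hS ▸ T.std)
      rw [StdTableau.node_injective hS, h.self]
    · by_cases hμ : μ = lam
      · subst hμ
        exact h.of_ne S fun hST => hS (by rw [hST])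
      · rw [h.of_shape_ne μ hμ, LinearMap.zero_apply]
  · refine fun h => ⟨(h lam T).trans (if_pos rfl), fun S hS => (h lam S).trans (if_neg ?_),
      fun μ hμ => ?_⟩
    · exact fun hST => hS (StdTableau.node_injective hST)
    · refine Finsupp.lhom_ext' fun S => LinearMap.ext_ring ((h μ S).trans (if_neg fun hST => ?_))
      exact hμ (S.std.shape_unique (hST ▸ T.std))

theorem IsStage.isTableauIdempotent {X : MonoidAlgebra ℂ (G m n)} (h : IsStage ξ T (n + 1) X) :
    IsTableauIdempotent ξ T (fCoeff lam • X) := by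
  classical
  refine isTableauIdempotent_iff.2 fun μ => ?_
  rw [map_smul, h μ, ← Matrix.diagonal_smul]
  congr 1
  funext S
  have hagree : AgreesUpTo T (n + 1) S ↔ S.node = T.node :=
    ⟨fun hS => funext fun i => hS i i.2, fun hS i _ => congrFun hS i⟩
  have := fCoeff_ne_zero lam
  rw [Pi.smul_apply, stageScalar, partialShape_add_one_eq, if_congr hagree rfl rfl, smul_ite,
    smul_zero, smul_eq_mul, mul_inv_cancel₀ this]

theorem IsTableauIdempotent.eq (h : IsTableauIdempotent ξ T E) (h' : IsTableauIdempotent ξ T E') :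
    E = E' :=
  eq_of_forall_matAlg_eq ξ fun μ =>
    (isTableauIdempotent_iff.1 h μ).trans (isTableauIdempotent_iff.1 h' μ).symm

theorem IsTableauIdempotent.ne_zero (h : IsTableauIdempotent ξ T E) : E ≠ 0 := by
  rintro rfl
  exact one_ne_zero (Finsupp.single_eq_zero.1 (h.self.symm.trans (by rw [map_zero]; rfl)))

theorem IsTableauIdempotent.isIdempotentElem (h : IsTableauIdempotent ξ T E) :
    IsIdempotentElem E := by
  refine IsTableauIdempotent.eq (ξ := ξ) (T := T) (isTableauIdempotent_iff.2 fun μ => ?_) h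
  rw [map_mul, isTableauIdempotent_iff.1 h, Matrix.diagonal_mul_diagonal]
  simp

theorem IsTableauIdempotent.eq_smul (h : IsTableauIdempotent ξ T E) (hEa : E * a = a)
    (haE : a * E = a) : a = matAlg ξ lam ℂ a T T • E := by
  classical
  refine eq_of_forall_matAlg_eq ξ fun μ => Matrix.ext fun S S' => ?_
  have hE := isTableauIdempotent_iff.1 h μ
  have hentry : matAlg ξ μ ℂ a S S' = (if S.node = T.node then 1 else 0) *
      matAlg ξ μ ℂ a S S' * (if S'.node = T.node then 1 else 0) := by
    conv_lhs => rw [← haE, ← hEa, map_mul, map_mul, hE, Matrix.mul_diagonal, Matrix.diagonal_mul]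
  rw [hentry, map_smul, hE, Matrix.smul_apply, Matrix.diagonal_apply]
  by_cases hS : S.node = T.node
  · obtain rfl : μ = lam := S.std.shape_unique (hS ▸ T.std)
    obtain rfl := StdTableau.node_injective hS
    by_cases hS' : S = S'
    · subst hS'; simp
    · simp [hS', StdTableau.node_injective.eq_iff, Ne.symm hS']
  · simp [hS]

theorem IsTableauIdempotent.isPrimitiveIdempotent (h : IsTableauIdempotent ξ T E) :
    IsPrimitiveIdempotent E := by
  refine ⟨h.isIdempotentElem, h.ne_zero, fun a b ha _ hab hba hsum => ?_⟩
  have hEa : E * a = a := by rw [← hsum, add_mul, ha.eq, hba, add_zero]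
  have haE : a * E = a := by rw [← hsum, mul_add, ha.eq, hab, add_zero]
  obtain ⟨c, hc⟩ : ∃ c : ℂ, a = c • E := ⟨_, h.eq_smul hEa haE⟩
  have hcc : (c * c) • E = c • E := by
    rw [← hc, ← ha.eq, hc, smul_mul_smul_comm, h.isIdempotentElem.eq]
  rcases eq_zero_or_one_of_sq_eq_self (pow_two c ▸ smul_left_injective ℂ h.ne_zero hcc) with h0 | h1
  · left; rw [hc, h0, zero_smul]
  · right; exact add_eq_left.1 (hsum.trans (by rw [hc, h1, one_smul]))

end TableauIdempotent

end CyclotomicFusion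

open CyclotomicFusion in
theorem theorem2 (m n : ℕ) (hm : 1 ≤ m) (ξ : Fin m ≃ rootsOfUnity m ℂ)
    (lam : Fin m → YoungDiagram) (hlam : ∑ k, (lam k).card = n + 1) (T : StdTableau n lam) :
    ∃ E : MonoidAlgebra ℂ (G m n),
      IsPrimitiveIdempotent E ∧
      (∀ E' : MonoidAlgebra ℂ (G m n), IsTableauIdempotent ξ T E' ↔ E' = E) ∧
      ∃ X : MonoidAlgebra ℂ (G m n),
        ConsecutiveEvaluation (Phi m (T.p ξ) uVar) (fun i => ((T.c i : ℤ) : ℂ)) X ∧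
        E = fCoeff lam • X := by
  obtain ⟨X, hX, hev⟩ := exists_consecutiveEvaluation ξ T
  have hE := hX.isTableauIdempotent
  exact ⟨fCoeff lam • X, hE.isPrimitiveIdempotent,
    fun E' => ⟨fun h => h.eq hE, fun h => h ▸ hE⟩, X, hev, rfl⟩
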